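/- Let $n\ge 2$, let $K\subset\mathbb{R}^n$ be a convex body (compact, convex) with the origin in its interior, let $U\supset K$ be an open set, and let $\varphi,\psi:U\to(0,\infty)$ be continuous and Lebesgue integrable. For measurable $A\subset\mathbb{R}^n$ put $\operatorname{vol}_n^{\varphi}(A)=\int_{A\cap U}\varphi\,d\lambda_n$, where $\lambda_n$ is Lebesgue measure, and similarly for $\psi$. For $\delta>0$ the $\varphi$-weighted illumination body of $K$ is $$\mathcal{I}_\delta^\varphi(K)=\{x\in\mathbb{R}^n:\operatorname{vol}_n^\varphi([x,K]\setminus K)\le\delta\},\qquad [x,K]=\operatorname{conv}(\{x\}\cup K).$$ For $x\in\partial K$ let $H_{n-1}(K,x)$ denote the generalized Gauss--Kronecker curvature: if $K$ has a unique outer unit normal $N$ at $x$, and the convex function $f$ on $N^\perp$ near $0$ whose graph describes $\partial K$ near $x$ (that is, $f(y)=\min\{t: x+y-tN\in K\}$) satisfies $f(y)=\frac12\langle Ay,y\rangle+o(\|y\|^2)$ as $y\to0$ for a self-adjoint linear map $A:N^\perp\to N^\perp$, then $H_{n-1}(K,x)=\det A$. This is the case for $\mathcal{H}^{n-1}$-almost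 every $x\in\partial K$; elsewhere put $H_{n-1}(K,x)=0$. Then the integral on the right-hand side below is finite, and $$\lim_{\delta\to0^+}\frac{\operatorname{vol}_n^{\psi}(\mathcal{I}_\delta^\varphi(K))-\operatorname{vol}_n^{\psi}(K)}{\delta^{\frac{2}{n+1}}}=c_n\int_{\partial K}H_{n-1}(K,x)^{\frac1{n+1}}\,\varphi(x)^{-\frac{2}{n+1}}\,\psi(x)\,d\mathcal{H}^{n-1}(x),$$ where $\mathcal{H}^{n-1}$ is the $(n-1)$-dimensional Hausdorff measure (normalized to agree with Lebesgue measure on $\mathbb{R}^{n-1}$) and, with $B_2^{n-1}$ the Euclidean unit ball of $\mathbb{R}^{n-1}$, $$c_n=\frac12\left(\frac{n(n+1)}{\operatorname{vol}_{n-1}(B_2^{n-1})}\right)^{\frac{2}{n+1}}.$$ -/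

import Mathlib

open Set Filter Topology MeasureTheory Asymptotics

noncomputable section

namespace Illumination

/-- `[x, K] = conv ({x} ∪ K)`. -/
def hullWith {n : ℕ} (x : EuclideanSpace ℝ (Fin n)) (K : Set (EuclideanSpace ℝ (Fin n))) :
    Set (EuclideanSpace ℝ (Fin n)) :=
  convexHull ℝ ({x} ∪ K)

/-- The weighted volume `vol^φ (A) = ∫_{A ∩ U} φ dλ`, as a measure on `ℝⁿ`. Only the values of the
weight `φ` on `U` matter. -/
def weightedVol {n : ℕ} (U : Set (EuclideanSpace ℝ (Fin n))) (φ : EuclideanSpace ℝ (Fin n) → ℝ) :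
    Measure (EuclideanSpace ℝ (Fin n)) :=
  (volume.restrict U).withDensity fun x => ENNReal.ofReal (φ x)

/-- The `φ`-weighted illumination body
`I_δ^φ (K) = {x ∈ ℝⁿ : vol^φ ([x, K] \ K) ≤ δ}`. -/
def illuminationBody {n : ℕ} (U : Set (EuclideanSpace ℝ (Fin n)))
    (φ : EuclideanSpace ℝ (Fin n) → ℝ) (K : Set (EuclideanSpace ℝ (Fin n))) (δ : ℝ) :
    Set (EuclideanSpace ℝ (Fin n)) :=
  {x | weightedVol U φ (hullWith x K \ K) ≤ ENNReal.ofReal δ}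

/-- `N` is an outer unit normal vector of `K` at `x`. -/
def IsOuterUnitNormal {n : ℕ} (K : Set (EuclideanSpace ℝ (Fin n)))
    (x N : EuclideanSpace ℝ (Fin n)) : Prop :=
  ‖N‖ = 1 ∧ ∀ y ∈ K, inner ℝ N (y - x) ≤ 0

/-- The boundary of `K` near `x`, written as a graph over the hyperplane `x + N^⊥`: the point
of `∂K` above `x + y`, as seen from the outside, is `x + y - f(y) N`. If `K` is a convex body and
`N` is its only outer unit normal at `x`, then the set below is nonempty for all small `y`, it is
always bounded below, and `f` is convex near `0`. -/
def boundaryGraph {n : ℕ} (K : Set (EuclideanSpace ℝ (Fin n)))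
    (x N : EuclideanSpace ℝ (Fin n)) (y : (Submodule.span ℝ {N})ᗮ) : ℝ :=
  sInf {t : ℝ | x + (y : EuclideanSpace ℝ (Fin n)) - t • N ∈ K}

/-- `x` is a normal boundary point of `K` with generalized Gauss–Kronecker curvature `κ`: the outer
unit normal `N` at `x` is unique, the boundary is at `x` twice differentiable in the sense of
Alexandrov, that is, `f(y) = ⟨A y, y⟩ / 2 + o(‖y‖²)` for a self-adjoint endomorphism `A` of
`N^⊥`, and `κ = det A`. -/
def HasGaussKroneckerCurvature {n : ℕ} (K : Set (EuclideanSpace ℝ (Fin n)))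
    (x : EuclideanSpace ℝ (Fin n)) (κ : ℝ) : Prop :=
  ∃ N : EuclideanSpace ℝ (Fin n),
    IsOuterUnitNormal K x N ∧ (∀ N', IsOuterUnitNormal K x N' → N' = N) ∧
    ∃ A : (Submodule.span ℝ {N})ᗮ →ₗ[ℝ] (Submodule.span ℝ {N})ᗮ,
      A.IsSymmetric ∧
      (fun y : (Submodule.span ℝ {N})ᗮ => boundaryGraph K x N y - inner ℝ (A y) y / 2)
        =o[𝓝 0] (fun y : (Submodule.span ℝ {N})ᗮ => ‖y‖ ^ 2) ∧
      κ = LinearMap.det A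

open Classical in
/-- The generalized Gauss–Kronecker curvature `H_{n-1}(K, x)`. It is defined at the normal boundary
points of `K`, hence almost everywhere on `∂K`, and is set to `0` elsewhere. -/
def gaussKronecker {n : ℕ} (K : Set (EuclideanSpace ℝ (Fin n)))
    (x : EuclideanSpace ℝ (Fin n)) : ℝ :=
  if h : ∃ κ, HasGaussKroneckerCurvature K x κ then h.choose else 0

/-- `c_n = (1/2) (n (n + 1) / vol_{n-1}(B^{n-1}))^{2/(n+1)}`. -/
def illuminationConst (n : ℕ) : ℝ :=
  1 / 2 * ((n : ℝ) * ((n : ℝ) + 1) /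
    volume.real (Metric.closedBall (0 : EuclideanSpace ℝ (Fin (n - 1))) 1)) ^ (2 / ((n : ℝ) + 1))

end Illumination

end

/-! Describe `K` by its gauge `g`, so that `K = {g ≤ 1}` and `∂K = {g = 1}`. Polar coordinates
adapted to `∂K` (`BodyGauge.polar`) give `∫ F = ∫_{∂K} ‖∇g(x)‖⁻¹ ∫_0^∞ F(t x) t^(n-1) dt
dH^(n-1)(x)`. The ψ-volume of the shell between `K` and its illumination body thus becomes a
boundary integral of ψ-weighted ray lengths. It remains to find the limit of these lengths, divided
by `δ^(2/(n+1))`, at almost every `x`, and to dominate them.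

Pointwise limit. By Alexandrov's theorem the convex function `g` has a second order expansion, with
gradient `p` and symmetric `B`, almost everywhere in space. Since `g` is homogeneous, this passes to
almost every boundary point. In the parabolic coordinates `x + √t y + t σ x` the set `K` becomes in
the limit `σ + q(y) ≤ 0` with `q(y) = ⟨B y, y⟩ / 2`, and the apex `(1 + t) x` becomes `(0, 1)`. The
part of the convex hull outside `K`, the cap, turns into `-q < σ < 1 - 2√q`, `q < 1`, whose volume
is the integral of `(1 - √q)²` over `q < 1`, an explicit constant divided by `√det`. With `κ =
det(B|p^⊥) / ‖p‖^(n-1)` the Gauss–Kronecker curvature (`gaussKronecker_eq_det`), the φ-volume of the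
cap is therefore `~ L t^((n+1)/2)` with an explicit `L`, infinite if `κ = 0` (`tendsto_capVolume`).
Caps grow along rays, so the ray through `x` leaves the illumination body at `t ~ (δ /
L)^(2/(n+1))`. Multiplying by `ψ / ‖p‖` gives `c_n κ^(1/(n+1)) φ^(-2/(n+1)) ψ`.

Domination. If a ball of radius `r` inside `K` touches `∂K` at `x`, the cap over `(1 + t) x` has
volume at least a constant times `r^((n-1)/2) t^((n+1)/2)` (`volume_cap_ge_of_rolling`), so the
rescaled ray length is at most a constant times `r^(-(n-1)/(n+1))`. The boundary points without such
a ball of radius `r` have measure `O(r)`, because an expanding map carries a slightly shrunken copy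
of `∂K` into the set of the other points (`exists_expanding`). As `(n-1)/(n+1) < 1`, the bound is
integrable (`exists_rolling_bound`). Dominated convergence then gives both the limit and the
finiteness of the integral. -/

noncomputable section

namespace Illumination

/-! ### Alexandrov's theorem by way of the proximal map -/

variable {E : Type*} [NormedAddCommGroup E] [InnerProductSpace ℝ E]

/-- `p` is a subgradient of `g` at `x`. -/
def IsSubgradient (g : E → ℝ) (x p : E) : Prop := ∀ y, g x + inner ℝ p (y - x) ≤ g y

lemma IsSubgradient.monotone {g : E → ℝ} {x y p q : E} (hp : IsSubgradient g x p)
    (hq : IsSubgradient g y q) : 0 ≤ inner ℝ (p - q) (x - y) := by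
  have h1 := hp y
  have h2 := hq x
  have h3 : inner ℝ p (y - x) = - inner ℝ p (x - y) := by rw [← inner_neg_right, neg_sub]
  rw [inner_sub_left]
  linarith

lemma IsSubgradient.norm_le {g : E → ℝ} {L : NNReal} (hL : LipschitzWith L g) {x p : E}
    (hp : IsSubgradient g x p) : ‖p‖ ≤ L := by
  have h1 := hp (x + p)
  have h2 := hL.dist_le_mul (x + p) x
  rw [Real.dist_eq, dist_eq_norm] at h2
  simp only [add_sub_cancel_left, real_inner_self_eq_norm_sq] at h1 h2
  have h3 := le_abs_self (g (x + p) - g x)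
  by_contra! h
  nlinarith [norm_nonneg p, L.coe_nonneg]

/-- The proximal map is firmly nonexpansive. -/
lemma IsSubgradient.firmly {g : E → ℝ} {x y z w : E} (hp : IsSubgradient g x (z - x))
    (hq : IsSubgradient g y (w - y)) : ‖x - y‖ ^ 2 ≤ inner ℝ (z - w) (x - y) := by
  have h := hp.monotone hq
  have e : z - x - (w - y) = (z - w) - (x - y) := by abel
  rw [e, inner_sub_left, real_inner_self_eq_norm_sq] at h
  linarith

/-- The point is the minimiser of `g + ‖· - z‖² / 2`, which is coercive because `g ≥ 0`. Comparing
it with `x + s (y - x)`, dividing by `s` and letting `s → 0` turns minimality into the subgradient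
inequality. -/
lemma exists_prox [FiniteDimensional ℝ E] {g : E → ℝ} (hg : ConvexOn ℝ univ g)
    (hc : Continuous g) (h0 : ∀ x, 0 ≤ g x) (z : E) : ∃ x, IsSubgradient g x (z - x) := by
  have hcont : Continuous fun x => g x + ‖x - z‖ ^ 2 / 2 := by fun_prop
  have htend : Tendsto (fun x => g x + ‖x - z‖ ^ 2 / 2) (cocompact E) atTop := by
    have h1 : Tendsto (fun x : E => ‖x - z‖) (cocompact E) atTop := by
      have := tendsto_norm_cocompact_atTop (E := E)
      exact this.comp (Homeomorph.subRight z).isClosedEmbedding.tendsto_cocompact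
    have h2 : Tendsto (fun x : E => ‖x - z‖ ^ 2 / 2) (cocompact E) atTop :=
      ((tendsto_pow_atTop two_ne_zero).comp h1).atTop_div_const two_pos
    exact tendsto_atTop_mono (fun x => by simpa using h0 x) h2
  obtain ⟨x, hx⟩ := hcont.exists_forall_le htend
  refine ⟨x, fun y => ?_⟩
  have key : ∀ s ∈ Ioc (0 : ℝ) 1, g x + inner ℝ (z - x) (y - x) - s * (‖y - x‖ ^ 2 / 2) ≤ g y := by
    rintro s ⟨hs0, hs1⟩
    have h1 := hx (x + s • (y - x))
    have h2 : g (x + s • (y - x)) ≤ (1 - s) * g x + s * g y := by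
      have := hg.2 (mem_univ x) (mem_univ y) (by linarith : 0 ≤ 1 - s) hs0.le (by ring)
      rw [smul_eq_mul, smul_eq_mul] at this
      refine le_of_eq_of_le (congrArg g ?_) this
      module
    have h3 : ‖x + s • (y - x) - z‖ ^ 2
        = ‖x - z‖ ^ 2 - 2 * s * inner ℝ (z - x) (y - x) + s ^ 2 * ‖y - x‖ ^ 2 := by
      have e : x + s • (y - x) - z = (x - z) + s • (y - x) := by abel
      rw [e, norm_add_sq_real, norm_smul, inner_smul_right, ← neg_sub z x, inner_neg_left,
        mul_pow, norm_neg, Real.norm_eq_abs, sq_abs]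
      ring
    simp only [h3] at h1
    have h4 : 0 ≤ s * (g y - g x - inner ℝ (z - x) (y - x) + s * (‖y - x‖ ^ 2 / 2)) := by nlinarith
    have := nonneg_of_mul_nonneg_right h4 hs0
    linarith
  have hlim : Tendsto (fun s : ℝ => g x + inner ℝ (z - x) (y - x) - s * (‖y - x‖ ^ 2 / 2))
      (𝓝[>] 0) (𝓝 (g x + inner ℝ (z - x) (y - x) - 0 * (‖y - x‖ ^ 2 / 2))) := by
    apply Tendsto.mono_left _ nhdsWithin_le_nhds
    exact (Continuous.tendsto (by fun_prop) 0)
  rw [zero_mul, sub_zero] at hlim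
  refine le_of_tendsto hlim ?_
  filter_upwards [Ioc_mem_nhdsGT (zero_lt_one' ℝ)] with s hs using key s hs

/-- The proximal points `y_k` of `g / (k + 1)` at `x` supply subgradients `(k + 1) (x - y_k)` of `g`
at `y_k`. These are bounded by `L`, hence `y_k → x`, and the limit of a convergent subsequence is a
subgradient at `x`. -/
lemma exists_subgradient [FiniteDimensional ℝ E] {g : E → ℝ} (hg : ConvexOn ℝ univ g)
    {L : NNReal} (hL : LipschitzWith L g) (h0 : ∀ x, 0 ≤ g x) (x : E) :
    ∃ p, IsSubgradient g x p := by
  have h1 : ∀ k : ℕ, ∃ y, IsSubgradient g y ((k + 1 : ℝ) • (x - y)) := by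
    intro k
    have hk : (0 : ℝ) < k + 1 := by positivity
    obtain ⟨y, hy⟩ := exists_prox (g := fun x => (k + 1 : ℝ)⁻¹ * g x)
      (hg.smul (by positivity)) (continuous_const.mul hL.continuous)
      (fun x => mul_nonneg (by positivity) (h0 x)) x
    refine ⟨y, fun w => ?_⟩
    have := hy w
    rw [real_inner_smul_left]
    have h2 := mul_le_mul_of_nonneg_left this hk.le
    rw [mul_add, mul_inv_cancel_left₀ hk.ne', mul_inv_cancel_left₀ hk.ne'] at h2
    exact h2
  choose y hy using h1
  set p : ℕ → E := fun k => (k + 1 : ℝ) • (x - y k) with hp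
  have hpb : ∀ k, p k ∈ Metric.closedBall (0 : E) L := fun k => by
    simpa using (hy k).norm_le hL
  obtain ⟨a, -, φ, hφ, ha⟩ := (isCompact_closedBall (0 : E) (L : ℝ)).tendsto_subseq hpb
  have hyx : Tendsto y atTop (𝓝 x) := by
    have e : ∀ k, y k = x - (1 / ((k : ℝ) + 1)) • p k := by
      intro k
      have : (0 : ℝ) < k + 1 := by positivity
      simp only [hp, smul_smul]
      rw [one_div_mul_cancel this.ne', one_smul, sub_sub_cancel]
    have h2 : Tendsto (fun k : ℕ => (1 / ((k : ℝ) + 1)) • p k) atTop (𝓝 0) := by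
      rw [tendsto_zero_iff_norm_tendsto_zero]
      refine squeeze_zero (fun _ => norm_nonneg _) (fun k => ?_)
        (g := fun k : ℕ => 1 / ((k : ℝ) + 1) * L)
        (by simpa using (tendsto_one_div_add_atTop_nhds_zero_nat (𝕜 := ℝ)).mul_const (L : ℝ))
      have hk : (0 : ℝ) ≤ 1 / (k + 1) := by positivity
      rw [norm_smul, Real.norm_of_nonneg hk]
      exact mul_le_mul_of_nonneg_left (by simpa using hpb k) hk
    have h3 := (tendsto_const_nhds (x := x)).sub h2
    rw [sub_zero] at h3
    exact h3.congr fun k => (e k).symm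
  refine ⟨a, fun w => ?_⟩
  have h4 : Tendsto (fun k => g (y (φ k)) + inner ℝ (p (φ k)) (w - y (φ k))) atTop
      (𝓝 (g x + inner ℝ a (w - x))) := by
    have h5 := hyx.comp hφ.tendsto_atTop
    exact ((hL.continuous.tendsto x).comp h5).add (ha.inner (tendsto_const_nhds.sub h5))
  exact le_of_tendsto h4 (Eventually.of_forall fun k => hy (φ k) w)

/-- One-dimensional integration of subgradients: if the subgradients along a segment are
`κ`-close to `a + s b`, then the increment of the function is `κ`-close to `a + b / 2`. -/
lemma abs_sub_le_of_subgradients {f m : ℝ → ℝ} {a b κ : ℝ}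
    (hm : ∀ s ∈ Icc (0 : ℝ) 1, ∀ t ∈ Icc (0 : ℝ) 1, f s + m s * (t - s) ≤ f t)
    (hκ : ∀ s ∈ Icc (0 : ℝ) 1, |m s - (a + s * b)| ≤ κ) :
    |f 1 - f 0 - a - b / 2| ≤ κ := by
  have key : ∀ n : ℕ, |f 1 - f 0 - a - b / 2| ≤ κ + |b| / 2 * (1 / ((n : ℝ) + 1)) := by
    intro n
    set N : ℝ := (n : ℝ) + 1 with hN
    have hN0 : 0 < N := by positivity
    -- Subgradients at the two endpoints bracket the increment on a subinterval. Both lie within `κ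
    -- + |b| / (2N)` of the slope at the midpoint `(2i + 1) / (2N)`, and the midpoint rule is exact
    -- for the affine function `a + s b`.
    have step : ∀ i ∈ Finset.range (n + 1),
        |f ((i + 1 : ℕ) / N) - f ((i : ℕ) / N) - (a + (2 * i + 1) / (2 * N) * b) / N|
          ≤ (κ + |b| / (2 * N)) / N := by
      intro i hi
      have hi' : (i : ℝ) + 1 ≤ N := by
        have := Finset.mem_range.1 hi
        rw [hN]; exact_mod_cast this
      have hs : (i : ℝ) / N ∈ Icc (0 : ℝ) 1 :=
        ⟨by positivity, by rw [div_le_one hN0]; linarith⟩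
      have ht : ((i + 1 : ℕ) : ℝ) / N ∈ Icc (0 : ℝ) 1 :=
        ⟨by positivity, by rw [div_le_one hN0]; push_cast; linarith⟩
      have e : ((i + 1 : ℕ) : ℝ) / N - i / N = 1 / N := by push_cast; ring
      have h1 := hm _ hs _ ht
      have h2 := hm _ ht _ hs
      have e' : (i : ℝ) / N - ((i + 1 : ℕ) : ℝ) / N = - (1 / N) := by rw [← e]; ring
      rw [e] at h1
      rw [e'] at h2
      have h3 := abs_le.1 (hκ _ hs)
      have h4 := abs_le.1 (hκ _ ht)
      have hinv : 0 < 1 / N := by positivity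
      set D := f ((i + 1 : ℕ) / N) - f ((i : ℕ) / N) with hD
      have u1 : (a + i / N * b - κ) * (1 / N) ≤ D := by
        have := mul_le_mul_of_nonneg_right (show a + i / N * b - κ ≤ m (i / N) by linarith) hinv.le
        linarith
      have u2 : D ≤ (a + ((i + 1 : ℕ) : ℝ) / N * b + κ) * (1 / N) := by
        have := mul_le_mul_of_nonneg_right
          (show m (((i + 1 : ℕ) : ℝ) / N) ≤ a + ((i + 1 : ℕ) : ℝ) / N * b + κ by linarith) hinv.le
        linarith
      have hb1 : b / (2 * N) ≤ |b| / (2 * N) := by gcongr; exact le_abs_self b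
      have hb2 : -(|b| / (2 * N)) ≤ b / (2 * N) := by
        rw [← neg_div]; gcongr; exact neg_abs_le b
      rw [abs_le]
      constructor
      · have : (a + (2 * i + 1) / (2 * N) * b) / N - (κ + |b| / (2 * N)) / N
            ≤ (a + i / N * b - κ) * (1 / N) := by
          rw [← sub_div, mul_one_div]
          refine div_le_div_of_nonneg_right ?_ hN0.le
          have : (2 * (i : ℝ) + 1) / (2 * N) * b = i / N * b + b / (2 * N) := by field_simp
          linarith
        linarith
      · have : (a + ((i + 1 : ℕ) : ℝ) / N * b + κ) * (1 / N)
            ≤ (a + (2 * i + 1) / (2 * N) * b) / N + (κ + |b| / (2 * N)) / N := by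
          rw [← add_div, mul_one_div]
          refine div_le_div_of_nonneg_right ?_ hN0.le
          have : ((i + 1 : ℕ) : ℝ) / N * b = (2 * (i : ℝ) + 1) / (2 * N) * b + b / (2 * N) := by
            push_cast; field_simp; ring
          linarith
        linarith
    have hsum := (Finset.abs_sum_le_sum_abs _ _).trans (Finset.sum_le_sum step)
    rw [Finset.sum_sub_distrib, Finset.sum_range_sub (fun i => f ((i : ℕ) / N))] at hsum
    have e1 : ((n + 1 : ℕ) : ℝ) / N = 1 := by
      rw [hN]; push_cast; exact div_self (by positivity)
    have e2 : ∑ i ∈ Finset.range (n + 1), (a + (2 * (i : ℝ) + 1) / (2 * N) * b) / N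
        = a + b / 2 := by
      have h5 : ∀ k : ℕ, ∑ i ∈ Finset.range k, (2 * (i : ℝ) + 1) = k ^ 2 := by
        intro k
        induction k with
        | zero => simp
        | succ k ih => rw [Finset.sum_range_succ, ih]; push_cast; ring
      rw [← Finset.sum_div, Finset.sum_add_distrib, ← Finset.sum_mul, ← Finset.sum_div, h5]
      simp only [Finset.sum_const, Finset.card_range, nsmul_eq_mul]
      rw [show ((n + 1 : ℕ) : ℝ) = N by rw [hN]; push_cast; rfl]
      field_simp
    rw [e1, e2] at hsum
    simp only [Nat.cast_zero, zero_div, Finset.sum_const, Finset.card_range, nsmul_eq_mul] at hsum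
    rw [show ((n + 1 : ℕ) : ℝ) = N by rw [hN]; push_cast; rfl] at hsum
    calc |f 1 - f 0 - a - b / 2| = |f 1 - f 0 - (a + b / 2)| := by rw [sub_sub]
      _ ≤ N * ((κ + |b| / (2 * N)) / N) := hsum
      _ = κ + |b| / 2 * (1 / N) := by field_simp
  have hlim : Tendsto (fun n : ℕ => κ + |b| / 2 * (1 / ((n : ℝ) + 1))) atTop
      (𝓝 (κ + |b| / 2 * 0)) :=
    tendsto_const_nhds.add (tendsto_const_nhds.mul tendsto_one_div_add_atTop_nhds_zero_nat)
  rw [mul_zero, add_zero] at hlim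
  exact ge_of_tendsto' hlim key

/-- Since `J = (id + ∂g)⁻¹`, differentiating `J` at `z` and inverting gives a first order expansion
of `∂g` at `J z` with derivative `S - id`; integrating the subgradients along segments then gives
the second order expansion of `g`. Inverting requires that `J (z + w)` close to `J z` forces `w`
small, which follows from monotonicity and `⟨d, T d⟩ ≥ ‖T d‖² ≥ ‖d‖² / M²`. -/
lemma isLittleO_of_prox {g : E → ℝ} {J : E → E} (hJ : ∀ z, IsSubgradient g (J z) (z - J z))
    (hsub : ∀ x, ∃ p, IsSubgradient g x p) {z : E} {T S : E →L[ℝ] E} (hT : HasFDerivAt J T z)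
    (hST : ∀ v, S (T v) = v) :
    (fun v => g (J z + v) - g (J z) - inner ℝ (z - J z) v - inner ℝ (S v - v) v / 2)
      =o[𝓝 0] fun v => ‖v‖ ^ 2 := by
  have firm : ∀ a b, ‖J a - J b‖ ^ 2 ≤ inner ℝ (a - b) (J a - J b) := fun a b =>
    (hJ a).firmly (hJ b)
  set M : ℝ := ‖S‖ + 1 with hM
  have hM0 : 0 < M := by positivity
  have hS : ∀ v, ‖S v‖ ≤ M * ‖v‖ := fun v => (S.le_opNorm v).trans (by gcongr; simp [hM])
  have hTpos : ∀ d, ‖d‖ ^ 2 / M ^ 2 ≤ inner ℝ d (T d) := by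
    intro d
    have h1 : ‖T d‖ ^ 2 ≤ inner ℝ d (T d) := by
      have hl : Tendsto (fun s : ℝ => s⁻¹ • (J (z + s • d) - J z)) (𝓝[>] 0) (𝓝 (T d)) :=
        ((hT.hasLineDerivAt d).tendsto_slope_zero).mono_left
          (nhdsWithin_mono _ fun s hs => (ne_of_gt hs : s ≠ 0))
      refine le_of_tendsto_of_tendsto (hl.norm.pow 2) (tendsto_const_nhds.inner hl) ?_
      filter_upwards [self_mem_nhdsWithin] with s hs
      have hs : 0 < s := hs
      have := firm (z + s • d) z
      rw [add_sub_cancel_left, real_inner_smul_left] at this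
      rw [norm_smul, inner_smul_right, mul_pow, norm_inv, Real.norm_of_nonneg hs.le]
      calc s⁻¹ ^ 2 * ‖J (z + s • d) - J z‖ ^ 2
          ≤ s⁻¹ ^ 2 * (s * inner ℝ d (J (z + s • d) - J z)) := by gcongr
        _ = _ := by field_simp
    refine le_trans ?_ h1
    have h2 := hS (T d)
    rw [hST] at h2
    rw [div_le_iff₀ (by positivity), ← mul_pow, mul_comm]
    gcongr
  have hder : ∀ ε > 0, ∃ η > 0, ∀ w, ‖w‖ ≤ η → ‖J (z + w) - J z - T w‖ ≤ ε * ‖w‖ := by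
    intro ε hε
    have := (hasFDerivAt_iff_isLittleO_nhds_zero.1 hT).def hε
    obtain ⟨η, hη, h⟩ := Metric.eventually_nhds_iff.1 this
    refine ⟨η / 2, by positivity, fun w hw => h ?_⟩
    rw [dist_zero_right]; linarith
  -- the inverse of `J` is continuous at `J z`
  have hinvc : ∀ η > 0, ∃ ρ > 0, ∀ w, ‖J (z + w) - J z‖ < ρ → ‖w‖ < η := by
    intro η hη
    obtain ⟨η₁, hη₁, h1⟩ := hder (1 / (2 * M ^ 2)) (by positivity)
    set θ := min η η₁ with hθ
    have hθ0 : 0 < θ := lt_min hη hη₁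
    refine ⟨θ / (2 * M ^ 2), by positivity, fun w hw => ?_⟩
    by_contra! hcon
    have hw0 : θ ≤ ‖w‖ := (min_le_left _ _).trans hcon
    have hwp : 0 < ‖w‖ := hθ0.trans_le hw0
    -- The derivative controls `J` only near `z`, so `w` is replaced by the point at distance `θ` on
    -- the same ray. Monotonicity of `J` shows that the component of `J (z + ·) - J z` along `u`
    -- does not decrease from `u` to `w`.
    set u := (θ / ‖w‖) • w with hu
    have hun : ‖u‖ = θ := by
      rw [hu, norm_smul, Real.norm_of_nonneg (by positivity)]
      field_simp
    have h2 : 0 ≤ inner ℝ (J (z + w) - J (z + u)) u := by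
      have hm := (sq_nonneg _).trans (firm (z + w) (z + u))
      rw [add_sub_add_left_eq_sub] at hm
      rcases hw0.eq_or_lt with h | h
      · have : u = w := by rw [hu, h, div_self hwp.ne', one_smul]
        simp [this]
      · have e : w - u = ((‖w‖ - θ) / θ) • u := by
          rw [hu, smul_smul]
          have : (‖w‖ - θ) / θ * (θ / ‖w‖) = 1 - θ / ‖w‖ := by field_simp
          rw [this, sub_smul, one_smul]
        rw [e, real_inner_smul_left] at hm
        have hpos : 0 < (‖w‖ - θ) / θ := div_pos (by linarith) hθ0
        rw [real_inner_comm]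
        exact nonneg_of_mul_nonneg_right hm hpos
    have h3 := h1 u (by rw [hun]; exact min_le_right _ _)
    have h4 : θ ^ 2 / (2 * M ^ 2) ≤ inner ℝ (J (z + u) - J z) u := by
      have h5 := hTpos u
      have h6 := abs_le.1 (abs_real_inner_le_norm (J (z + u) - J z - T u) u)
      rw [inner_sub_left, real_inner_comm u (T u)] at h6
      have h7 : ‖J (z + u) - J z - T u‖ * ‖u‖ ≤ 1 / (2 * M ^ 2) * ‖u‖ * ‖u‖ := by gcongr
      rw [hun] at *
      have : θ ^ 2 / M ^ 2 - 1 / (2 * M ^ 2) * θ * θ = θ ^ 2 / (2 * M ^ 2) := by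
        field_simp; ring
      linarith [h6.1]
    have h8 : θ ^ 2 / (2 * M ^ 2) ≤ ‖J (z + w) - J z‖ * θ := by
      calc _ ≤ inner ℝ (J (z + w) - J z) u := by
            have e : J (z + w) - J z = (J (z + w) - J (z + u)) + (J (z + u) - J z) := by abel
            rw [e, inner_add_left]; linarith
        _ ≤ _ := by rw [← hun]; exact real_inner_le_norm _ _
    have h9 : ‖J (z + w) - J z‖ * θ < θ / (2 * M ^ 2) * θ := by gcongr
    have : θ / (2 * M ^ 2) * θ = θ ^ 2 / (2 * M ^ 2) := by ring
    linarith
  -- first order expansion of the subdifferential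
  have hexp : ∀ ε > 0, ∃ ρ > 0, ∀ v q, ‖v‖ < ρ → IsSubgradient g (J z + v) q →
      ‖q - (z - J z) - (S v - v)‖ ≤ ε * ‖v‖ := by
    intro ε hε
    set ε' := min (1 / (2 * M)) (ε / (2 * M ^ 2)) with hε'
    have hε'0 : 0 < ε' := lt_min (by positivity) (by positivity)
    obtain ⟨η, hη, h1⟩ := hder ε' hε'0
    obtain ⟨ρ, hρ, h2⟩ := hinvc η hη
    refine ⟨ρ, hρ, fun v q hv hq => ?_⟩
    -- With this choice `z + w = (J z + v) + q`, so `J (z + w) = J z + v`. The expansion `v = T w +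
    -- o(w)` then yields `w ≈ S v`, that is, `q - (z - J z) = w - v ≈ S v - v`.
    set w := J z + v + q - z with hw
    have hJw : J (z + w) = J z + v := by
      have h3 : IsSubgradient g (J z + v) (z + w - (J z + v)) := by
        have : z + w - (J z + v) = q := by rw [hw]; abel
        rwa [this]
      have := (hJ (z + w)).firmly h3
      rw [sub_self, inner_zero_left] at this
      have h4 : ‖J (z + w) - (J z + v)‖ = 0 := by nlinarith [norm_nonneg (J (z + w) - (J z + v))]
      exact sub_eq_zero.1 (norm_eq_zero.1 h4)
    have hwn : ‖w‖ < η := h2 w (by rw [hJw, add_sub_cancel_left]; exact hv)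
    have h5 := h1 w hwn.le
    rw [hJw, add_sub_cancel_left] at h5
    have h6 : ‖S v - w‖ ≤ M * (ε' * ‖w‖) := by
      have : S v - w = S (v - T w) := by rw [map_sub, hST]
      rw [this]
      exact (hS _).trans (by gcongr)
    have h7 : ‖w‖ ≤ 2 * M * ‖v‖ := by
      have h8 : ‖w‖ ≤ ‖S v‖ + ‖S v - w‖ := by
        have := norm_sub_le (S v) (S v - w)
        rwa [sub_sub_cancel] at this
      have h9 : M * (ε' * ‖w‖) ≤ ‖w‖ / 2 := by
        calc M * (ε' * ‖w‖) ≤ M * (1 / (2 * M) * ‖w‖) := by gcongr; exact min_le_left _ _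
          _ = _ := by field_simp
      linarith [hS v]
    have e : q - (z - J z) - (S v - v) = -(S v - w) := by rw [hw]; abel
    rw [e, norm_neg]
    calc ‖S v - w‖ ≤ M * (ε' * ‖w‖) := h6
      _ ≤ M * (ε / (2 * M ^ 2) * (2 * M * ‖v‖)) := by gcongr; exact min_le_right _ _
      _ = ε * ‖v‖ := by field_simp
  rw [isLittleO_iff]
  intro ε hε
  obtain ⟨ρ, hρ, h⟩ := hexp ε hε
  filter_upwards [Metric.ball_mem_nhds (0 : E) hρ] with v hv
  rw [mem_ball_zero_iff] at hv
  choose q hq using hsub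
  have := abs_sub_le_of_subgradients (f := fun s => g (J z + s • v))
    (m := fun s => inner ℝ (q (J z + s • v)) v) (a := inner ℝ (z - J z) v)
    (b := inner ℝ (S v - v) v) (κ := ε * ‖v‖ ^ 2) ?_ ?_
  · simpa [Real.norm_eq_abs] using this
  · intro s _ t _
    have := hq (J z + s • v) (J z + t • v)
    have e : J z + t • v - (J z + s • v) = (t - s) • v := by module
    rw [e, inner_smul_right] at this
    linarith
  · intro s hs
    have hsv : ‖s • v‖ ≤ ‖v‖ := by
      rw [norm_smul, Real.norm_of_nonneg hs.1]
      exact mul_le_of_le_one_left (norm_nonneg _) hs.2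
    have h1 := h (s • v) _ (hsv.trans_lt hv) (hq (J z + s • v))
    have e : inner ℝ (q (J z + s • v)) v - (inner ℝ (z - J z) v + s * inner ℝ (S v - v) v)
        = inner ℝ (q (J z + s • v) - (z - J z) - (S (s • v) - s • v)) v := by
      simp only [map_smul, inner_sub_left, real_inner_smul_left]; ring
    rw [e]
    calc _ ≤ _ := abs_real_inner_le_norm _ _
      _ ≤ ε * ‖v‖ * ‖v‖ := by gcongr; exact h1.trans (by gcongr)
      _ = _ := by ring

/-- `g` has at `x` the gradient `p` and the second order expansion given by the symmetric
operator `B`. -/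
def HasSecondOrderExpansion (g : E → ℝ) (x p : E) (B : E →L[ℝ] E) : Prop :=
  (B : E →ₗ[ℝ] E).IsSymmetric ∧
    (fun v => g (x + v) - g x - inner ℝ p v - inner ℝ (B v) v / 2) =o[𝓝 0] fun v => ‖v‖ ^ 2

/-- **Alexandrov's theorem** for nonnegative Lipschitz convex functions. -/
theorem ae_exists_hasSecondOrderExpansion [FiniteDimensional ℝ E] [MeasurableSpace E]
    [BorelSpace E] {g : E → ℝ} (hg : ConvexOn ℝ univ g) {L : NNReal} (hL : LipschitzWith L g)
    (h0 : ∀ x, 0 ≤ g x) : ∀ᵐ x : E, ∃ p B, HasSecondOrderExpansion g x p B := by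
  choose J hJ using exists_prox hg hL.continuous h0
  have hsub := exists_subgradient hg hL h0
  have hJL : LipschitzWith 1 J := by
    refine LipschitzWith.of_dist_le_mul fun a b => ?_
    rw [dist_eq_norm, dist_eq_norm, NNReal.coe_one, one_mul]
    have h1 := (hJ a).firmly (hJ b)
    have h2 := real_inner_le_norm (a - b) (J a - J b)
    by_contra! h
    nlinarith [norm_nonneg (a - b)]
  -- Every `x` equals `J (x + p)` for a subgradient `p` at `x`. Hence the bad points lie in the
  -- image under `J` of the non-differentiability set, null by Rademacher since a Lipschitz map
  -- preserves `n`-dimensional Hausdorff null sets, or of the critical set, null by Sard.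
  have hnull1 : volume (J '' {z | ¬ DifferentiableAt ℝ J z}) = 0 := by
    have h1 : volume {z | ¬ DifferentiableAt ℝ J z} = 0 :=
      ae_iff.1 (hJL.ae_differentiableAt (μ := (volume : Measure E)))
    rw [← InnerProductSpace.euclideanHausdorffMeasure_eq_volume,
      Measure.euclideanHausdorffMeasure_def, Measure.smul_apply] at h1 ⊢
    have hne := Measure.addHaarScalarFactor_volume_hausdorffMeasure_ne_zero (Module.finrank ℝ E)
    have h2 : μH[(Module.finrank ℝ E : ℝ)] {z | ¬ DifferentiableAt ℝ J z} = 0 := by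
      rw [ENNReal.smul_def, smul_eq_mul, mul_eq_zero] at h1
      exact h1.resolve_left (by simpa using hne)
    have h3 := (hJL.lipschitzOnWith (s := {z | ¬ DifferentiableAt ℝ J z})).hausdorffMeasure_image_le
      (Nat.cast_nonneg (Module.finrank ℝ E) : (0 : ℝ) ≤ Module.finrank ℝ E)
    rw [h2, mul_zero, nonpos_iff_eq_zero] at h3
    rw [h3, smul_zero]
  have hnull2 : volume (J '' {z | DifferentiableAt ℝ J z ∧ (fderiv ℝ J z).det = 0}) = 0 :=
    addHaar_image_eq_zero_of_det_fderivWithin_eq_zero volume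
      (fun z hz => hz.1.hasFDerivAt.hasFDerivWithinAt) (fun z hz => hz.2)
  have hn := measure_union_null hnull1 hnull2
  filter_upwards [compl_mem_ae_iff.2 hn] with x hx
  rw [← image_union] at hx
  obtain ⟨p, hp⟩ := hsub x
  have hJx : J (x + p) = x := by
    have h3 : IsSubgradient g x (x + p - x) := by rwa [add_sub_cancel_left]
    have := (hJ (x + p)).firmly h3
    rw [sub_self, inner_zero_left] at this
    have h4 : ‖J (x + p) - x‖ = 0 := by nlinarith [norm_nonneg (J (x + p) - x)]
    exact sub_eq_zero.1 (norm_eq_zero.1 h4)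
  have hz : x + p ∉ {z | ¬ DifferentiableAt ℝ J z} ∪
      {z | DifferentiableAt ℝ J z ∧ (fderiv ℝ J z).det = 0} := fun h => hx ⟨_, h, hJx⟩
  simp only [mem_union, mem_ofPred_eq, not_or, not_not, not_and] at hz
  have hdet := hz.2 hz.1
  set T := fderiv ℝ J (x + p) with hTdef
  let e := T.toContinuousLinearEquivOfDetNeZero hdet
  set S : E →L[ℝ] E := e.symm.toContinuousLinearMap with hS
  have hexp := isLittleO_of_prox hJ hsub (S := S) hz.1.hasFDerivAt
    (fun v => e.symm_apply_apply v)
  rw [hJx, add_sub_cancel_left] at hexp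
  set B₀ : E →L[ℝ] E := S - ContinuousLinearMap.id ℝ E with hB₀
  -- Symmetry of the derivative of `J` is never shown; only the quadratic form of `S - id` enters
  -- the expansion, so its symmetric part serves.
  refine ⟨p, (1 / 2 : ℝ) • (B₀ + ContinuousLinearMap.adjoint B₀), ?_, ?_⟩
  · intro v w
    simp [inner_add_left, inner_add_right, real_inner_smul_left, real_inner_smul_right,
      ContinuousLinearMap.adjoint_inner_left, ContinuousLinearMap.adjoint_inner_right]
    ring
  · refine hexp.congr_left fun v => ?_
    have : inner ℝ (((1 / 2 : ℝ) • (B₀ + ContinuousLinearMap.adjoint B₀)) v) v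
        = inner ℝ (S v - v) v := by
      simp only [smul_apply, add_apply, inner_add_left,
        real_inner_smul_left, ContinuousLinearMap.adjoint_inner_left]
      rw [real_inner_comm (B₀ v) v]
      simp [hB₀]
      ring
    rw [this]

end Illumination
end

/-! ### Fubini decompositions and the area formula for Hausdorff measure -/

noncomputable section

namespace Illumination

open scoped ENNReal NNReal

section Decomposition

variable {E : Type*} [NormedAddCommGroup E] [InnerProductSpace ℝ E]

lemma finrank_orthogonal_add_one [FiniteDimensional ℝ E] {e : E} (he : e ≠ 0) :
    Module.finrank ℝ (Submodule.span ℝ {e})ᗮ + 1 = Module.finrank ℝ E := by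
  rw [← (Submodule.span ℝ {e}).finrank_add_finrank_orthogonal, finrank_span_singleton he, add_comm]

lemma inner_coe_orthogonal (e : E) (y : (Submodule.span ℝ {e})ᗮ) : inner ℝ e (y : E) = 0 :=
  Submodule.mem_orthogonal_singleton_iff_inner_right.1 y.2

variable [FiniteDimensional ℝ E] [MeasurableSpace E] [BorelSpace E]

/-- The decomposition `E = e^⊥ ⊕ ℝ e` as a measurable equivalence. -/
def orthogonalEquiv (e : E) (he : ‖e‖ = 1) : (Submodule.span ℝ {e})ᗮ × ℝ ≃ᵐ E :=
  (MeasurableEquiv.prodComm.trans ((LinearIsometryEquiv.toSpanUnitSingleton (𝕜 := ℝ) e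
    he).toHomeomorph.toMeasurableEquiv.prodCongr (MeasurableEquiv.refl _))).trans
    ((Submodule.span ℝ {e}).measurableEquivProd (0 : E)).symm

lemma orthogonalEquiv_apply (e : E) (he : ‖e‖ = 1) (q : (Submodule.span ℝ {e})ᗮ × ℝ) :
    orthogonalEquiv e he q = (q.1 : E) + q.2 • e := by
  rw [add_comm]
  simp only [orthogonalEquiv, MeasurableEquiv.trans_apply, Submodule.measurableEquivProd_symm_apply,
    vadd_eq_add, add_zero]
  rfl

lemma measurePreserving_orthogonalEquiv (e : E) (he : ‖e‖ = 1) :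
    MeasurePreserving (orthogonalEquiv e he) := by
  have h1 : MeasurePreserving
      ((Submodule.span ℝ {e}).measurableEquivProd (0 : E)) volume volume := by
    have := (Submodule.span ℝ {e}).measurePreserving_measurableEquivProd (0 : E)
    rwa [InnerProductSpace.euclideanHausdorffMeasure_eq_volume] at this
  refine MeasurePreserving.trans ?_ h1.symm
  refine MeasurePreserving.trans (Measure.measurePreserving_swap) ?_
  exact ((LinearIsometryEquiv.toSpanUnitSingleton (𝕜 := ℝ) e he).measurePreserving).prod
    (MeasurePreserving.id _)

lemma lintegral_eq_orthogonal (e : E) (he : ‖e‖ = 1) {F : E → ℝ≥0∞} (hF : Measurable F) :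
    ∫⁻ x, F x = ∫⁻ y : (Submodule.span ℝ {e})ᗮ, ∫⁻ s : ℝ, F (y + s • e) := by
  rw [← (measurePreserving_orthogonalEquiv e he).lintegral_comp_emb
    (orthogonalEquiv e he).measurableEmbedding]
  simp only [orthogonalEquiv_apply]
  rw [Measure.volume_eq_prod]
  refine lintegral_prod _ (Measurable.aemeasurable ?_)
  exact hF.comp (by fun_prop)

lemma lintegral_comp_smul {V : Type*} [NormedAddCommGroup V] [InnerProductSpace ℝ V]
    [FiniteDimensional ℝ V] [MeasurableSpace V] [BorelSpace V] {F : V → ℝ≥0∞} (hF : Measurable F)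
    {s : ℝ} (hs : 0 < s) :
    ∫⁻ y, F y = ENNReal.ofReal (s ^ Module.finrank ℝ V) * ∫⁻ y, F (s • y) := by
  have h1 := Measure.map_addHaar_smul (volume : Measure V) hs.ne'
  have h2 := lintegral_map (μ := (volume : Measure V)) hF (measurable_const_smul s)
  rw [h1, lintegral_smul_measure] at h2
  have hp : 0 < s ^ Module.finrank ℝ V := by positivity
  rw [← h2, smul_eq_mul, ← mul_assoc, abs_of_pos (by positivity), ← ENNReal.ofReal_mul hp.le,
    mul_inv_cancel₀ hp.ne', ENNReal.ofReal_one, one_mul]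

/-- Oblique version of Fubini's theorem. -/
lemma lintegral_eq_oblique (e : E) (he : ‖e‖ = 1) {x : E} (hx : 0 < inner ℝ e x) {F : E → ℝ≥0∞}
    (hF : Measurable F) :
    ∫⁻ z, F z = ENNReal.ofReal (inner ℝ e x) *
      ∫⁻ y : (Submodule.span ℝ {e})ᗮ, ∫⁻ s : ℝ, F (y + s • x) := by
  set c := inner ℝ e x with hc
  have hx' : x - c • e ∈ (Submodule.span ℝ {e})ᗮ := by
    rw [Submodule.mem_orthogonal_singleton_iff_inner_right, inner_sub_right, inner_smul_right,
      real_inner_self_eq_norm_sq, he, hc]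
    ring
  set x' : (Submodule.span ℝ {e})ᗮ := ⟨x - c • e, hx'⟩ with hx'def
  have hm : Measurable (Function.uncurry fun (y : (Submodule.span ℝ {e})ᗮ) (s : ℝ) =>
      F (y + s • x)) := hF.comp (by fun_prop)
  have hm2 : Measurable (Function.uncurry fun (y : (Submodule.span ℝ {e})ᗮ) (s : ℝ) =>
      F (y + s • e)) := hF.comp (by fun_prop)
  rw [lintegral_eq_orthogonal e he hF, lintegral_lintegral_swap hm.aemeasurable,
    lintegral_lintegral_swap hm2.aemeasurable]
  -- On the slice with parameter `s`, `s x = s x' + c s e` with `x' ∈ e^⊥`, and the shear by `s x'`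
  -- is a translation of `e^⊥`.
  have h1 : ∀ s : ℝ, ∫⁻ y : (Submodule.span ℝ {e})ᗮ, F (y + s • x)
      = ∫⁻ y : (Submodule.span ℝ {e})ᗮ, F (y + (c * s) • e) := by
    intro s
    rw [← lintegral_add_right_eq_self (μ := (volume : Measure (Submodule.span ℝ {e})ᗮ))
      (fun y : (Submodule.span ℝ {e})ᗮ => F (y + (c * s) • e)) (s • x')]
    refine lintegral_congr fun y => congrArg F ?_
    simp only [hx'def, Submodule.coe_add, Submodule.coe_smul]
    module
  simp_rw [h1]
  have hm3 : Measurable fun s : ℝ => ∫⁻ y : (Submodule.span ℝ {e})ᗮ, F (y + s • e) :=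
    hm2.lintegral_prod_left'
  have := lintegral_comp_smul hm3 hx
  simpa using this

/-- Integration over an open half space in the projective coordinates `t (e + y)`. -/
lemma lintegral_halfSpace (e : E) (he : ‖e‖ = 1) {F : E → ℝ≥0∞} (hF : Measurable F) :
    ∫⁻ x in {x | 0 < inner ℝ e x}, F x = ∫⁻ y : (Submodule.span ℝ {e})ᗮ, ∫⁻ t in Ioi (0 : ℝ),
      F (t • (e + y)) * ENNReal.ofReal (t ^ (Module.finrank ℝ E - 1)) := by
  have hΩ : MeasurableSet {x : E | 0 < inner ℝ e x} :=
    measurableSet_lt measurable_const (by fun_prop)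
  have hfr : Module.finrank ℝ (Submodule.span ℝ {e})ᗮ = Module.finrank ℝ E - 1 := by
    have := finrank_orthogonal_add_one (e := e) (by rintro rfl; simp at he)
    omega
  rw [← lintegral_indicator hΩ, lintegral_eq_orthogonal e he (hF.indicator hΩ)]
  have h1 : ∀ (y : (Submodule.span ℝ {e})ᗮ) (s : ℝ),
      ({x : E | 0 < inner ℝ e x}.indicator F (y + s • e)) =
        (Ioi (0 : ℝ)).indicator (fun s => F (y + s • e)) s := by
    intro y s
    have : inner ℝ e ((y : E) + s • e) = s := by
      rw [inner_add_right, inner_coe_orthogonal, inner_smul_right, real_inner_self_eq_norm_sq, he]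
      simp
    simp only [indicator, mem_ofPred_eq, this, mem_Ioi]
  simp_rw [h1, lintegral_indicator measurableSet_Ioi]
  have hm2 : Measurable (Function.uncurry fun (y : (Submodule.span ℝ {e})ᗮ) (s : ℝ) =>
      F (y + s • e)) := hF.comp (by fun_prop)
  have hm3 : Measurable (Function.uncurry fun (y : (Submodule.span ℝ {e})ᗮ) (t : ℝ) =>
      F (t • (e + y)) * ENNReal.ofReal (t ^ (Module.finrank ℝ E - 1))) :=
    (hF.comp (by fun_prop)).mul (by fun_prop)
  rw [lintegral_lintegral_swap hm2.aemeasurable, lintegral_lintegral_swap hm3.aemeasurable]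
  refine setLIntegral_congr_fun measurableSet_Ioi fun s hs => ?_
  have hs : 0 < s := hs
  rw [lintegral_comp_smul (F := fun y : (Submodule.span ℝ {e})ᗮ => F (y + s • e))
    (hF.comp (by fun_prop)) hs, hfr, mul_comm, ← lintegral_mul_const]
  · refine lintegral_congr fun y => ?_
    rw [smul_add, add_comm (s • e)]
    rfl
  · exact hF.comp (by fun_prop)

end Decomposition

section Hausdorff

variable {α X Y : Type*} [MetricSpace X] [MeasurableSpace X] [BorelSpace X]
  [MetricSpace Y] [MeasurableSpace Y] [BorelSpace Y]

/-- If `u` is dominated by `C` times `v` on `A`, then so is the Hausdorff measure of the image. -/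
lemma euclideanHausdorffMeasure_image_le_of_dist_le {u : α → X} {v : α → Y} {A : Set α}
    {C : ℝ≥0} (h : ∀ a ∈ A, ∀ b ∈ A, dist (u a) (u b) ≤ C * dist (v a) (v b)) (d : ℕ) :
    (Measure.euclideanHausdorffMeasure d : Measure X) (u '' A)
      ≤ (C : ℝ≥0∞) ^ d * (Measure.euclideanHausdorffMeasure d : Measure Y) (v '' A) := by
  rcases A.eq_empty_or_nonempty with rfl | ⟨a₀, ha₀⟩
  · simp
  have : Nonempty α := ⟨a₀⟩
  -- The domination makes `u` factor through `v` on `A`, by a map that is `C`-Lipschitz on the image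
  -- of `v`.
  set F : Y → X := u ∘ Function.invFunOn v A with hF
  have hinv : ∀ a ∈ A, Function.invFunOn v A (v a) ∈ A ∧ v (Function.invFunOn v A (v a)) = v a :=
    fun a ha => ⟨Function.invFunOn_mem ⟨a, ha, rfl⟩, Function.invFunOn_eq ⟨a, ha, rfl⟩⟩
  have hlip : LipschitzOnWith C F (v '' A) := by
    refine LipschitzOnWith.of_dist_le_mul ?_
    rintro _ ⟨a, ha, rfl⟩ _ ⟨b, hb, rfl⟩
    have := h _ (hinv a ha).1 _ (hinv b hb).1
    rwa [(hinv a ha).2, (hinv b hb).2] at this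
  have himg : F '' (v '' A) = u '' A := by
    rw [image_image]
    refine image_congr fun a ha => ?_
    have := h _ (hinv a ha).1 a ha
    rw [(hinv a ha).2, dist_self, mul_zero] at this
    exact dist_le_zero.1 this
  have h1 := hlip.hausdorffMeasure_image_le (Nat.cast_nonneg d : (0 : ℝ) ≤ d)
  rw [himg, ENNReal.rpow_natCast] at h1
  simp only [Measure.euclideanHausdorffMeasure_def, Measure.smul_apply, ENNReal.smul_def,
    smul_eq_mul]
  calc _ ≤ _ := mul_le_mul_right h1 _
    _ = _ := by ring

end Hausdorff

section Area

variable {W E : Type*} [NormedAddCommGroup W] [InnerProductSpace ℝ W] [FiniteDimensional ℝ W]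
  [MeasurableSpace W] [BorelSpace W] [NormedAddCommGroup E] [InnerProductSpace ℝ E]
  [FiniteDimensional ℝ E] [MeasurableSpace E] [BorelSpace E]

/-- Cut `A` into countably many pieces on which `f` is close to one of its derivatives `L_j`, with
error `ε / (1 + ε)` relative to `‖L_j v‖`. There `f` and `L_j` dominate each other with factor `1 +
ε`, since `1 - ε / (1 + ε) = 1 / (1 + ε)`, so the image measures agree up to `(1 + ε) ^ d`. The
oscillation of `w` on `A` costs the remaining factor. -/
lemma area_estimate_of_level {f : W → E} {f' : W → W →L[ℝ] E} {A : Set W} (hA : MeasurableSet A)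
    (hf' : ∀ y ∈ A, HasFDerivWithinAt f (f' y) A y) (hinj : InjOn f A) {d : ℕ} {w : W → ℝ≥0∞}
    (hw : ∀ y ∈ A, ∀ S, (Measure.euclideanHausdorffMeasure d : Measure E) (f' y '' S)
      = w y * volume S) (hf'inj : ∀ y ∈ A, Function.Injective (f' y)) {ε : ℝ≥0} (hε : 0 < ε)
    (hlev : ∀ y ∈ A, ∀ z ∈ A, w y ≤ (1 + ε : ℝ≥0) * w z) :
    (Measure.euclideanHausdorffMeasure d : Measure E) (f '' A)
        ≤ ((1 + ε : ℝ≥0) : ℝ≥0∞) ^ (d + 1) * ∫⁻ y in A, w y ∧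
      ∫⁻ y in A, w y ≤ ((1 + ε : ℝ≥0) : ℝ≥0∞) ^ (d + 1) *
        (Measure.euclideanHausdorffMeasure d : Measure E) (f '' A) := by
  classical
  rcases A.eq_empty_or_nonempty with rfl | hne
  · simp
  have hanti : ∀ L : W →L[ℝ] E, ∃ c : ℝ≥0, 0 < c ∧
      (Function.Injective L → ∀ v, (c : ℝ) * ‖v‖ ≤ ‖L v‖) := by
    intro L
    by_cases hL : Function.Injective L
    · obtain ⟨K, hK, h⟩ := LinearMap.exists_antilipschitzWith (L : W →ₗ[ℝ] E)
        (LinearMap.ker_eq_bot.2 hL)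
      refine ⟨K⁻¹, inv_pos.2 hK, fun _ v => ?_⟩
      have := h.le_mul_dist v 0
      simp only [dist_zero_right, map_zero] at this
      rw [NNReal.coe_inv, inv_mul_le_iff₀ (by exact_mod_cast hK)]
      exact this
    · exact ⟨1, one_pos, fun h => absurd h hL⟩
  choose c hc0 hc using hanti
  obtain ⟨t, L, htd, htm, hcov, happ, hL⟩ :=
    exists_partition_approximatesLinearOn_of_hasFDerivWithinAt f A f' hf'
      (fun L => c L * (ε / (1 + ε))) (fun L => (mul_pos (hc0 L) (by positivity)).ne')
  have hL := hL hne
  have hAeq : A = ⋃ j, A ∩ t j := by rw [← inter_iUnion, inter_eq_self_of_subset_left hcov]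
  have hdist : ∀ j, (∀ a ∈ A ∩ t j, ∀ b ∈ A ∩ t j,
        dist (f a) (f b) ≤ (1 + ε : ℝ≥0) * dist (L j a) (L j b)) ∧
      (∀ a ∈ A ∩ t j, ∀ b ∈ A ∩ t j,
        dist (L j a) (L j b) ≤ (1 + ε : ℝ≥0) * dist (f a) (f b)) := by
    intro j
    obtain ⟨y, hy, hLy⟩ := hL j
    have hb : ∀ a ∈ A ∩ t j, ∀ b ∈ A ∩ t j,
        ‖f a - f b - L j (a - b)‖ ≤ (ε / (1 + ε) : ℝ) * ‖L j (a - b)‖ := by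
      intro a ha b hb
      have h1 := happ j a ha b hb
      have h2 := hc (L j) (by rw [hLy]; exact hf'inj y hy) (a - b)
      push_cast at h1
      calc _ ≤ _ := h1
        _ = (ε / (1 + ε) : ℝ) * (c (L j) * ‖a - b‖) := by ring
        _ ≤ _ := by gcongr
    have hθ : (ε : ℝ) / (1 + ε) ≤ ε := div_le_self ε.2 (by simp)
    have hpos : (0 : ℝ) < 1 + ε := by positivity
    constructor
    · intro a ha b hb'
      have h := hb a ha b hb'
      rw [dist_eq_norm, dist_eq_norm, ← map_sub]
      have h3 := norm_sub_norm_le (f a - f b) (L j (a - b))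
      have h4 : (ε / (1 + ε) : ℝ) * ‖L j (a - b)‖ ≤ ε * ‖L j (a - b)‖ := by gcongr
      push_cast
      linarith
    · intro a ha b hb'
      have h := hb a ha b hb'
      rw [dist_eq_norm, dist_eq_norm, ← map_sub]
      have h3 := norm_sub_norm_le (L j (a - b)) (f a - f b)
      rw [norm_sub_rev (L j (a - b))] at h3
      push_cast
      have h5 : (1 - ε / (1 + ε) : ℝ) * ‖L j (a - b)‖ ≤ ‖f a - f b‖ := by linarith
      have h6 : (1 - ε / (1 + ε) : ℝ) = 1 / (1 + ε) := by field_simp; ring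
      rw [h6, one_div, inv_mul_le_iff₀ hpos] at h5
      exact h5
  have hcont : ContinuousOn f A := fun y hy => (hf' y hy).continuousWithinAt
  have hHsum : (Measure.euclideanHausdorffMeasure d : Measure E) (f '' A)
      = ∑' j, (Measure.euclideanHausdorffMeasure d : Measure E) (f '' (A ∩ t j)) := by
    conv_lhs => rw [hAeq, image_iUnion]
    refine measure_iUnion (fun i j hij => ?_) fun j => ?_
    · refine disjoint_image_image fun a ha b hb hab => ?_
      exact Set.disjoint_left.1 (htd hij) ha.2 (by rw [hinj ha.1 hb.1 hab]; exact hb.2)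
    · exact (hA.inter (htm j)).image_of_continuousOn_injOn (hcont.mono inter_subset_left)
        (hinj.mono inter_subset_left)
  have hIsum : ∫⁻ y in A, w y = ∑' j, ∫⁻ y in A ∩ t j, w y := by
    conv_lhs => rw [hAeq]
    exact lintegral_iUnion (fun j => hA.inter (htm j))
      (fun i j hij => (htd hij).mono inter_subset_right inter_subset_right) _
  rw [hHsum, hIsum, ← ENNReal.tsum_mul_left, ← ENNReal.tsum_mul_left]
  refine ⟨ENNReal.tsum_le_tsum fun j => ?_, ENNReal.tsum_le_tsum fun j => ?_⟩
  · obtain ⟨y, hy, hLy⟩ := hL j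
    have h1 := euclideanHausdorffMeasure_image_le_of_dist_le (hdist j).1 d
    rw [hLy, hw y hy] at h1
    refine h1.trans ?_
    rw [pow_succ, mul_assoc]
    refine mul_le_mul_right ?_ _
    rw [← setLIntegral_const, ← lintegral_const_mul' _ _ ENNReal.coe_ne_top]
    exact setLIntegral_mono' (hA.inter (htm j)) fun z hz => hlev y hy z hz.1
  · obtain ⟨y, hy, hLy⟩ := hL j
    have h1 := euclideanHausdorffMeasure_image_le_of_dist_le (hdist j).2 d
    rw [hLy, hw y hy] at h1
    calc ∫⁻ z in A ∩ t j, w z ≤ ∫⁻ _ in A ∩ t j, (1 + ε : ℝ≥0) * w y :=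
          setLIntegral_mono' (hA.inter (htm j)) fun z hz => hlev z hz.1 y hy
      _ = (1 + ε : ℝ≥0) * (w y * volume (A ∩ t j)) := by rw [setLIntegral_const, mul_assoc]
      _ ≤ (1 + ε : ℝ≥0) * (((1 + ε : ℝ≥0) : ℝ≥0∞) ^ d *
          (Measure.euclideanHausdorffMeasure d : Measure E) (f '' (A ∩ t j))) := by gcongr
      _ = _ := by rw [pow_succ]; ring

/-- **Area formula** for an injective map with injective derivatives. -/
theorem euclideanHausdorffMeasure_image_eq_lintegral {f : W → E} {f' : W → W →L[ℝ] E} {A : Set W}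
    (hA : MeasurableSet A) (hf' : ∀ y ∈ A, HasFDerivWithinAt f (f' y) A y) (hinj : InjOn f A)
    {d : ℕ} {w : W → ℝ≥0∞} (hwm : Measurable w)
    (hw : ∀ y ∈ A, ∀ S, (Measure.euclideanHausdorffMeasure d : Measure E) (f' y '' S)
      = w y * volume S) (hf'inj : ∀ y ∈ A, Function.Injective (f' y))
    (hw0 : ∀ y ∈ A, w y ≠ 0) (hwt : ∀ y ∈ A, w y ≠ ∞) :
    (Measure.euclideanHausdorffMeasure d : Measure E) (f '' A) = ∫⁻ y in A, w y := by
  have key : ∀ ε : ℝ≥0, 0 < ε →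
      (Measure.euclideanHausdorffMeasure d : Measure E) (f '' A)
        ≤ ((1 + ε : ℝ≥0) : ℝ≥0∞) ^ (d + 1) * ∫⁻ y in A, w y ∧
      ∫⁻ y in A, w y ≤ ((1 + ε : ℝ≥0) : ℝ≥0∞) ^ (d + 1) *
        (Measure.euclideanHausdorffMeasure d : Measure E) (f '' A) := by
    intro ε hε
    set a : ℝ≥0∞ := ((1 + ε : ℝ≥0) : ℝ≥0∞) with ha
    have ha1 : 1 < a := by rw [ha]; exact_mod_cast (lt_add_of_pos_right 1 hε)
    have hat : a ≠ ∞ := ENNReal.coe_ne_top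
    -- The geometric levels of `w` exhaust `A` because `w` is neither `0` nor `∞` there, and on each
    -- of them `w` oscillates by a factor of at most `1 + ε`.
    set s : ℤ → Set W := fun k => A ∩ w ⁻¹' Ico (a ^ k) (a ^ (k + 1)) with hs
    have hsm : ∀ k, MeasurableSet (s k) := fun k => hA.inter (hwm measurableSet_Ico)
    have hAeq : A = ⋃ k, s k := by
      ext y
      simp only [hs, mem_iUnion, mem_inter_iff, mem_preimage, exists_and_left]
      exact ⟨fun hy => ⟨hy, ENNReal.exists_mem_Ico_zpow (hw0 y hy) (hwt y hy) ha1 hat⟩, fun h => h.1⟩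
    have hdisj : Pairwise (Function.onFun Disjoint s) := by
      have : ∀ i j : ℤ, i < j → Disjoint (s i) (s j) := by
        intro i j hij
        rw [Set.disjoint_left]
        intro y hi hj
        have h1 := hi.2.2
        have h2 := hj.2.1
        have h3 : a ^ (i + 1) ≤ a ^ j := ENNReal.zpow_le_of_le ha1.le (by omega)
        exact absurd (h2.trans_lt h1) (not_lt.2 h3)
      intro i j hij
      rcases lt_or_gt_of_ne hij with h | h
      · exact this i j h
      · exact (this j i h).symm
    have hcont : ContinuousOn f A := fun y hy => (hf' y hy).continuousWithinAt
    have hsA : ∀ k, s k ⊆ A := fun k => inter_subset_left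
    have hHsum : (Measure.euclideanHausdorffMeasure d : Measure E) (f '' A)
        = ∑' j, (Measure.euclideanHausdorffMeasure d : Measure E) (f '' (s j)) := by
      conv_lhs => rw [hAeq, image_iUnion]
      refine measure_iUnion (fun i j hij => ?_) fun j => ?_
      · refine disjoint_image_image fun a ha b hb hab => ?_
        exact Set.disjoint_left.1 (hdisj hij) ha (by rw [hinj ha.1 hb.1 hab]; exact hb)
      · exact (hsm j).image_of_continuousOn_injOn (hcont.mono (hsA j)) (hinj.mono (hsA j))
    have hIsum : ∫⁻ y in A, w y = ∑' j, ∫⁻ y in s j, w y := by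
      conv_lhs => rw [hAeq]
      exact lintegral_iUnion hsm hdisj _
    have hlev : ∀ k, ∀ y ∈ s k, ∀ z ∈ s k, w y ≤ (1 + ε : ℝ≥0) * w z := by
      intro k y hy z hz
      refine hy.2.2.le.trans ?_
      rw [ENNReal.zpow_add (one_pos.trans ha1).ne' hat, zpow_one, mul_comm]
      exact mul_le_mul_right hz.2.1 _
    have hest := fun k => area_estimate_of_level (hsm k)
      (fun y hy => (hf' y (hsA k hy)).mono (hsA k)) (hinj.mono (hsA k))
      (fun y hy => hw y (hsA k hy)) (fun y hy => hf'inj y (hsA k hy)) hε (hlev k)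
    rw [hHsum, hIsum, ← ENNReal.tsum_mul_left, ← ENNReal.tsum_mul_left]
    exact ⟨ENNReal.tsum_le_tsum fun k => (hest k).1, ENNReal.tsum_le_tsum fun k => (hest k).2⟩
  have hlim : ∀ x : ℝ≥0∞, Tendsto (fun ε : ℝ≥0 => ((1 + ε : ℝ≥0) : ℝ≥0∞) ^ (d + 1) * x)
      (𝓝[>] 0) (𝓝 x) := by
    intro x
    have h1 : Tendsto (fun ε : ℝ≥0 => (((1 + ε) ^ (d + 1) : ℝ≥0) : ℝ≥0∞)) (𝓝[>] 0) (𝓝 1) := by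
      rw [← ENNReal.coe_one, ENNReal.tendsto_coe]
      have : Continuous fun ε : ℝ≥0 => (1 + ε) ^ (d + 1) := by fun_prop
      simpa using (this.tendsto 0).mono_left nhdsWithin_le_nhds
    have h2 := ENNReal.Tendsto.mul_const (b := x) h1 (Or.inl one_ne_zero)
    simpa using h2
  refine le_antisymm ?_ ?_
  · exact ge_of_tendsto (hlim _) (eventually_mem_nhdsWithin.mono fun ε hε => (key ε hε).1)
  · exact ge_of_tendsto (hlim _) (eventually_mem_nhdsWithin.mono fun ε hε => (key ε hε).2)

end Area

end Illumination
end

/-! ### Area factor of the radial parametrization, and gauges of convex bodies -/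

noncomputable section

namespace Illumination

open scoped ENNReal NNReal

section LinearImage

variable {E : Type*} [NormedAddCommGroup E] [InnerProductSpace ℝ E] [FiniteDimensional ℝ E]

/-- Determinant of the map `v + τ e ↦ L v + τ N`, where `L` is the derivative of the radial
parametrization `y ↦ (e + y) / g (e + y)`. -/
lemma det_radial {e y p : E} {c : ℝ} (hc : 0 < c) (hey : inner ℝ e y = 0)
    (he : ‖e‖ = 1) (hp : inner ℝ p (e + y) = c) (M : E →ₗ[ℝ] E)
    (hM : ∀ w, M w = c⁻¹ • (w - inner ℝ e w • e) - ((c ^ 2)⁻¹ * inner ℝ p (w - inner ℝ e w • e)) •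
      (e + y) + inner ℝ e w • (‖p‖⁻¹ • p)) :
    LinearMap.det M = ‖p‖ * (c ^ Module.finrank ℝ E)⁻¹ := by
  have hp0 : p ≠ 0 := by rintro rfl; simp at hp; exact hc.ne hp
  have hpn : 0 < ‖p‖ := norm_pos_iff.2 hp0
  have hpp : inner ℝ p p = ‖p‖ ^ 2 := real_inner_self_eq_norm_sq p
  have hee : inner ℝ e e = 1 := by rw [real_inner_self_eq_norm_sq, he, one_pow]
  have hpy : inner ℝ p e + inner ℝ p y = c := by rw [← inner_add_right, hp]
  -- `M` factors as `c⁻¹` times a product of three rank-one perturbations of the identity. The first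
  -- two have determinant `1`; `κ` makes that of the third equal to `‖p‖`.
  set κ : ℝ := (‖p‖ - 1) / c - inner ℝ e (‖p‖⁻¹ • p) with hκ
  set T₀ := LinearMap.transvection (innerₗ E e) y with hT₀
  set T₁ := LinearMap.transvection (c⁻¹ • innerₗ E p) ((c / ‖p‖ ^ 2) • p - (e + y)) with hT₁
  set T₂ := LinearMap.transvection (innerₗ E e + κ • innerₗ E (‖p‖⁻¹ • p)) (c • ‖p‖⁻¹ • p) with hT₂
  have hdec : M = (c⁻¹ • T₂) ∘ₗ T₁ ∘ₗ T₀ := by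
    ext1 w
    simp only [hM, hT₀, hT₁, hT₂, LinearMap.comp_apply, LinearMap.smul_apply,
      LinearMap.transvection.apply, innerₗ_apply_apply, LinearMap.add_apply, inner_add_right,
      inner_sub_right, inner_smul_right, inner_smul_left, hey, hee, hpp, smul_eq_mul,
      RCLike.conj_to_real, hκ]
    have hpe : inner ℝ p e = c - inner ℝ p y := by linarith
    rw [real_inner_comm p e, hpe]
    match_scalars <;> field_simp <;> ring
  rw [hdec, LinearMap.det_comp, LinearMap.det_comp, LinearMap.det_smul, hT₀, hT₁, hT₂,
    LinearMap.transvection.det, LinearMap.transvection.det, LinearMap.transvection.det]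
  simp only [LinearMap.smul_apply, innerₗ_apply_apply, LinearMap.add_apply,
      inner_sub_right, inner_smul_right, inner_smul_left, hey, hpp, smul_eq_mul, hp,
      RCLike.conj_to_real, hκ]
  have : (1 + c⁻¹ * (c / ‖p‖ ^ 2 * ‖p‖ ^ 2 - c)) = 1 := by field_simp; ring
  rw [this, inv_pow]
  field_simp
  ring

variable [MeasurableSpace E] [BorelSpace E]

/-- `M` maps the prism of height `1` over `S` in direction `e` onto the prism of height `1` over `L
'' S` in direction `N`. The volume of such a prism equals the area of its base, so the area factor
is the determinant of `M`. -/
lemma euclideanHausdorffMeasure_linear_image {e N : E} (he : ‖e‖ = 1) (hN : ‖N‖ = 1)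
    (L : (Submodule.span ℝ {e})ᗮ → E) (M : E →ₗ[ℝ] E)
    (hM : ∀ (v : (Submodule.span ℝ {e})ᗮ) (τ : ℝ), M (v + τ • e) = L v + τ • N)
    (hLN : ∀ v, inner ℝ N (L v) = 0) (S : Set (Submodule.span ℝ {e})ᗮ) :
    (Measure.euclideanHausdorffMeasure (Module.finrank ℝ E - 1) : Measure E) (L '' S)
      = ENNReal.ofReal |LinearMap.det M| * volume S := by
  have hN0 : N ≠ 0 := by rintro rfl; simp at hN
  have hfr : Module.finrank ℝ (Submodule.span ℝ {N})ᗮ = Module.finrank ℝ E - 1 := by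
    have := finrank_orthogonal_add_one hN0
    omega
  set S' : Set (Submodule.span ℝ {N})ᗮ := {v | (v : E) ∈ L '' S} with hS'
  have h1 : L '' S = Subtype.val '' S' := by
    ext x
    constructor
    · rintro ⟨v, hv, rfl⟩
      exact ⟨⟨L v, Submodule.mem_orthogonal_singleton_iff_inner_right.2 (hLN v)⟩, ⟨v, hv, rfl⟩, rfl⟩
    · rintro ⟨v, hv, rfl⟩
      exact hv
  have h2 : (Measure.euclideanHausdorffMeasure (Module.finrank ℝ E - 1) : Measure E) (L '' S)
      = volume S' := by
    rw [h1, isometry_subtype_coe.euclideanHausdorffMeasure_image, ← hfr,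
      InnerProductSpace.euclideanHausdorffMeasure_eq_volume]
  have prism : ∀ (f : E) (hf : ‖f‖ = 1) (A : Set (Submodule.span ℝ {f})ᗮ),
      volume A = volume (orthogonalEquiv f hf '' (A ×ˢ Icc (0 : ℝ) 1)) := by
    intro f hf A
    rw [← (measurePreserving_orthogonalEquiv f hf).measure_preimage_equiv,
      preimage_image_eq _ (orthogonalEquiv f hf).injective, Measure.volume_eq_prod,
      Measure.prod_prod]
    simp
  rw [h2, prism N hN S', prism e he S, ← Measure.addHaar_image_linearMap]
  congr 1
  ext x
  simp only [mem_image, Prod.exists, mem_prod, orthogonalEquiv_apply]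
  constructor
  · rintro ⟨v, τ, ⟨⟨w, hw, hwv⟩, hτ⟩, rfl⟩
    refine ⟨w + τ • e, ⟨w, τ, ⟨hw, hτ⟩, rfl⟩, ?_⟩
    rw [hM, hwv]
  · rintro ⟨_, ⟨w, τ, ⟨hw, hτ⟩, rfl⟩, rfl⟩
    refine ⟨⟨L w, Submodule.mem_orthogonal_singleton_iff_inner_right.2 (hLN w)⟩, τ,
      ⟨⟨w, hw, rfl⟩, hτ⟩, ?_⟩
    rw [hM]

end LinearImage

/-- The properties of the gauge of a convex body with the origin in its interior. -/
structure BodyGauge {E : Type*} [NormedAddCommGroup E] [NormedSpace ℝ E] (g : E → ℝ) (ρ R : ℝ) :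
    Prop where
  pos_rho : 0 < ρ
  pos_R : 0 < R
  smul : ∀ {t : ℝ}, 0 ≤ t → ∀ x, g (t • x) = t * g x
  add_le : ∀ x y, g (x + y) ≤ g x + g y
  le_div : ∀ x, g x ≤ ‖x‖ / ρ
  div_le : ∀ x, ‖x‖ / R ≤ g x

namespace BodyGauge

variable {E : Type*} [NormedAddCommGroup E] [InnerProductSpace ℝ E] {g : E → ℝ} {ρ R : ℝ}

lemma nonneg (hg : BodyGauge g ρ R) (x : E) : 0 ≤ g x :=
  (div_nonneg (norm_nonneg x) hg.pos_R.le).trans (hg.div_le x)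

lemma zero (hg : BodyGauge g ρ R) : g 0 = 0 := by
  have := hg.smul le_rfl (0 : E)
  simpa using this

lemma pos (hg : BodyGauge g ρ R) {x : E} (hx : x ≠ 0) : 0 < g x :=
  (div_pos (norm_pos_iff.2 hx) hg.pos_R).trans_le (hg.div_le x)

lemma convexOn (hg : BodyGauge g ρ R) : ConvexOn ℝ univ g := by
  refine ⟨convex_univ, fun x _ y _ a b ha hb _ => ?_⟩
  have := hg.add_le (a • x) (b • y)
  rwa [hg.smul ha, hg.smul hb] at this

lemma abs_sub_le (hg : BodyGauge g ρ R) (x y : E) : |g x - g y| ≤ ‖x - y‖ / ρ := by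
  have h1 := hg.add_le (x - y) y
  have h2 := hg.add_le (y - x) x
  rw [sub_add_cancel] at h1 h2
  have h3 := hg.le_div (x - y)
  have h4 := hg.le_div (y - x)
  rw [norm_sub_rev] at h4
  rw [abs_le]; constructor <;> linarith

lemma lipschitz (hg : BodyGauge g ρ R) : LipschitzWith (Real.toNNReal ρ⁻¹) g := by
  refine LipschitzWith.of_dist_le_mul fun x y => ?_
  rw [Real.dist_eq, dist_eq_norm, Real.coe_toNNReal _ (inv_nonneg.2 hg.pos_rho.le), mul_comm,
    ← div_eq_mul_inv]
  exact hg.abs_sub_le x y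

lemma continuous (hg : BodyGauge g ρ R) : Continuous g := hg.lipschitz.continuous

lemma fderiv_self (hg : BodyGauge g ρ R) {x : E} (hx : DifferentiableAt ℝ g x) :
    fderiv ℝ g x x = g x := by
  have h1 := (hx.hasFDerivAt.hasLineDerivAt x)
  have h2 : HasLineDerivAt ℝ g (g x) x x := by
    have h3 : HasDerivAt (fun t : ℝ => (1 + t) * g x) (g x) 0 := by
      simpa using ((hasDerivAt_id (0 : ℝ)).const_add 1).mul_const (g x)
    refine h3.congr_of_eventuallyEq ?_
    filter_upwards [Ioi_mem_nhds (show (-1 : ℝ) < 0 by norm_num)] with t ht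
    have ht : -1 < t := ht
    rw [← hg.smul (by linarith), add_smul, one_smul]
  exact h1.unique h2

lemma norm_fderiv_pos (hg : BodyGauge g ρ R) {x : E} (hx : DifferentiableAt ℝ g x) (hx0 : x ≠ 0) :
    0 < ‖fderiv ℝ g x‖ := by
  rw [norm_pos_iff]
  intro h
  have := hg.fderiv_self hx
  rw [h] at this
  exact (hg.pos hx0).ne this

lemma hasFDerivAt_smul (hg : BodyGauge g ρ R) {x : E} {f : E →L[ℝ] ℝ} (hx : HasFDerivAt g f x)
    {t : ℝ} (ht : 0 < t) : HasFDerivAt g f (t • x) := by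
  have h1 : g = fun z => t * g (t⁻¹ • z) := by
    ext z
    rw [hg.smul (inv_nonneg.2 ht.le), mul_inv_cancel_left₀ ht.ne']
  rw [h1]
  have h2 : HasFDerivAt g f (t⁻¹ • t • x) := by rwa [inv_smul_smul₀ ht.ne']
  have h3 := (h2.comp (t • x) ((hasFDerivAt_id (𝕜 := ℝ) (t • x)).const_smul t⁻¹)).const_mul t
  refine h3.congr_fderiv ?_
  ext v
  simp [mul_inv_cancel_left₀ ht.ne']

lemma fderiv_smul (hg : BodyGauge g ρ R) (x : E) {t : ℝ} (ht : 0 < t) :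
    fderiv ℝ g (t • x) = fderiv ℝ g x := by
  by_cases hx : DifferentiableAt ℝ g x
  · exact (hg.hasFDerivAt_smul hx.hasFDerivAt ht).fderiv
  · have hx' : ¬ DifferentiableAt ℝ g (t • x) := fun h => hx (by
      have := (hg.hasFDerivAt_smul h.hasFDerivAt (inv_pos.2 ht)).differentiableAt
      rwa [inv_smul_smul₀ ht.ne'] at this)
    rw [fderiv_zero_of_not_differentiableAt hx, fderiv_zero_of_not_differentiableAt hx']

end BodyGauge

end Illumination
end

/-! ### Radial charts of the boundary and polar coordinates -/

noncomputable section

namespace Illumination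

open scoped ENNReal NNReal

namespace BodyGauge

variable {E : Type*} [NormedAddCommGroup E] [InnerProductSpace ℝ E] {g : E → ℝ} {ρ R : ℝ}

/-- Radial parametrization of the part of `{g = 1}` in the half space `⟨e, x⟩ > 0`. -/
def chart (g : E → ℝ) (e : E) (y : (Submodule.span ℝ {e})ᗮ) : E := (g (e + y))⁻¹ • (e + y)

lemma inner_add_coe {e : E} (he : ‖e‖ = 1) (y : (Submodule.span ℝ {e})ᗮ) :
    inner ℝ e (e + y) = 1 := by
  rw [inner_add_right, inner_coe_orthogonal, real_inner_self_eq_norm_sq, he]; norm_num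

lemma add_coe_ne_zero {e : E} (he : ‖e‖ = 1) (y : (Submodule.span ℝ {e})ᗮ) : e + (y : E) ≠ 0 := by
  intro h
  have := inner_add_coe he y
  rw [h, inner_zero_right] at this
  exact zero_ne_one this

lemma one_le_norm_add_coe {e : E} (he : ‖e‖ = 1) (y : (Submodule.span ℝ {e})ᗮ) :
    1 ≤ ‖e + (y : E)‖ := by
  have := real_inner_le_norm e (e + y)
  rwa [inner_add_coe he, he, one_mul] at this

lemma pos_chart (hg : BodyGauge g ρ R) {e : E} (he : ‖e‖ = 1) (y : (Submodule.span ℝ {e})ᗮ) :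
    0 < g (e + y) := hg.pos (add_coe_ne_zero he y)

lemma gauge_chart (hg : BodyGauge g ρ R) {e : E} (he : ‖e‖ = 1) (y : (Submodule.span ℝ {e})ᗮ) :
    g (chart g e y) = 1 := by
  rw [chart, hg.smul (inv_nonneg.2 (hg.pos_chart he y).le), inv_mul_cancel₀ (hg.pos_chart he y).ne']

lemma inner_chart {e : E} (he : ‖e‖ = 1) (y : (Submodule.span ℝ {e})ᗮ) :
    inner ℝ e (chart g e y) = (g (e + y))⁻¹ := by
  rw [chart, inner_smul_right, inner_add_coe he, mul_one]

lemma injective_chart (hg : BodyGauge g ρ R) {e : E} (he : ‖e‖ = 1) :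
    Function.Injective (chart g e) := by
  intro y z h
  have h1 : g (e + y) = g (e + z) := by
    have := congrArg (inner ℝ e) h
    rwa [inner_chart he, inner_chart he, inv_inj] at this
  rw [chart, chart, h1] at h
  have h2 := smul_right_injective E (inv_ne_zero (hg.pos_chart he z).ne') h
  exact Subtype.ext (add_left_cancel h2)

lemma range_chart (hg : BodyGauge g ρ R) {e : E} (he : ‖e‖ = 1) :
    range (chart g e) = {x | g x = 1 ∧ 0 < inner ℝ e x} := by
  ext x
  constructor
  · rintro ⟨y, rfl⟩
    exact ⟨hg.gauge_chart he y, by rw [inner_chart he]; exact inv_pos.2 (hg.pos_chart he y)⟩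
  · rintro ⟨hx, hpos⟩
    set c := inner ℝ e x with hc
    have hy : c⁻¹ • x - e ∈ (Submodule.span ℝ {e})ᗮ := by
      rw [Submodule.mem_orthogonal_singleton_iff_inner_right, inner_sub_right, inner_smul_right,
        ← hc, real_inner_self_eq_norm_sq, he, inv_mul_cancel₀ hpos.ne']
      norm_num
    refine ⟨⟨_, hy⟩, ?_⟩
    simp only [chart, add_sub_cancel]
    rw [hg.smul (inv_nonneg.2 hpos.le), hx, mul_one, inv_inv, smul_inv_smul₀ hpos.ne']

lemma continuous_chart (hg : BodyGauge g ρ R) {e : E} (he : ‖e‖ = 1) : Continuous (chart g e) := by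
  have h1 : Continuous fun y : (Submodule.span ℝ {e})ᗮ => g (e + y) :=
    hg.continuous.comp (by fun_prop)
  exact (h1.inv₀ fun y => (hg.pos_chart he y).ne').smul (by fun_prop)

lemma dist_chart_le (hg : BodyGauge g ρ R) {e : E} (he : ‖e‖ = 1)
    (y z : (Submodule.span ℝ {e})ᗮ) :
    dist (chart g e y) (chart g e z) ≤ (R + R * R * ‖e + (z : E)‖ / ρ) * dist y z := by
  have hR := hg.pos_R
  have hρ := hg.pos_rho
  have hy : (g (e + y))⁻¹ ≤ R := by
    rw [inv_le_comm₀ (hg.pos_chart he y) hR, ← one_div]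
    refine le_trans ?_ (hg.div_le _)
    gcongr
    exact one_le_norm_add_coe he y
  have hz : (g (e + z))⁻¹ ≤ R := by
    rw [inv_le_comm₀ (hg.pos_chart he z) hR, ← one_div]
    refine le_trans ?_ (hg.div_le _)
    gcongr
    exact one_le_norm_add_coe he z
  have hy0 : 0 < (g (e + y))⁻¹ := inv_pos.2 (hg.pos_chart he y)
  have hz0 : 0 < (g (e + z))⁻¹ := inv_pos.2 (hg.pos_chart he z)
  have e1 : chart g e y - chart g e z = (g (e + y))⁻¹ • ((y : E) - z) +
      ((g (e + y))⁻¹ * (g (e + z))⁻¹ * (g (e + z) - g (e + y))) • (e + (z : E)) := by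
    have : (g (e + y))⁻¹ * (g (e + z))⁻¹ * (g (e + z) - g (e + y))
        = (g (e + y))⁻¹ - (g (e + z))⁻¹ := by
      have h1 := (hg.pos_chart he y).ne'
      have h2 := (hg.pos_chart he z).ne'
      field_simp
    rw [this, chart, chart]
    module
  have hd : dist y z = ‖(y : E) - z‖ := by rw [Subtype.dist_eq, dist_eq_norm]
  have h3 : |g (e + z) - g (e + y)| ≤ ‖(y : E) - z‖ / ρ := by
    have := hg.abs_sub_le (e + (z : E)) (e + y)
    rwa [add_sub_add_left_eq_sub, norm_sub_rev] at this
  rw [dist_eq_norm, e1, hd]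
  refine (norm_add_le _ _).trans ?_
  rw [norm_smul, norm_smul, norm_mul, norm_mul, Real.norm_of_nonneg hy0.le,
    Real.norm_of_nonneg hz0.le, Real.norm_eq_abs, add_mul]
  refine add_le_add (by gcongr) ?_
  calc (g (e + y))⁻¹ * (g (e + z))⁻¹ * |g (e + z) - g (e + y)| * ‖e + (z : E)‖
      ≤ R * R * (‖(y : E) - z‖ / ρ) * ‖e + (z : E)‖ := by gcongr
    _ = _ := by ring

/-- Derivative of the radial parametrization. -/
def chartDeriv (g : E → ℝ) (e : E) (y : (Submodule.span ℝ {e})ᗮ) :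
    (Submodule.span ℝ {e})ᗮ →L[ℝ] E :=
  (g (e + y))⁻¹ • (Submodule.span ℝ {e})ᗮ.subtypeL +
    (-((g (e + y)) ^ 2)⁻¹ • (fderiv ℝ g (e + y)).comp
      (Submodule.span ℝ {e})ᗮ.subtypeL).smulRight (e + (y : E))

lemma hasFDerivAt_chart (hg : BodyGauge g ρ R) {e : E} (he : ‖e‖ = 1)
    {y : (Submodule.span ℝ {e})ᗮ} (hy : DifferentiableAt ℝ g (e + y)) :
    HasFDerivAt (chart g e) (chartDeriv g e y) y := by
  have h1 : HasFDerivAt (fun y : (Submodule.span ℝ {e})ᗮ => e + (y : E))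
      (Submodule.span ℝ {e})ᗮ.subtypeL y :=
    ((Submodule.span ℝ {e})ᗮ.subtypeL.hasFDerivAt).const_add e
  have h2 := hy.hasFDerivAt.comp y h1
  have h3 := (hasDerivAt_inv (hg.pos_chart he y).ne').comp_hasFDerivAt y h2
  have h4 := h3.smul h1
  exact h4

variable [FiniteDimensional ℝ E]

/-- The derivative of the chart takes values in the orthogonal complement of the gradient `p`.
Extending it by `e ↦ p / ‖p‖` gives an endomorphism of `E` whose determinant is the area factor;
`det_radial` computes it. -/
lemma chartDeriv_hausdorff [MeasurableSpace E] [BorelSpace E] (hg : BodyGauge g ρ R) {e : E}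
    (he : ‖e‖ = 1) {y : (Submodule.span ℝ {e})ᗮ} (hy : DifferentiableAt ℝ g (e + y)) :
    (∀ S, (Measure.euclideanHausdorffMeasure (Module.finrank ℝ E - 1) : Measure E)
      (chartDeriv g e y '' S) = ENNReal.ofReal (‖fderiv ℝ g (e + y)‖ *
        (g (e + y) ^ Module.finrank ℝ E)⁻¹) * volume S) ∧
    Function.Injective (chartDeriv g e y) := by
  set p : E := (InnerProductSpace.toDual ℝ E).symm (fderiv ℝ g (e + y)) with hp
  have hpi : ∀ v, inner ℝ p v = fderiv ℝ g (e + y) v := fun v => by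
    rw [hp, InnerProductSpace.toDual_symm_apply]
  have hpn : ‖p‖ = ‖fderiv ℝ g (e + y)‖ := by rw [hp, LinearIsometryEquiv.norm_map]
  have hpn0 : 0 < ‖p‖ := by rw [hpn]; exact hg.norm_fderiv_pos hy (add_coe_ne_zero he y)
  set c := g (e + y) with hc
  have hc0 : 0 < c := hg.pos_chart he y
  have hpu : inner ℝ p (e + (y : E)) = c := by rw [hpi, hg.fderiv_self hy]
  set Q : E →ₗ[ℝ] E := LinearMap.id - (innerₗ E e).smulRight e with hQ
  set M : E →ₗ[ℝ] E := c⁻¹ • Q - (((c ^ 2)⁻¹ • innerₗ E p) ∘ₗ Q).smulRight (e + (y : E)) +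
    (innerₗ E e).smulRight (‖p‖⁻¹ • p) with hM
  have hMw : ∀ w, M w = c⁻¹ • (w - inner ℝ e w • e) - ((c ^ 2)⁻¹ * inner ℝ p (w - inner ℝ e w • e)) •
      (e + (y : E)) + inner ℝ e w • (‖p‖⁻¹ • p) := fun w => by
    simp [hM, hQ]
  have hdet := det_radial hc0 (inner_coe_orthogonal e y) he hpu M hMw
  have hN : ‖‖p‖⁻¹ • p‖ = 1 := by
    rw [norm_smul, norm_inv, norm_norm, inv_mul_cancel₀ hpn0.ne']
  have hL : ∀ v : (Submodule.span ℝ {e})ᗮ, chartDeriv g e y v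
      = c⁻¹ • (v : E) - ((c ^ 2)⁻¹ * inner ℝ p v) • (e + (y : E)) := fun v => by
    simp only [chartDeriv, hpi, ← hc]
    simp [sub_eq_add_neg]
    abel
  have hMv : ∀ (v : (Submodule.span ℝ {e})ᗮ) (τ : ℝ),
      M (v + τ • e) = chartDeriv g e y v + τ • (‖p‖⁻¹ • p) := by
    intro v τ
    have h1 : inner ℝ e ((v : E) + τ • e) = τ := by
      rw [inner_add_right, inner_coe_orthogonal, inner_smul_right, real_inner_self_eq_norm_sq, he]
      simp
    rw [hMw, h1, hL, add_sub_cancel_right]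
  have hLN : ∀ v, inner ℝ (‖p‖⁻¹ • p) (chartDeriv g e y v) = 0 := by
    intro v
    rw [hL, real_inner_smul_left, inner_sub_right, inner_smul_right, inner_smul_right, hpu]
    field_simp
    ring
  have hpos : 0 < ‖p‖ * (c ^ Module.finrank ℝ E)⁻¹ := by positivity
  constructor
  · intro S
    rw [euclideanHausdorffMeasure_linear_image he hN (chartDeriv g e y) M hMv hLN S, hdet,
      abs_of_pos hpos, hpn]
  · have hinj : Function.Injective M := by
      have : LinearMap.det M ≠ 0 := by rw [hdet]; exact hpos.ne'
      exact (LinearMap.equivOfDetNeZero M this).injective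
    intro v w hvw
    have h1 := hMv v 0
    have h2 := hMv w 0
    rw [zero_smul, zero_smul, add_zero, add_zero] at h1 h2
    exact Subtype.ext (hinj (by rw [h1, h2, hvw]))

variable [MeasurableSpace E] [BorelSpace E]

/-- The non-differentiability set is null by Rademacher's theorem and invariant under positive
dilations, so by Fubini in projective coordinates its slice by the hyperplane `e + e^⊥` is null as
well. -/
lemma ae_differentiableAt_chart (hg : BodyGauge g ρ R) {e : E} (he : ‖e‖ = 1) :
    ∀ᵐ y : (Submodule.span ℝ {e})ᗮ, DifferentiableAt ℝ g (e + y) := by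
  have h0 : volume {x : E | ¬ DifferentiableAt ℝ g x} = 0 :=
    ae_iff.1 (hg.lipschitz.ae_differentiableAt (μ := (volume : Measure E)))
  have hm : MeasurableSet {x : E | ¬ DifferentiableAt ℝ g x} :=
    (measurableSet_of_differentiableAt ℝ g).compl
  have h1 := lintegral_halfSpace e he (F := {x : E | ¬ DifferentiableAt ℝ g x}.indicator 1)
    (measurable_one.indicator hm)
  have h2 : ∫⁻ x in {x | 0 < inner ℝ e x}, {x : E | ¬ DifferentiableAt ℝ g x}.indicator 1 x = 0 := by
    rw [lintegral_indicator_one hm]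
    exact le_antisymm ((Measure.restrict_apply_le _ _).trans h0.le) zero_le
  rw [h2] at h1
  have hm3 : Measurable fun y : (Submodule.span ℝ {e})ᗮ => ∫⁻ t in Ioi (0 : ℝ),
      {x : E | ¬ DifferentiableAt ℝ g x}.indicator 1 (t • (e + (y : E))) *
        ENNReal.ofReal (t ^ (Module.finrank ℝ E - 1)) := by
    refine Measurable.lintegral_prod_right' (f := fun q : (Submodule.span ℝ {e})ᗮ × ℝ =>
      {x : E | ¬ DifferentiableAt ℝ g x}.indicator (1 : E → ℝ≥0∞) (q.2 • (e + (q.1 : E))) *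
        ENNReal.ofReal (q.2 ^ (Module.finrank ℝ E - 1))) ?_
    exact ((measurable_one.indicator hm).comp (by fun_prop)).mul (by fun_prop)
  have h3 := (lintegral_eq_zero_iff hm3).1 h1.symm
  filter_upwards [h3] with y hy
  by_contra hnd
  have h4 : ∀ t ∈ Ioi (0 : ℝ), {x : E | ¬ DifferentiableAt ℝ g x}.indicator (1 : E → ℝ≥0∞)
      (t • (e + (y : E))) * ENNReal.ofReal (t ^ (Module.finrank ℝ E - 1))
        = ENNReal.ofReal (t ^ (Module.finrank ℝ E - 1)) := by
    intro t ht
    have ht : 0 < t := ht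
    rw [indicator_of_mem, Pi.one_apply, one_mul]
    intro h
    apply hnd
    have := (hg.hasFDerivAt_smul h.hasFDerivAt (inv_pos.2 ht)).differentiableAt
    rwa [inv_smul_smul₀ ht.ne'] at this
  simp only [Pi.zero_apply] at hy
  rw [setLIntegral_congr_fun measurableSet_Ioi h4] at hy
  have h5 := (setLIntegral_eq_zero_iff measurableSet_Ioi (by fun_prop)).1 hy
  have h6 : (volume (Ioi (0 : ℝ))) = 0 := by
    have : ∀ᵐ t : ℝ, t ∉ Ioi (0 : ℝ) := by
      filter_upwards [h5] with t ht htt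
      have := ht htt
      rw [ENNReal.ofReal_eq_zero] at this
      exact absurd this (not_le.2 (pow_pos htt _))
    have := ae_iff.1 this
    simp only [not_not] at this
    exact this
  simp at h6

lemma hausdorff_chart_image_null (hg : BodyGauge g ρ R) {e : E} (he : ‖e‖ = 1)
    {Z : Set (Submodule.span ℝ {e})ᗮ} (hZ : volume Z = 0) :
    (Measure.euclideanHausdorffMeasure (Module.finrank ℝ E - 1) : Measure E) (chart g e '' Z) = 0 := by
  have hfr : Module.finrank ℝ (Submodule.span ℝ {e})ᗮ = Module.finrank ℝ E - 1 := by
    have := finrank_orthogonal_add_one (e := e) (by rintro rfl; simp at he)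
    omega
  have hcov : chart g e '' Z = ⋃ k : ℕ, chart g e '' (Z ∩ Metric.closedBall 0 k) := by
    rw [← image_iUnion, ← inter_iUnion, Metric.iUnion_closedBall_nat, inter_univ]
  rw [hcov, measure_iUnion_null_iff]
  intro k
  have hR := hg.pos_R
  have hρ := hg.pos_rho
  have hC : 0 ≤ R + R * R * (1 + k) / ρ := by positivity
  have h1 := euclideanHausdorffMeasure_image_le_of_dist_le (u := chart g e)
    (v := (id : (Submodule.span ℝ {e})ᗮ → _)) (A := Z ∩ Metric.closedBall 0 k)
    (C := ⟨R + R * R * (1 + k) / ρ, hC⟩) (fun a _ b hb => ?_) (Module.finrank ℝ E - 1)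
  · rw [image_id, ← hfr, InnerProductSpace.euclideanHausdorffMeasure_eq_volume, hfr,
      measure_mono_null inter_subset_left hZ, mul_zero] at h1
    exact le_antisymm h1 zero_le
  · refine (hg.dist_chart_le he a b).trans ?_
    have h2 : ‖e + (b : E)‖ ≤ 1 + k := by
      refine (norm_add_le _ _).trans ?_
      rw [he]
      gcongr
      have := hb.2
      rwa [mem_closedBall_zero_iff] at this
    change _ ≤ (R + R * R * (1 + k) / ρ) * dist a b
    gcongr

/-- Density of the surface measure in the radial parametrization. -/
def chartDensity (g : E → ℝ) (e : E) (y : (Submodule.span ℝ {e})ᗮ) : ℝ≥0∞ :=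
  ENNReal.ofReal (‖fderiv ℝ g (e + y)‖ * (g (e + y) ^ Module.finrank ℝ E)⁻¹)

omit [FiniteDimensional ℝ E] in
lemma measurable_chartDensity (hg : BodyGauge g ρ R) (e : E) : Measurable (chartDensity g e) := by
  have h1 : Measurable fun y : (Submodule.span ℝ {e})ᗮ => fderiv ℝ g (e + (y : E)) :=
    (measurable_fderiv ℝ g).comp (by fun_prop)
  have h2 : Measurable fun y : (Submodule.span ℝ {e})ᗮ => g (e + (y : E)) :=
    hg.continuous.measurable.comp (by fun_prop)
  exact (h1.norm.mul (h2.pow_const _).inv).ennreal_ofReal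

lemma hausdorff_chart_image (hg : BodyGauge g ρ R) {e : E} (he : ‖e‖ = 1)
    {A : Set (Submodule.span ℝ {e})ᗮ} (hA : MeasurableSet A) :
    (Measure.euclideanHausdorffMeasure (Module.finrank ℝ E - 1) : Measure E) (chart g e '' A)
      = ∫⁻ y in A, chartDensity g e y := by
  set D := {y : (Submodule.span ℝ {e})ᗮ | DifferentiableAt ℝ g (e + (y : E))} with hD
  have hDm : MeasurableSet D :=
    (measurableSet_of_differentiableAt ℝ g).preimage (by fun_prop :
      Measurable fun y : (Submodule.span ℝ {e})ᗮ => e + (y : E))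
  have hDn : volume Dᶜ = 0 := hg.ae_differentiableAt_chart he
  have h1 := euclideanHausdorffMeasure_image_eq_lintegral (f := chart g e) (hA.inter hDm)
    (fun y hy => (hg.hasFDerivAt_chart he hy.2).hasFDerivWithinAt)
    (hg.injective_chart he).injOn (hg.measurable_chartDensity e)
    (fun y hy => (hg.chartDeriv_hausdorff he hy.2).1)
    (fun y hy => (hg.chartDeriv_hausdorff he hy.2).2)
    (fun y hy => by
      rw [chartDensity, Ne, ENNReal.ofReal_eq_zero, not_le]
      have h2 := hg.norm_fderiv_pos hy.2 (add_coe_ne_zero he y)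
      have h3 := hg.pos_chart he y
      positivity)
    (fun y hy => ENNReal.ofReal_ne_top)
  have h4 : ∫⁻ y in A ∩ D, chartDensity g e y = ∫⁻ y in A, chartDensity g e y :=
    setLIntegral_congr (by
      have : D =ᵐ[volume] univ := by rw [ae_eq_univ]; exact hDn
      simpa using (ae_eq_refl A).inter this)
  rw [← h4, ← h1]
  refine le_antisymm ?_ (measure_mono (image_mono inter_subset_left))
  rw [← inter_union_compl A D, image_union]
  refine (measure_union_le _ _).trans ?_
  rw [hg.hausdorff_chart_image_null he (measure_mono_null inter_subset_right hDn), add_zero,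
    inter_union_compl]

lemma restrict_hausdorff_eq_map_chart (hg : BodyGauge g ρ R) {e : E} (he : ‖e‖ = 1) :
    (Measure.euclideanHausdorffMeasure (Module.finrank ℝ E - 1) : Measure E).restrict
      {x | g x = 1 ∧ 0 < inner ℝ e x} = (volume.withDensity (chartDensity g e)).map (chart g e) := by
  ext S hS
  have hc := (hg.continuous_chart he).measurable
  rw [Measure.restrict_apply hS, Measure.map_apply hc hS, withDensity_apply _ (hc hS),
    ← hg.hausdorff_chart_image he (hc hS), image_preimage_eq_inter_range, hg.range_chart he]

lemma setLIntegral_chart (hg : BodyGauge g ρ R) {e : E} (he : ‖e‖ = 1) {G : E → ℝ≥0∞}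
    (hG : Measurable G) :
    ∫⁻ x in {x | g x = 1 ∧ 0 < inner ℝ e x}, G x
        ∂(Measure.euclideanHausdorffMeasure (Module.finrank ℝ E - 1))
      = ∫⁻ y, chartDensity g e y * G (chart g e y) := by
  have hc := (hg.continuous_chart he).measurable
  rw [hg.restrict_hausdorff_eq_map_chart he, lintegral_map hG hc,
    lintegral_withDensity_eq_lintegral_mul _ (hg.measurable_chartDensity e) (show Measurable fun y => G (chart g e y) from hG.comp hc)]
  rfl

/-- The density of the cone measure with respect to the surface measure. -/
def conormal (g : E → ℝ) (x : E) : ℝ≥0∞ := (ENNReal.ofReal ‖fderiv ℝ g x‖)⁻¹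

omit [FiniteDimensional ℝ E] in
lemma measurable_conormal : Measurable (conormal g) :=
  (measurable_fderiv ℝ g).norm.ennreal_ofReal.inv

/-- Integral along a ray with the polar weight. -/
def rayIntegral (F : E → ℝ≥0∞) (x : E) : ℝ≥0∞ :=
  ∫⁻ t in Ioi (0 : ℝ), F (t • x) * ENNReal.ofReal (t ^ (Module.finrank ℝ E - 1))

lemma measurable_rayIntegral {F : E → ℝ≥0∞} (hF : Measurable F) : Measurable (rayIntegral F) := by
  refine Measurable.lintegral_prod_right' (f := fun q : E × ℝ =>
      F (q.2 • q.1) * ENNReal.ofReal (q.2 ^ (Module.finrank ℝ E - 1))) ?_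
  exact (hF.comp (by fun_prop)).mul (by fun_prop)

omit [FiniteDimensional ℝ E] in
lemma rayIntegral_smul {F : E → ℝ≥0∞} (hF : Measurable F) {c : ℝ} (hc : 0 < c) (x : E)
    (hn : Module.finrank ℝ E ≠ 0) :
    rayIntegral F x = ENNReal.ofReal (c ^ Module.finrank ℝ E) * rayIntegral F (c • x) := by
  have hm : Measurable ((Ioi (0 : ℝ)).indicator fun t => F (t • x) *
      ENNReal.ofReal (t ^ (Module.finrank ℝ E - 1))) :=
    ((hF.comp (by fun_prop)).mul (by fun_prop)).indicator measurableSet_Ioi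
  have h1 := lintegral_comp_smul hm hc
  rw [lintegral_indicator measurableSet_Ioi] at h1
  rw [rayIntegral, h1, rayIntegral, ← lintegral_indicator measurableSet_Ioi,
    ← lintegral_const_mul' _ _ ENNReal.ofReal_ne_top, ← lintegral_const_mul' _ _ ENNReal.ofReal_ne_top]
  refine lintegral_congr fun t => ?_
  have hmem : (c • t ∈ Ioi (0 : ℝ)) ↔ t ∈ Ioi (0 : ℝ) := by
    simp [mul_pos_iff_of_pos_left hc]
  by_cases ht : t ∈ Ioi (0 : ℝ)
  · rw [indicator_of_mem ht, indicator_of_mem (hmem.2 ht), Module.finrank_self, pow_one]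
    rw [smul_eq_mul, smul_smul, mul_comm t c, mul_left_comm, ← ENNReal.ofReal_mul hc.le,
      mul_left_comm (ENNReal.ofReal _), ← ENNReal.ofReal_mul (by positivity)]
    congr 2
    rw [mul_pow, ← mul_assoc, mul_pow_sub_one hn]
  · rw [indicator_of_notMem ht, indicator_of_notMem (fun h => ht (hmem.1 h)), mul_zero, mul_zero]

/-- The weights cancel. The chart density is `‖∇g‖ g(e + y)^(-n)`; the gradient factor is removed by
`conormal`, and the power comes from rescaling the ray parameter from `e + y` to the boundary point.
-/
lemma polar_halfSpace (hg : BodyGauge g ρ R) {e : E} (he : ‖e‖ = 1) {F : E → ℝ≥0∞}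
    (hF : Measurable F) :
    ∫⁻ x in {x | 0 < inner ℝ e x}, F x = ∫⁻ x in {x | g x = 1 ∧ 0 < inner ℝ e x},
      conormal g x * rayIntegral F x
        ∂(Measure.euclideanHausdorffMeasure (Module.finrank ℝ E - 1)) := by
  have hn : Module.finrank ℝ E ≠ 0 := by
    have := finrank_orthogonal_add_one (e := e) (by rintro rfl; simp at he)
    omega
  rw [lintegral_halfSpace e he hF,
    hg.setLIntegral_chart he (G := fun x => conormal g x * rayIntegral F x)
      (measurable_conormal.mul (measurable_rayIntegral hF))]
  refine lintegral_congr_ae ?_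
  filter_upwards [hg.ae_differentiableAt_chart he] with y hy
  have hc := hg.pos_chart he y
  have h1 : conormal g (chart g e y) = (ENNReal.ofReal ‖fderiv ℝ g (e + y)‖)⁻¹ := by
    rw [conormal, chart, hg.fderiv_smul _ (inv_pos.2 hc)]
  have hpos := hg.norm_fderiv_pos hy (add_coe_ne_zero he y)
  have h2 := rayIntegral_smul hF (inv_pos.2 hc) (e + (y : E)) hn
  change rayIntegral F (e + (y : E)) = _
  rw [h1, h2, chartDensity, ENNReal.ofReal_mul (norm_nonneg _), ← mul_assoc, inv_pow, chart]
  congr 1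
  rw [mul_right_comm, ENNReal.mul_inv_cancel (ENNReal.ofReal_pos.2 hpos).ne' ENNReal.ofReal_ne_top, one_mul]

omit [MeasurableSpace E] [BorelSpace E] in
lemma exists_seq_unit : ∃ e : ℕ → E, (∀ k, ‖e k‖ = 1 ∨ e k = 0) ∧
    ∀ x : E, x ≠ 0 → ∃ k, 0 < inner ℝ (e k) x := by
  set d := TopologicalSpace.denseSeq E with hd
  refine ⟨fun k => ‖d k‖⁻¹ • d k, fun k => ?_, fun x hx => ?_⟩
  · by_cases h : d k = 0
    · right; simp [h]
    · left; rw [norm_smul, norm_inv, norm_norm, inv_mul_cancel₀ (norm_ne_zero_iff.2 h)]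
  · have ho : IsOpen {z : E | 0 < inner ℝ z x} := isOpen_lt continuous_const (by fun_prop)
    obtain ⟨k, hk⟩ := (TopologicalSpace.denseRange_denseSeq E).exists_mem_open ho
      ⟨x, real_inner_self_pos.2 hx⟩
    refine ⟨k, ?_⟩
    have hk : 0 < inner ℝ (d k) x := hk
    have : d k ≠ 0 := by intro h; rw [h, inner_zero_left] at hk; exact hk.false
    have h1 : 0 < ‖d k‖ := norm_pos_iff.2 this
    rw [real_inner_smul_left]
    positivity

/-- **Polar coordinates** with respect to the boundary of a convex body. -/
theorem polar (hg : BodyGauge g ρ R) [Nontrivial E] {F : E → ℝ≥0∞} (hF : Measurable F) :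
    ∫⁻ x, F x = ∫⁻ x in {x | g x = 1}, conormal g x * rayIntegral F x
        ∂(Measure.euclideanHausdorffMeasure (Module.finrank ℝ E - 1)) := by
  obtain ⟨e, he, hcov⟩ := exists_seq_unit (E := E)
  set Ω : ℕ → Set E := fun k => {x | 0 < inner ℝ (e k) x} with hΩ
  have hΩm : ∀ k, MeasurableSet (Ω k) := fun k => measurableSet_lt measurable_const (by fun_prop)
  -- Countably many half spaces cover `E \ {0}`. Making them disjoint keeps them invariant under
  -- positive dilations, so each ray lies in a single piece and the formula for half spaces
  -- restricts to it.
  set C := disjointed Ω with hC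
  have hCm : ∀ k, MeasurableSet (C k) := fun k => MeasurableSet.disjointed hΩm k
  have hCd : Pairwise (Function.onFun Disjoint C) := disjoint_disjointed Ω
  have hCu : ⋃ k, C k = {0}ᶜ := by
    rw [hC, iUnion_disjointed]
    ext x
    simp only [mem_iUnion, mem_compl_iff, mem_singleton_iff]
    exact ⟨fun ⟨k, hk⟩ h => by rw [h] at hk; simp [hΩ] at hk, fun h => hcov x h⟩
  have hcone : ∀ k, ∀ x, ∀ t : ℝ, 0 < t → (t • x ∈ C k ↔ x ∈ C k) := by
    intro k x t ht
    have : ∀ j, t • x ∈ Ω j ↔ x ∈ Ω j := fun j => by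
      simp [hΩ, inner_smul_right, mul_pos_iff_of_pos_left ht]
    simp only [hC, disjointed_eq_inter_compl, mem_inter_iff, mem_iInter, mem_compl_iff, this]
  have hSm : MeasurableSet {x : E | g x = 1} := hg.continuous.measurable (measurableSet_singleton 1)
  have hl : ∫⁻ x, F x = ∑' k, ∫⁻ x in C k, F x := by
    rw [← lintegral_iUnion hCm hCd, hCu, ← setLIntegral_univ]
    refine setLIntegral_congr ?_
    exact (ae_eq_univ.2 (by simp)).symm
  have hSC : {x : E | g x = 1} = ⋃ k, {x | g x = 1} ∩ C k := by
    rw [← inter_iUnion, hCu, inter_eq_self_of_subset_left]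
    intro x hx h
    rw [mem_singleton_iff] at h
    rw [h, mem_ofPred_eq, hg.zero] at hx
    exact zero_ne_one hx
  rw [hl, hSC, lintegral_iUnion (fun k => hSm.inter (hCm k))
    (fun i j hij => (hCd hij).mono inter_subset_right inter_subset_right)]
  refine tsum_congr fun k => ?_
  rcases he k with hk | hk
  · have h1 := hg.polar_halfSpace hk (hF.indicator (hCm k))
    have hsub : C k ⊆ Ω k := disjointed_subset Ω k
    rw [setLIntegral_indicator (hCm k), inter_eq_self_of_subset_left hsub] at h1
    rw [h1]
    have h2 : ∀ x, conormal g x * rayIntegral ((C k).indicator F) x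
        = (C k).indicator (fun x => conormal g x * rayIntegral F x) x := by
      intro x
      by_cases hx : x ∈ C k
      · rw [indicator_of_mem hx, rayIntegral, rayIntegral]
        congr 1
        refine setLIntegral_congr_fun measurableSet_Ioi fun t ht => ?_
        rw [indicator_of_mem ((hcone k x t ht).2 hx)]
      · rw [indicator_of_notMem hx, rayIntegral, setLIntegral_congr_fun (g := 0) measurableSet_Ioi]
        · simp
        · intro t ht
          simp only [indicator_of_notMem (fun h => hx ((hcone k x t ht).1 h)), zero_mul,
            Pi.zero_apply]
    simp_rw [h2]
    rw [setLIntegral_indicator (hCm k)]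
    congr 2
    ext x
    simp only [mem_inter_iff, mem_ofPred_eq]
    exact ⟨fun h => ⟨h.2.1, h.1⟩, fun h => ⟨h.2, h.1, hsub h.2⟩⟩
  · have : C k = ∅ := by
      refine subset_empty_iff.1 ((disjointed_subset Ω k).trans ?_)
      intro x hx
      simp [hΩ, hk] at hx
    simp [this]

end BodyGauge

end Illumination
end

/-! ### Balls touching the boundary from inside -/

noncomputable section

namespace Illumination

open scoped ENNReal NNReal Pointwise

namespace BodyGauge

variable {E : Type*} [NormedAddCommGroup E] [InnerProductSpace ℝ E] {g : E → ℝ} {ρ R : ℝ}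

lemma exists_support [FiniteDimensional ℝ E] (hg : BodyGauge g ρ R) (x : E) :
    ∃ p, inner ℝ p x = g x ∧ ∀ y, inner ℝ p y ≤ g y := by
  obtain ⟨p, hp⟩ := exists_subgradient hg.convexOn hg.lipschitz hg.nonneg x
  have h1 := hp 0
  have h2 := hp ((2 : ℝ) • x)
  rw [hg.zero, zero_sub, inner_neg_right] at h1
  rw [hg.smul zero_le_two, two_smul, add_sub_cancel_right] at h2
  have h3 : inner ℝ p x = g x := by linarith
  refine ⟨p, h3, fun y => ?_⟩
  have := hp y
  rw [inner_sub_right] at this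
  linarith

lemma norm_le_of_gauge_le (hg : BodyGauge g ρ R) {x : E} {a : ℝ} (hx : g x ≤ a) : ‖x‖ ≤ a * R :=
  (div_le_iff₀ hg.pos_R).1 ((hg.div_le x).trans hx)

/-- The boundary points at which a ball of radius `t` touches from inside. -/
def rollingSet (g : E → ℝ) (t : ℝ) : Set E :=
  {x | g x = 1 ∧ ∃ c, Metric.closedBall c t ⊆ {z | g z ≤ 1} ∧ dist x c = t}

/-- The ball lies in the half space `⟨p, ·⟩ ≤ 1`, whose boundary contains `x`. Equality in
Cauchy–Schwarz then forces `x - c` to point along `p`. -/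
lemma sub_eq_of_closedBall_subset {x c p : E} {t : ℝ} (ht : 0 ≤ t) (hpx : inner ℝ p x = 1)
    (hp : ∀ y, inner ℝ p y ≤ g y) (hc : Metric.closedBall c t ⊆ {z | g z ≤ 1})
    (hd : dist x c ≤ t) : ‖p‖ • (x - c) = t • p := by
  have hp0 : p ≠ 0 := by rintro rfl; simp at hpx
  have hpn : 0 < ‖p‖ := norm_pos_iff.2 hp0
  have h1 : inner ℝ p c + t * ‖p‖ ≤ 1 := by
    have hm : c + (t / ‖p‖) • p ∈ Metric.closedBall c t := by
      rw [mem_closedBall_iff_norm, add_sub_cancel_left, norm_smul, Real.norm_of_nonneg (by positivity)]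
      field_simp
      rfl
    have := (hp _).trans (hc hm)
    rw [inner_add_right, inner_smul_right, real_inner_self_eq_norm_sq] at this
    have e : t / ‖p‖ * ‖p‖ ^ 2 = t * ‖p‖ := by field_simp
    rwa [e] at this
  have h2 : t * ‖p‖ ≤ inner ℝ p (x - c) := by rw [inner_sub_right]; linarith
  rw [dist_eq_norm] at hd
  have h3 : inner ℝ p (x - c) ≤ ‖p‖ * ‖x - c‖ := real_inner_le_norm _ _
  have h4 : ‖x - c‖ = t := le_antisymm hd (by
    have : t * ‖p‖ ≤ ‖x - c‖ * ‖p‖ := by linarith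
    exact le_of_mul_le_mul_right this hpn)
  have h5 : inner ℝ p (x - c) = ‖p‖ * ‖x - c‖ := by
    rw [h4] at h3 ⊢; linarith
  have := (inner_eq_norm_mul_iff_real).1 h5
  rw [h4] at this
  exact this.symm

/-- The point `c' + (x - c) = x + (c' - c)` lies in the other ball, hence below the supporting
hyperplane at `x`, whose normal is parallel to `x - c`. -/
lemma inner_sub_le_of_closedBall_subset [FiniteDimensional ℝ E] (hg : BodyGauge g ρ R)
    {x c c' : E} {t : ℝ} (ht : 0 ≤ t) (hx : g x = 1)
    (hc : Metric.closedBall c t ⊆ {z | g z ≤ 1}) (hd : dist x c = t)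
    (hc' : Metric.closedBall c' t ⊆ {z | g z ≤ 1}) : inner ℝ (x - c) (c' - c) ≤ 0 := by
  obtain ⟨p, hpx, hp⟩ := hg.exists_support x
  rw [hx] at hpx
  have hp0 : p ≠ 0 := by rintro rfl; simp at hpx
  have hpn : 0 < ‖p‖ := norm_pos_iff.2 hp0
  have h1 := sub_eq_of_closedBall_subset ht hpx hp hc hd.le
  have hm : c' + (x - c) ∈ Metric.closedBall c' t := by
    rw [mem_closedBall_iff_norm, add_sub_cancel_left, ← dist_eq_norm, hd]
  have h2 := (hp _).trans (hc' hm)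
  have h3 : inner ℝ p (c' - c) ≤ 0 := by
    have : c' + (x - c) = x + (c' - c) := by abel
    rw [this, inner_add_right, hpx] at h2
    linarith
  have h4 : ‖p‖ * inner ℝ (x - c) (c' - c) ≤ 0 := by
    rw [← real_inner_smul_left, h1, real_inner_smul_left]
    exact mul_nonpos_of_nonneg_of_nonpos ht h3
  by_contra! h
  nlinarith

/-- This is the nonexpansiveness of the nearest point projection, with two variational inequalities
in place of a convex set. It serves both halves of the map of `exists_expanding`: from contact
points to centres, and from centres to the shrunken boundary. -/
lemma norm_sub_le_of_inner {y y' c c' : E} (h1 : inner ℝ (c - y) (y' - y) ≤ 0)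
    (h2 : inner ℝ (c' - y') (y - y') ≤ 0) : ‖y - y'‖ ≤ ‖c - c'‖ := by
  have h3 : ‖y - y'‖ ^ 2 ≤ inner ℝ (c - c') (y - y') := by
    have e1 : inner ℝ (c - y) (y' - y) = - inner ℝ (c - y) (y - y') := by
      rw [← inner_neg_right, neg_sub]
    have e2 : c - c' = (c - y) - (c' - y') + (y - y') := by abel
    rw [e2, inner_add_left, inner_sub_left, real_inner_self_eq_norm_sq]
    linarith
  have h4 := real_inner_le_norm (c - c') (y - y')
  by_contra! h
  nlinarith [norm_nonneg (c - c')]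

variable [FiniteDimensional ℝ E]

omit [FiniteDimensional ℝ E] in
lemma isClosed_ball_centers (hg : BodyGauge g ρ R) (t : ℝ) :
    IsClosed {c | Metric.closedBall c t ⊆ {z | g z ≤ 1}} := by
  have : {c | Metric.closedBall c t ⊆ {z | g z ≤ 1}}
      = ⋂ u ∈ Metric.closedBall (0 : E) t, {c | g (c + u) ≤ 1} := by
    ext c
    simp only [mem_ofPred_eq, mem_iInter]
    constructor
    · intro h u hu
      exact h (by simpa using hu)
    · intro h z hz
      have := h (z - c) (by simpa [dist_eq_norm] using hz)
      rwa [add_sub_cancel] at this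
  rw [this]
  exact isClosed_biInter fun u _ => isClosed_le (hg.continuous.comp (by fun_prop)) continuous_const

/-- Every point of the shrunken boundary is carried to the rolling set by an expanding map. -/
lemma exists_expanding (hg : BodyGauge g ρ R) {t : ℝ} (ht : 0 < t) (htρ : t < ρ) {y : E}
    (hy : g y = 1 - t / ρ) : ∃ c x, x ∈ rollingSet g t ∧
      Metric.closedBall c t ⊆ {z | g z ≤ 1} ∧ dist x c = t ∧
      ∀ y', g y' ≤ 1 - t / ρ → inner ℝ (c - y) (y' - y) ≤ 0 := by
  have hρ := hg.pos_rho
  have hs : t / ρ < 1 := (div_lt_one hρ).2 htρ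
  obtain ⟨p, hpy, hp⟩ := hg.exists_support y
  have hp0 : p ≠ 0 := by
    rintro rfl
    rw [inner_zero_left, hy] at hpy
    linarith
  have hball : ∀ {c : E} {m s : ℝ}, Metric.closedBall c t ⊆ {z | g z ≤ m} → ∀ v : E, ‖v‖ / ρ ≤ s →
      Metric.closedBall (c + v) t ⊆ {z | g z ≤ m + s} := by
    intro c m s hc v hv z hz
    have h1 : g (z - v) ≤ m := hc (by
      rw [mem_closedBall_iff_norm] at hz ⊢
      convert hz using 2
      abel)
    have h2 := hg.add_le (z - v) v
    rw [sub_add_cancel] at h2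
    have h3 := hg.le_div v
    change g z ≤ m + s
    linarith
  have hy0 : Metric.closedBall y t ⊆ {z | g z ≤ 1} := by
    intro z hz
    have h2 := hg.add_le y (z - y)
    rw [add_sub_cancel] at h2
    have h3 := hg.le_div (z - y)
    rw [mem_closedBall_iff_norm] at hz
    have h4 : ‖z - y‖ / ρ ≤ t / ρ := by gcongr
    change g z ≤ 1
    linarith
  -- The ball of radius `t` around `y` lies in the body because `g y + t / ρ = 1`; it is pushed
  -- along the normal `p` at `y` as far as it stays inside.
  set T : Set ℝ := {τ | 0 ≤ τ ∧ Metric.closedBall (y + τ • p) t ⊆ {z | g z ≤ 1}} with hT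
  have hTc : IsCompact T := by
    refine Metric.isCompact_of_isClosed_isBounded ?_ ?_
    · exact isClosed_Ici.inter ((hg.isClosed_ball_centers t).preimage
        (by fun_prop : Continuous fun τ : ℝ => y + τ • p))
    · refine (Metric.isBounded_Icc (0 : ℝ) ((R + ‖y‖) / ‖p‖)).subset fun τ hτ => ⟨hτ.1, ?_⟩
      have h1 : g (y + τ • p) ≤ 1 := hτ.2 (Metric.mem_closedBall_self ht.le)
      have h2 := hg.norm_le_of_gauge_le h1
      have h3 : ‖τ • p‖ ≤ ‖y + τ • p‖ + ‖y‖ := by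
        have := norm_sub_le (y + τ • p) y
        rwa [add_sub_cancel_left] at this
      rw [norm_smul, Real.norm_of_nonneg hτ.1] at h3
      rw [le_div_iff₀ (norm_pos_iff.2 hp0)]
      linarith
  obtain ⟨τ, hτT, hτmax⟩ := hTc.exists_isMaxOn ⟨0, le_rfl, by simpa using hy0⟩ continuousOn_id
  set c := y + τ • p with hc
  obtain ⟨x, hxc, hxmax⟩ := (isCompact_closedBall c t).exists_isMaxOn
    ⟨c, Metric.mem_closedBall_self ht.le⟩ hg.continuous.continuousOn
  have hx1 : g x = 1 := by
    refine le_antisymm (hτT.2 hxc) ?_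
    by_contra! hlt
    set ε := (1 - g x) * ρ / ‖p‖ with hε
    have hpn := norm_pos_iff.2 hp0
    have hε0 : 0 < ε := by
      have : 0 < 1 - g x := by linarith
      positivity
    have h1 := hball (m := g x) (fun z hz => hxmax hz) (ε • p) (s := 1 - g x) (by
      rw [norm_smul, Real.norm_of_nonneg hε0.le, hε]
      field_simp
      rfl)
    have h2 : τ + ε ∈ T := by
      refine ⟨by linarith [hτT.1], ?_⟩
      rw [add_smul, ← add_assoc]
      simpa using h1
    have h3 : τ + ε ≤ τ := hτmax h2
    linarith
  -- A maximiser of `g` inside the open ball could be dilated within the ball to a point with `g >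
  -- 1`.
  have hxd : dist x c = t := by
    refine le_antisymm hxc ?_
    by_contra! hlt
    have hcont : Tendsto (fun ε : ℝ => dist ((1 + ε) • x) c) (𝓝[>] 0) (𝓝 (dist ((1 + 0 : ℝ) • x) c)) :=
      (Continuous.tendsto (by fun_prop) (0 : ℝ)).mono_left nhdsWithin_le_nhds
    rw [add_zero, one_smul] at hcont
    obtain ⟨ε, hε, hε0⟩ := ((hcont.eventually (gt_mem_nhds hlt)).and self_mem_nhdsWithin).exists
    have hε0 : 0 < ε := hε0
    have h1 : g ((1 + ε) • x) ≤ 1 := hτT.2 hε.le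
    rw [hg.smul (by linarith), hx1] at h1
    linarith
  refine ⟨c, x, ⟨hx1, c, hτT.2, hxd⟩, hτT.2, hxd, fun y' hy' => ?_⟩
  have h1 : c - y = τ • p := by rw [hc, add_sub_cancel_left]
  rw [h1, real_inner_smul_left, inner_sub_right]
  refine mul_nonpos_of_nonneg_of_nonpos hτT.1 ?_
  have := hp y'
  linarith

variable [MeasurableSpace E] [BorelSpace E]

/-- The level set `g = 1 - t / ρ` is a homothetic copy of the boundary. The map `y ↦ x` of
`exists_expanding` sends it into the rolling set without decreasing distances, hence without
decreasing the Hausdorff measure. -/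
lemma hausdorff_rollingSet_ge (hg : BodyGauge g ρ R) {t : ℝ} (ht : 0 < t) (htρ : t < ρ) (d : ℕ) :
    ENNReal.ofReal ((1 - t / ρ) ^ d) * (Measure.euclideanHausdorffMeasure d : Measure E) {x | g x = 1}
      ≤ (Measure.euclideanHausdorffMeasure d : Measure E) (rollingSet g t) := by
  have hρ := hg.pos_rho
  have hs : 0 < 1 - t / ρ := by rw [sub_pos, div_lt_one hρ]; exact htρ
  have h1 : {y : E | g y = 1 - t / ρ} = (1 - t / ρ) • {x : E | g x = 1} := by
    ext y
    rw [mem_smul_set_iff_inv_smul_mem₀ hs.ne', mem_ofPred_eq, mem_ofPred_eq,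
      hg.smul (inv_nonneg.2 hs.le), inv_mul_eq_one₀ hs.ne', eq_comm]
  have h2 := Measure.euclideanHausdorffMeasure_smul₀ d hs.ne' {x : E | g x = 1}
  rw [← h1] at h2
  have h3 : ENNReal.ofReal ((1 - t / ρ) ^ d) * (Measure.euclideanHausdorffMeasure d : Measure E)
      {x | g x = 1} = (Measure.euclideanHausdorffMeasure d : Measure E) {y | g y = 1 - t / ρ} := by
    rw [h2, ENNReal.smul_def, smul_eq_mul]
    congr 1
    rw [ENNReal.ofReal_pow hs.le, ENNReal.coe_pow, ← enorm_eq_nnnorm, Real.enorm_of_nonneg hs.le]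
  rw [h3]
  choose! c x hx hc hd hn using fun (y : E) (hy : g y = 1 - t / ρ) => hg.exists_expanding ht htρ hy
  have h4 := euclideanHausdorffMeasure_image_le_of_dist_le (u := (id : E → E)) (v := x)
    (A := {y : E | g y = 1 - t / ρ}) (C := 1) (fun y hy y' hy' => ?_) d
  · rw [image_id, ENNReal.coe_one, one_pow, one_mul] at h4
    exact h4.trans (measure_mono (image_subset_iff.2 fun y hy => hx y hy))
  · rw [NNReal.coe_one, one_mul, id, id, dist_eq_norm, dist_eq_norm]
    refine (norm_sub_le_of_inner (hn y hy y' (le_of_eq hy')) (hn y' hy' y (le_of_eq hy))).trans ?_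
    exact norm_sub_le_of_inner
      (hg.inner_sub_le_of_closedBall_subset ht.le (hx y hy).1 (hc y hy) (hd y hy) (hc y' hy'))
      (hg.inner_sub_le_of_closedBall_subset ht.le (hx y' hy').1 (hc y' hy') (hd y' hy') (hc y hy))

omit [MeasurableSpace E] [BorelSpace E] in
lemma isClosed_rollingSet (hg : BodyGauge g ρ R) (t : ℝ) : IsClosed (rollingSet g t) := by
  set C := {c | Metric.closedBall c t ⊆ {z | g z ≤ 1}} with hC
  set Q : Set (E × E) := {q | g q.1 = 1 ∧ q.2 ∈ C ∧ dist q.1 q.2 = t} with hQ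
  have hcl : IsClosed Q := by
    refine (isClosed_eq (hg.continuous.comp continuous_fst) continuous_const).inter ?_
    exact ((hg.isClosed_ball_centers t).preimage continuous_snd).inter
      (isClosed_eq (by fun_prop) continuous_const)
  have hb : Bornology.IsBounded Q := by
    refine ((Metric.isBounded_closedBall (x := (0 : E)) (r := R)).prod
      (Metric.isBounded_closedBall (x := (0 : E)) (r := R + t))).subset fun q hq => ?_
    have h1 := hg.norm_le_of_gauge_le hq.1.le
    rw [one_mul] at h1
    refine ⟨by simpa using h1, ?_⟩
    rw [mem_closedBall_zero_iff]
    have h2 : ‖q.2‖ ≤ ‖q.1‖ + ‖q.1 - q.2‖ := by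
      have := norm_sub_le q.1 (q.1 - q.2)
      rwa [sub_sub_cancel] at this
    rw [← dist_eq_norm, hq.2.2] at h2
    linarith
  have himg : rollingSet g t = Prod.fst '' Q := by
    ext x
    constructor
    · rintro ⟨hx, c, hc, hd⟩
      exact ⟨(x, c), ⟨hx, hc, hd⟩, rfl⟩
    · rintro ⟨q, ⟨h1, h2, h3⟩, rfl⟩
      exact ⟨h1, q.2, h2, h3⟩
  rw [himg]
  exact ((Metric.isCompact_of_isClosed_isBounded hcl hb).image continuous_fst).isClosed

/-- In polar coordinates the finite volume of the body is at least `ρ ∫_0^1 t^(n-1) dt` times the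
boundary measure, because `‖∇g‖ ≤ 1 / ρ`. -/
lemma hausdorff_boundary_lt_top (hg : BodyGauge g ρ R) [Nontrivial E] :
    (Measure.euclideanHausdorffMeasure (Module.finrank ℝ E - 1) : Measure E) {x | g x = 1} < ∞ := by
  have hKm : MeasurableSet {x : E | g x ≤ 1} :=
    measurableSet_le hg.continuous.measurable measurable_const
  have hSm : MeasurableSet {x : E | g x = 1} := hg.continuous.measurable (measurableSet_singleton 1)
  have h1 := hg.polar (F := {x : E | g x ≤ 1}.indicator 1) (measurable_one.indicator hKm)
  rw [lintegral_indicator_one hKm] at h1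
  have hfin : volume {x : E | g x ≤ 1} < ∞ := by
    refine (measure_mono fun x (hx : g x ≤ 1) => ?_).trans_lt
      (measure_closedBall_lt_top (x := (0 : E)) (r := R))
    simpa using hg.norm_le_of_gauge_le hx
  rw [h1] at hfin
  set a : ℝ≥0∞ := ∫⁻ t in Ioc (0 : ℝ) 1, ENNReal.ofReal (t ^ (Module.finrank ℝ E - 1)) with ha
  have ha0 : a ≠ 0 := by
    intro h
    have h5 := (setLIntegral_eq_zero_iff measurableSet_Ioc (by fun_prop)).1 h
    have h6 : (volume (Ioc (0 : ℝ) 1)) = 0 := by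
      have : ∀ᵐ t : ℝ, t ∉ Ioc (0 : ℝ) 1 := by
        filter_upwards [h5] with t ht htt
        have := ht htt
        rw [ENNReal.ofReal_eq_zero] at this
        exact absurd this (not_le.2 (pow_pos htt.1 _))
      have := ae_iff.1 this
      simp only [not_not] at this
      exact this
    simp at h6
  have h2 : ∀ x ∈ {x : E | g x = 1}, ENNReal.ofReal ρ * a ≤
      conormal g x * rayIntegral ({x : E | g x ≤ 1}.indicator 1) x := by
    intro x hx
    have hx : g x = 1 := hx
    refine mul_le_mul' ?_ ?_
    · rw [conormal, ENNReal.le_inv_iff_le_inv, ← ENNReal.ofReal_inv_of_pos hg.pos_rho]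
      refine ENNReal.ofReal_le_ofReal ?_
      have := norm_fderiv_le_of_lipschitz ℝ hg.lipschitz (x₀ := x)
      rwa [Real.coe_toNNReal _ (inv_nonneg.2 hg.pos_rho.le)] at this
    · rw [ha, rayIntegral]
      refine le_trans ?_ (lintegral_mono_set (fun t (ht : t ∈ Ioc (0 : ℝ) 1) => ht.1))
      refine setLIntegral_mono' measurableSet_Ioc fun t ht => ?_
      rw [indicator_of_mem, Pi.one_apply, one_mul]
      rw [mem_ofPred_eq, hg.smul ht.1.le, hx, mul_one]
      exact ht.2
  have h3 := setLIntegral_mono' (μ := Measure.euclideanHausdorffMeasure (Module.finrank ℝ E - 1))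
    hSm h2
  rw [setLIntegral_const] at h3
  have h4 := h3.trans_lt hfin
  have hne : ENNReal.ofReal ρ * a ≠ 0 := mul_ne_zero (by simpa using hg.pos_rho) ha0
  by_contra htop
  rw [not_lt, top_le_iff] at htop
  rw [htop, ENNReal.mul_top hne] at h4
  exact h4.false

/-- Bernoulli's inequality turns the factor `(1 - t / ρ)^d` of `hausdorff_rollingSet_ge` into a
bound for the complement that is linear in `t`. -/
lemma hausdorff_diff_rollingSet_le (hg : BodyGauge g ρ R) [Nontrivial E] {t : ℝ} (ht : 0 < t)
    (htρ : t < ρ) :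
    (Measure.euclideanHausdorffMeasure (Module.finrank ℝ E - 1) : Measure E)
        ({x | g x = 1} \ rollingSet g t)
      ≤ ENNReal.ofReal ((Module.finrank ℝ E - 1 : ℕ) * (t / ρ)) *
        (Measure.euclideanHausdorffMeasure (Module.finrank ℝ E - 1) : Measure E) {x | g x = 1} := by
  have hρ := hg.pos_rho
  have hs : t / ρ < 1 := (div_lt_one hρ).2 htρ
  have hs0 : 0 < t / ρ := by positivity
  set d := Module.finrank ℝ E - 1 with hd
  set H := (Measure.euclideanHausdorffMeasure d : Measure E) {x | g x = 1} with hH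
  have hHt : H ≠ ∞ := hg.hausdorff_boundary_lt_top.ne
  have h1 := hg.hausdorff_rollingSet_ge ht htρ d
  have hsub : rollingSet g t ⊆ {x | g x = 1} := fun x hx => hx.1
  rw [measure_sdiff hsub (hg.isClosed_rollingSet t).measurableSet.nullMeasurableSet
    ((measure_mono hsub).trans_lt hg.hausdorff_boundary_lt_top).ne]
  rw [tsub_le_iff_right]
  refine le_trans ?_ (add_le_add_right h1 _)
  rw [← add_mul, ← ENNReal.ofReal_add (by positivity) (by
    have : 0 ≤ 1 - t / ρ := by linarith
    positivity)]
  refine le_mul_of_one_le_left' (ENNReal.one_le_ofReal.2 ?_)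
  have := one_add_mul_le_pow (show (-2 : ℝ) ≤ -(t / ρ) by linarith) d
  rw [← sub_eq_add_neg] at this
  linarith

/-- An integrable function that dominates the power `-β`, `β < 1`, of the radius of the largest
ball touching from inside. -/
lemma exists_rolling_bound (hg : BodyGauge g ρ R) [Nontrivial E] {β : ℝ} (hβ0 : 0 ≤ β)
    (hβ : β < 1) : ∃ D : E → ℝ≥0∞, Measurable D ∧
      ∫⁻ x in {x | g x = 1}, D x ∂(Measure.euclideanHausdorffMeasure (Module.finrank ℝ E - 1)) < ∞ ∧
      ∀ x, g x = 1 → D x < ∞ → ∃ r > 0, x ∈ rollingSet g r ∧ ENNReal.ofReal (r ^ (-β)) ≤ D x := by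
  have hρ := hg.pos_rho
  set t : ℕ → ℝ := fun k => ρ * (1 / 2) ^ (k + 1) with ht
  have ht0 : ∀ k, 0 < t k := fun k => by positivity
  have htρ : ∀ k, t k < ρ := fun k =>
    mul_lt_of_lt_one_right hρ (pow_lt_one₀ (by norm_num) (by norm_num) (by omega))
  set S : ℕ → Set E := fun k => {x | g x = 1} \ rollingSet g (t k) with hS
  have hSm : ∀ k, MeasurableSet (S k) := fun k =>
    (hg.continuous.measurable (measurableSet_singleton 1)).diff
      (hg.isClosed_rollingSet _).measurableSet
  set H := (Measure.euclideanHausdorffMeasure (Module.finrank ℝ E - 1) : Measure E) {x | g x = 1}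
    with hH
  -- A dyadic layer sum: the points of `S k` have measure `O(t_k)` and contribute `t_{k+1}^(-β)`.
  -- The terms are comparable to `2^(-k(1-β))`, so the sum of the integrals converges precisely
  -- because `β < 1`.
  set D : E → ℝ≥0∞ := fun x => ENNReal.ofReal (t 0 ^ (-β)) +
    ∑' k, ENNReal.ofReal (t (k + 1) ^ (-β)) * (S k).indicator 1 x with hD
  have hterm : ∀ k, Measurable fun x => ENNReal.ofReal (t (k + 1) ^ (-β)) *
      (S k).indicator (1 : E → ℝ≥0∞) x := fun k => (measurable_one.indicator (hSm k)).const_mul _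
  refine ⟨D, measurable_const.add (Measurable.tsum hterm), ?_, ?_⟩
  · rw [hD, lintegral_add_left measurable_const, lintegral_tsum fun k => (hterm k).aemeasurable]
    refine ENNReal.add_lt_top.2 ⟨?_, ?_⟩
    · rw [setLIntegral_const]
      exact ENNReal.mul_lt_top ENNReal.ofReal_lt_top hg.hausdorff_boundary_lt_top
    · have hle : ∀ k, ∫⁻ x in {x | g x = 1}, ENNReal.ofReal (t (k + 1) ^ (-β)) *
          (S k).indicator (1 : E → ℝ≥0∞) x
            ∂(Measure.euclideanHausdorffMeasure (Module.finrank ℝ E - 1))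
          ≤ ENNReal.ofReal (t (k + 1) ^ (-β) * ((Module.finrank ℝ E - 1 : ℕ) * (t k / ρ))) * H := by
        intro k
        rw [lintegral_const_mul' _ _ ENNReal.ofReal_ne_top, lintegral_indicator_one (hSm k),
          ENNReal.ofReal_mul (by have := ht0 (k + 1); positivity), mul_assoc]
        refine mul_le_mul_right ?_ _
        exact (Measure.restrict_apply_le _ _).trans
          (hg.hausdorff_diff_rollingSet_le (ht0 k) (htρ k))
      refine (ENNReal.tsum_le_tsum hle).trans_lt ?_
      rw [ENNReal.tsum_mul_right]
      refine ENNReal.mul_lt_top ?_ hg.hausdorff_boundary_lt_top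
      have hsum : Summable fun k => t (k + 1) ^ (-β) * ((Module.finrank ℝ E - 1 : ℕ) * (t k / ρ)) := by
        have hq : ((1 / 2 : ℝ) ^ (1 - β)) < 1 :=
          Real.rpow_lt_one (by norm_num) (by norm_num) (by linarith)
        have hgeo := (summable_geometric_of_lt_one (by positivity) hq).mul_left
          (ρ ^ (-β) * ((1 / 2 : ℝ) ^ (-β)) ^ 2 * (Module.finrank ℝ E - 1 : ℕ) * (1 / 2))
        refine hgeo.congr fun k => ?_
        have e1 : t (k + 1) ^ (-β) = ρ ^ (-β) * ((1 / 2 : ℝ) ^ (-β)) ^ (k + 2) := by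
          rw [ht]
          simp only
          rw [Real.mul_rpow hρ.le (by positivity), ← Real.rpow_natCast, ← Real.rpow_natCast,
            ← Real.rpow_mul (by norm_num), ← Real.rpow_mul (by norm_num), mul_comm (-β)]
        have e2 : t k / ρ = (1 / 2) ^ (k + 1) := by
          rw [ht]; field_simp
        have e3 : (1 / 2 : ℝ) ^ (1 - β) = (1 / 2) * (1 / 2 : ℝ) ^ (-β) := by
          rw [sub_eq_add_neg, Real.rpow_add (by norm_num), Real.rpow_one]
        rw [e1, e2, e3, mul_pow, pow_add ((1 / 2 : ℝ) ^ (-β)), pow_succ]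
        ring
      exact hsum.tsum_ofReal_lt_top
  · intro x hx hfin
    by_cases h0 : x ∈ rollingSet g (t 0)
    · exact ⟨t 0, ht0 0, h0, le_self_add⟩
    by_cases hex : ∃ k, x ∈ rollingSet g (t k)
    · classical
      obtain ⟨k, hk, hmin⟩ : ∃ k, x ∈ rollingSet g (t (k + 1)) ∧ x ∉ rollingSet g (t k) := by
        have hne : Nat.find hex ≠ 0 := fun h => h0 (by rw [← h]; exact Nat.find_spec hex)
        obtain ⟨m, hm⟩ := Nat.exists_eq_succ_of_ne_zero hne
        exact ⟨m, by rw [← Nat.succ_eq_add_one, ← hm]; exact Nat.find_spec hex,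
          Nat.find_min hex (by omega)⟩
      refine ⟨t (k + 1), ht0 _, hk, ?_⟩
      have hxS : x ∈ S k := ⟨hx, hmin⟩
      have h1 := ENNReal.le_tsum (f := fun k => ENNReal.ofReal (t (k + 1) ^ (-β)) *
        (S k).indicator (1 : E → ℝ≥0∞) x) k
      rw [indicator_of_mem hxS, Pi.one_apply, mul_one] at h1
      exact h1.trans le_add_self
    · exfalso
      push Not at hex
      -- A point at which no dyadic ball touches lies in every `S k`, and each term is at least
      -- `ρ^(-β)`, so `D` is infinite there.
      have h1 : ∑' k, ENNReal.ofReal (t (k + 1) ^ (-β)) * (S k).indicator (1 : E → ℝ≥0∞) x = ∞ := by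
        rw [← top_le_iff, ← ENNReal.tsum_const_eq_top_of_ne_zero (α := ℕ)
          (c := ENNReal.ofReal (ρ ^ (-β)))]
        · refine ENNReal.tsum_le_tsum fun k => ?_
          rw [indicator_of_mem (show x ∈ S k from ⟨hx, hex k⟩), Pi.one_apply, mul_one]
          exact ENNReal.ofReal_le_ofReal
            (Real.rpow_le_rpow_of_nonpos (ht0 _) (htρ _).le (by linarith))
        · simpa using Real.rpow_pos_of_pos hρ _
      rw [hD] at hfin
      simp only [h1, add_top, lt_self_iff_false] at hfin

/-- If `P` fails at a boundary point it fails on the whole open ray through it, so the ray integral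
of the indicator of the bad set is positive there. In polar coordinates the bad set is null, and
`conormal` never vanishes. -/
lemma ae_boundary_of_ae (hg : BodyGauge g ρ R) [Nontrivial E] {P : E → Prop} (hP : ∀ᵐ x, P x)
    (hcone : ∀ x, ∀ t : ℝ, 0 < t → P (t • x) → P x) :
    ∀ᵐ x ∂((Measure.euclideanHausdorffMeasure (Module.finrank ℝ E - 1) : Measure E).restrict
      {x | g x = 1}), P x := by
  set M := toMeasurable volume {x : E | ¬ P x} with hM
  have hMm : MeasurableSet M := measurableSet_toMeasurable _ _
  have hM0 : volume M = 0 := by rw [hM, measure_toMeasurable]; exact ae_iff.1 hP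
  have hFm : Measurable (M.indicator (1 : E → ℝ≥0∞)) := measurable_one.indicator hMm
  have h1 := hg.polar hFm
  rw [lintegral_indicator_one hMm, hM0] at h1
  have h2 := (lintegral_eq_zero_iff (measurable_conormal.mul (measurable_rayIntegral hFm))).1 h1.symm
  filter_upwards [h2] with x hx
  replace hx : conormal g x * rayIntegral (M.indicator 1) x = 0 := hx
  rw [mul_eq_zero, conormal, ENNReal.inv_eq_zero] at hx
  replace hx := hx.resolve_left ENNReal.ofReal_ne_top
  have hm : Measurable fun t : ℝ => M.indicator (1 : E → ℝ≥0∞) (t • x) *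
      ENNReal.ofReal (t ^ (Module.finrank ℝ E - 1)) := (hFm.comp (by fun_prop)).mul (by fun_prop)
  rw [rayIntegral, setLIntegral_eq_zero_iff measurableSet_Ioi hm] at hx
  by_contra hnP
  have h6 : (volume (Ioi (0 : ℝ))) = 0 := by
    have : ∀ᵐ t : ℝ, t ∉ Ioi (0 : ℝ) := by
      filter_upwards [hx] with t ht htt
      have := ht htt
      rw [mul_eq_zero, ENNReal.ofReal_eq_zero, indicator_of_mem] at this
      · rcases this with h | h
        · exact one_ne_zero h
        · exact absurd h (not_le.2 (pow_pos htt _))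
      · exact subset_toMeasurable _ _ fun h => hnP (hcone x t htt h)
    have := ae_iff.1 this
    simp only [not_not] at this
    exact this
  simp at h6

end BodyGauge

end Illumination
end

/-! ### Second order expansions of the gauge and the Gauss–Kronecker curvature -/

noncomputable section

namespace Illumination

open scoped ENNReal NNReal

section Expansion

variable {E : Type*} [NormedAddCommGroup E] [InnerProductSpace ℝ E] {g : E → ℝ} {ρ R : ℝ}
  {x p : E} {B : E →L[ℝ] E}

lemma HasSecondOrderExpansion.bound (h : HasSecondOrderExpansion g x p B) {η : ℝ} (hη : 0 < η) :
    ∃ r > 0, ∀ v, ‖v‖ < r → |g (x + v) - g x - inner ℝ p v - inner ℝ (B v) v / 2| ≤ η * ‖v‖ ^ 2 := by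
  obtain ⟨r, hr, h1⟩ := Metric.eventually_nhds_iff.1 (h.2.def hη)
  refine ⟨r, hr, fun v hv => ?_⟩
  have := h1 (show dist v 0 < r by simpa using hv)
  rwa [Real.norm_eq_abs, Real.norm_of_nonneg (by positivity)] at this

set_option maxHeartbeats 400000 in
/-- The second order expansion in parabolic coordinates, uniformly on bounded sets. -/
lemma HasSecondOrderExpansion.parabolic (h : HasSecondOrderExpansion g x p B) (w : E) {C ε : ℝ}
    (hC : 0 < C) (hε : 0 < ε) : ∃ h₀ > 0, ∀ h, 0 < h → h < h₀ → ∀ (y : E) (σ : ℝ),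
      inner ℝ p y = 0 → ‖y‖ ≤ C → |σ| ≤ C →
      |g (x + √h • y + (h * σ) • w) - g x - h * (σ * inner ℝ p w + inner ℝ (B y) y / 2)| ≤ ε * h := by
  set C₁ := C * (1 + ‖w‖) with hC₁
  have hC₁0 : 0 < C₁ := by positivity
  obtain ⟨r, hr, hb⟩ := h.bound (η := ε / (2 * C₁ ^ 2)) (by positivity)
  set M := C * (‖B‖ * C * ‖w‖) + C ^ 2 * (‖B‖ * ‖w‖ * ‖w‖) with hM
  have hM0 : 0 ≤ M := by positivity
  refine ⟨min 1 (min ((r / C₁) ^ 2) ((ε / (2 * (M + 1))) ^ 2)), by positivity, ?_⟩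
  intro s hs hs0 y σ hpy hy hσ
  have hs1 : s < 1 := hs0.trans_le (min_le_left _ _)
  have hs2 : s < (r / C₁) ^ 2 := hs0.trans_le ((min_le_right _ _).trans (min_le_left _ _))
  have hs3 : s < (ε / (2 * (M + 1))) ^ 2 :=
    hs0.trans_le ((min_le_right _ _).trans (min_le_right _ _))
  set z := √s with hz
  have hz0 : 0 < z := Real.sqrt_pos.2 hs
  have hzs : s = z ^ 2 := (Real.sq_sqrt hs.le).symm
  have hz1 : z < 1 := by rw [hz, Real.sqrt_lt' one_pos]; linarith
  have hz2 : z < r / C₁ := by rw [hz, Real.sqrt_lt' (by positivity)]; exact hs2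
  have hz3 : z < ε / (2 * (M + 1)) := by rw [hz, Real.sqrt_lt' (by positivity)]; exact hs3
  set v := z • y + (s * σ) • w with hv
  have hvn : ‖v‖ ≤ z * C₁ := by
    calc ‖v‖ ≤ ‖z • y‖ + ‖(s * σ) • w‖ := norm_add_le _ _
      _ = z * ‖y‖ + z * (z * |σ| * ‖w‖) := by
          rw [norm_smul, norm_smul, Real.norm_of_nonneg hz0.le, norm_mul, Real.norm_of_nonneg hs.le,
            Real.norm_eq_abs, hzs]; ring
      _ ≤ z * C + z * (1 * C * ‖w‖) := by gcongr
      _ = z * C₁ := by rw [hC₁]; ring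
  have hvr : ‖v‖ < r := by
    refine hvn.trans_lt ?_
    rwa [lt_div_iff₀ hC₁0] at hz2
  have h1 := hb v hvr
  have h2 : ε / (2 * C₁ ^ 2) * ‖v‖ ^ 2 ≤ ε / 2 * s := by
    calc ε / (2 * C₁ ^ 2) * ‖v‖ ^ 2 ≤ ε / (2 * C₁ ^ 2) * (z * C₁) ^ 2 := by gcongr
      _ = ε / 2 * s := by rw [hzs]; field_simp
  have hpv : inner ℝ p v = s * (σ * inner ℝ p w) := by
    rw [hv, inner_add_right, inner_smul_right, inner_smul_right, hpy]; ring
  have hsym : inner ℝ (B w) y = inner ℝ (B y) w := by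
    have := h.1 w y
    rw [ContinuousLinearMap.coe_coe] at this
    rw [this, real_inner_comm]
  have hBv : inner ℝ (B v) v = s * inner ℝ (B y) y + 2 * (s * z * σ) * inner ℝ (B y) w
      + (s * σ) ^ 2 * inner ℝ (B w) w := by
    rw [hv, map_add, map_smul, map_smul]
    simp only [inner_add_left, inner_add_right, real_inner_smul_left, real_inner_smul_right, hsym]
    rw [hzs]; ring
  have hb1 : |inner ℝ (B y) w| ≤ ‖B‖ * C * ‖w‖ := by
    refine (abs_real_inner_le_norm _ _).trans ?_
    have := (B.le_opNorm y).trans (mul_le_mul_of_nonneg_left hy (norm_nonneg B))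
    gcongr
  have hb2 : |inner ℝ (B w) w| ≤ ‖B‖ * ‖w‖ * ‖w‖ := by
    refine (abs_real_inner_le_norm _ _).trans ?_
    have := B.le_opNorm w
    gcongr
  -- The terms of `⟨B v, v⟩` that involve `w` carry at least `s √s`, so on bounded sets only `⟨B y,
  -- y⟩` survives at order `s`.
  have hrem : |(s * z * σ) * inner ℝ (B y) w + (s * σ) ^ 2 * inner ℝ (B w) w / 2| ≤ s * z * M := by
    refine (abs_add_le _ _).trans ?_
    rw [abs_mul, abs_mul, abs_mul, abs_of_pos hs, abs_of_pos hz0, abs_div, abs_mul, abs_pow,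
      abs_mul, abs_of_pos hs, abs_two]
    have t1 : s * z * |σ| * |inner ℝ (B y) w| ≤ s * z * (C * (‖B‖ * C * ‖w‖)) := by
      rw [mul_assoc (s * z)]; gcongr
    have t2 : (s * |σ|) ^ 2 * |inner ℝ (B w) w| / 2 ≤ s * z * (C ^ 2 * (‖B‖ * ‖w‖ * ‖w‖)) := by
      have t3 : (s * |σ|) ^ 2 * |inner ℝ (B w) w| ≤ (s * C) ^ 2 * (‖B‖ * ‖w‖ * ‖w‖) := by gcongr
      have t4 : (s * C) ^ 2 * (‖B‖ * ‖w‖ * ‖w‖) ≤ s * z * (C ^ 2 * (‖B‖ * ‖w‖ * ‖w‖)) := by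
        have : s ≤ z := by rw [hzs]; nlinarith
        calc (s * C) ^ 2 * (‖B‖ * ‖w‖ * ‖w‖) = s * s * (C ^ 2 * (‖B‖ * ‖w‖ * ‖w‖)) := by ring
          _ ≤ _ := by gcongr
      have : 0 ≤ (s * |σ|) ^ 2 * |inner ℝ (B w) w| := by positivity
      linarith
    rw [hM, mul_add]
    exact add_le_add t1 t2
  have h3 : s * z * M ≤ ε / 2 * s := by
    rw [lt_div_iff₀ (by positivity)] at hz3
    have h4 : z * M ≤ ε / 2 := by linarith [show z * (2 * (M + 1)) = 2 * (z * M) + 2 * z by ring]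
    calc s * z * M = s * (z * M) := by ring
      _ ≤ s * (ε / 2) := mul_le_mul_of_nonneg_left h4 hs.le
      _ = ε / 2 * s := by ring
  have e : g (x + z • y + (s * σ) • w) - g x - s * (σ * inner ℝ p w + inner ℝ (B y) y / 2)
      = (g (x + v) - g x - inner ℝ p v - inner ℝ (B v) v / 2) +
        ((s * z * σ) * inner ℝ (B y) w + (s * σ) ^ 2 * inner ℝ (B w) w / 2) := by
    rw [hpv, hBv, hv, add_assoc]; ring
  rw [e]
  refine (abs_add_le _ _).trans ?_
  linarith

lemma HasSecondOrderExpansion.hasFDerivAt (h : HasSecondOrderExpansion g x p B) :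
    HasFDerivAt g (innerSL ℝ p) x := by
  rw [hasFDerivAt_iff_isLittleO_nhds_zero]
  have h1 : (fun v : E => ‖v‖ ^ 2) =o[𝓝 0] fun v => v := by
    have : (fun v : E => ‖v‖ ^ 2) =o[𝓝 0] fun v => ‖v‖ := by
      have h2 : (fun t : ℝ => t ^ 2) =o[𝓝 0] fun t => t := by
        simpa using isLittleO_pow_pow (𝕜 := ℝ) (show 1 < 2 by norm_num)
      exact h2.comp_tendsto (by simpa using (continuous_norm.tendsto (0 : E)))
    exact this.of_norm_right
  have h2 : (fun v : E => inner ℝ (B v) v / 2) =o[𝓝 0] fun v => v := by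
    refine IsBigO.trans_isLittleO ?_ h1
    refine IsBigO.of_bound ‖B‖ (Eventually.of_forall fun v => ?_)
    rw [Real.norm_eq_abs, abs_div, abs_two, Real.norm_of_nonneg (by positivity)]
    have h3 := abs_real_inner_le_norm (B v) v
    have h4 := mul_le_mul_of_nonneg_right (B.le_opNorm v) (norm_nonneg v)
    have h5 : 0 ≤ ‖B‖ * ‖v‖ * ‖v‖ := by positivity
    nlinarith
  have h3 := (h.2.trans h1).add h2
  refine h3.congr_left fun v => ?_
  simp

variable [FiniteDimensional ℝ E]

/-- Subtracting a support functional at `x` from `g` leaves a function with a minimum at `x`. Its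
derivative vanishes there, so `p` is that functional. -/
lemma BodyGauge.expansion_support (hg : BodyGauge g ρ R) (h : HasSecondOrderExpansion g x p B) :
    inner ℝ p x = g x ∧ ∀ y, inner ℝ p y ≤ g y := by
  obtain ⟨p', hp'x, hp'⟩ := hg.exists_support x
  have hd := h.hasFDerivAt
  have hmin : IsLocalMin (fun z => g z - inner ℝ p' z) x := by
    refine Eventually.of_forall fun z => ?_
    simp only [hp'x, sub_self]
    linarith [hp' z]
  have hd2 : HasFDerivAt (fun z => g z - inner ℝ p' z) (innerSL ℝ p - innerSL ℝ p') x := by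
    have h1 := hd.sub (innerSL ℝ p').hasFDerivAt
    exact h1
  have h0 := hmin.hasFDerivAt_eq_zero hd2
  have hpp : p = p' := by
    have h1 := DFunLike.congr_fun h0 (p - p')
    simp only [sub_apply, innerSL_apply_apply, zero_apply, ← inner_sub_left] at h1
    exact sub_eq_zero.1 (inner_self_eq_zero.1 h1)
  rw [hpp]
  exact ⟨hp'x, hp'⟩

lemma BodyGauge.expansion_nonneg (hg : BodyGauge g ρ R) (h : HasSecondOrderExpansion g x p B)
    (v : E) : 0 ≤ inner ℝ (B v) v := by
  obtain ⟨hpx, hp⟩ := hg.expansion_support h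
  by_contra! hneg
  have hv0 : v ≠ 0 := by rintro rfl; simp at hneg
  have hvn : 0 < ‖v‖ := norm_pos_iff.2 hv0
  obtain ⟨r, hr, hb⟩ := h.bound (η := -inner ℝ (B v) v / (4 * ‖v‖ ^ 2)) (by
    have : 0 < -inner ℝ (B v) v := by linarith
    positivity)
  set s := r / (2 * ‖v‖) with hs
  have hs0 : 0 < s := by positivity
  have h1 := hb (s • v) (by
    rw [norm_smul, Real.norm_of_nonneg hs0.le, hs]
    field_simp
    linarith)
  have h2 := hp (x + s • v)
  rw [inner_add_right, hpx] at h2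
  rw [map_smul, real_inner_smul_left, inner_smul_right (B v), norm_smul,
    Real.norm_of_nonneg hs0.le, mul_pow] at h1
  have e : -inner ℝ (B v) v / (4 * ‖v‖ ^ 2) * (s ^ 2 * ‖v‖ ^ 2) = -inner ℝ (B v) v / 4 * s ^ 2 := by
    field_simp
  rw [e] at h1
  have h3 := (abs_le.1 h1).2
  nlinarith [pow_pos hs0 2]

/-- The compression of `B` to the hyperplane `N^⊥`. -/
def tangentOp (B : E →L[ℝ] E) (N : E) : (Submodule.span ℝ {N})ᗮ →ₗ[ℝ] (Submodule.span ℝ {N})ᗮ :=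
  ((Submodule.span ℝ {N})ᗮ.orthogonalProjectionOnto : E →ₗ[ℝ] (Submodule.span ℝ {N})ᗮ) ∘ₗ
    (B : E →ₗ[ℝ] E) ∘ₗ (Submodule.span ℝ {N})ᗮ.subtype

omit [FiniteDimensional ℝ E] in
lemma inner_tangentOp (B : E →L[ℝ] E) (N : E) (y z : (Submodule.span ℝ {N})ᗮ) :
    inner ℝ (tangentOp B N y) z = inner ℝ (B y) (z : E) := by
  simp [tangentOp]

omit [FiniteDimensional ℝ E] in
lemma isSymmetric_tangentOp (hB : (B : E →ₗ[ℝ] E).IsSymmetric) (N : E) :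
    (tangentOp B N).IsSymmetric := by
  intro y z
  rw [inner_tangentOp, real_inner_comm (tangentOp B N z) y, inner_tangentOp,
    real_inner_comm (y : E) (B z)]
  exact hB y z

end Expansion

section Bridge

variable {n : ℕ} {g : EuclideanSpace ℝ (Fin n) → ℝ} {ρ R : ℝ} {x p : EuclideanSpace ℝ (Fin n)}
  {B : EuclideanSpace ℝ (Fin n) →L[ℝ] EuclideanSpace ℝ (Fin n)}
  {K : Set (EuclideanSpace ℝ (Fin n))}

lemma expansion_ne_zero (hg : BodyGauge g ρ R) (hx : g x = 1)
    (h : HasSecondOrderExpansion g x p B) : 0 < ‖p‖ := by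
  have h1 := (hg.expansion_support h).1
  rw [norm_pos_iff]
  rintro rfl
  rw [inner_zero_left, hx] at h1
  exact zero_ne_one h1

lemma isOuterUnitNormal_of_expansion (hg : BodyGauge g ρ R) (hK : K = {z | g z ≤ 1})
    (hx : g x = 1) (h : HasSecondOrderExpansion g x p B) : IsOuterUnitNormal K x (‖p‖⁻¹ • p) := by
  have hp0 := expansion_ne_zero hg hx h
  obtain ⟨hpx, hp⟩ := hg.expansion_support h
  refine ⟨by rw [norm_smul, norm_inv, norm_norm, inv_mul_cancel₀ hp0.ne'], fun y hy => ?_⟩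
  rw [hK] at hy
  have hy : g y ≤ 1 := hy
  rw [real_inner_smul_left, inner_sub_right, hpx, hx]
  refine mul_nonpos_of_nonneg_of_nonpos (by positivity) ?_
  linarith [hp y]

/-- If `⟨p, v⟩ < 0` then `x + s v` lies in `K` for some small `s > 0`, so `⟨N', v⟩ ≤ 0`. A vector
nonpositive on this open half space is a nonnegative multiple of `p`. -/
lemma outerUnitNormal_unique (hg : BodyGauge g ρ R) (hK : K = {z | g z ≤ 1})
    (hx : g x = 1) (h : HasSecondOrderExpansion g x p B) {N' : EuclideanSpace ℝ (Fin n)}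
    (hN' : IsOuterUnitNormal K x N') : N' = ‖p‖⁻¹ • p := by
  have hp0 := expansion_ne_zero hg hx h
  have key : ∀ v, inner ℝ p v < 0 → inner ℝ N' v ≤ 0 := by
    intro v hv
    have hl := h.hasFDerivAt.hasLineDerivAt v
    have hl2 := hl.tendsto_slope_zero.mono_left
      (nhdsWithin_mono (0 : ℝ) fun s (hs : s ∈ Ioi (0 : ℝ)) => (ne_of_gt hs : s ≠ 0))
    rw [innerSL_apply_apply] at hl2
    obtain ⟨s, hs, hs0⟩ := ((hl2.eventually (gt_mem_nhds hv)).and self_mem_nhdsWithin).exists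
    have hs0 : 0 < s := hs0
    have h1 : g (x + s • v) ≤ 1 := by
      rw [hx, smul_eq_mul] at hs
      by_contra! hgt
      have : 0 < s⁻¹ * (g (x + s • v) - 1) := mul_pos (inv_pos.2 hs0) (by linarith)
      linarith
    have h2 := hN'.2 (x + s • v) (by rw [hK]; exact h1)
    rw [add_sub_cancel_left, inner_smul_right] at h2
    by_contra! hgt
    nlinarith
  have key2 : ∀ v, inner ℝ p v = 0 → inner ℝ N' v = 0 := by
    have hle : ∀ v, inner ℝ p v = 0 → inner ℝ N' v ≤ 0 := by
      intro v hv
      have h1 : ∀ s : ℝ, 0 < s → inner ℝ N' (v - s • p) ≤ 0 := by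
        intro s hs
        refine key _ ?_
        rw [inner_sub_right, hv, inner_smul_right, real_inner_self_eq_norm_sq]
        have : 0 < s * ‖p‖ ^ 2 := by positivity
        linarith
      have hl : Tendsto (fun s : ℝ => inner ℝ N' (v - s • p)) (𝓝[>] 0)
          (𝓝 (inner ℝ N' (v - (0 : ℝ) • p))) :=
        (Continuous.tendsto (by fun_prop) (0 : ℝ)).mono_left nhdsWithin_le_nhds
      rw [zero_smul, sub_zero] at hl
      exact le_of_tendsto hl (eventually_mem_nhdsWithin.mono h1)
    intro v hv
    refine le_antisymm (hle v hv) ?_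
    have := hle (-v) (by rw [inner_neg_right, hv, neg_zero])
    rw [inner_neg_right] at this
    linarith
  set c := inner ℝ N' p / ‖p‖ ^ 2 with hc
  have hcN : N' = c • p := by
    have h1 : inner ℝ p (N' - c • p) = 0 := by
      rw [inner_sub_right, inner_smul_right, real_inner_self_eq_norm_sq, hc, real_inner_comm]
      field_simp
      ring
    have h2 := key2 _ h1
    have h3 : inner ℝ (N' - c • p) (N' - c • p) = 0 := by
      rw [inner_sub_left, h2, real_inner_smul_left, h1]; ring
    exact sub_eq_zero.1 (inner_self_eq_zero.1 h3)
  have hc0 : 0 ≤ c := by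
    have := key (-p) (by
      rw [inner_neg_right, real_inner_self_eq_norm_sq]
      have : 0 < ‖p‖ ^ 2 := by positivity
      linarith)
    rw [inner_neg_right] at this
    rw [hc]
    exact div_nonneg (by linarith) (by positivity)
  have h4 := hN'.1
  rw [hcN, norm_smul, Real.norm_of_nonneg hc0] at h4
  rw [hcN, eq_inv_of_mul_eq_one_left h4]

/-- Put `s = ‖y‖²` and `y = √s u`. Then `g (x + y - s σ N) - 1 = s (q - σ ‖p‖) + o(s)` with `q = ⟨B
u, u⟩ / 2`, so the boundary is crossed at `σ = q / ‖p‖ + o(1)`. This division by `‖p‖` is the source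
of the factor `‖p‖⁻¹` in front of `tangentOp`. -/
lemma boundaryGraph_isLittleO (hg : BodyGauge g ρ R) (hK : K = {z | g z ≤ 1})
    (hx : g x = 1) (h : HasSecondOrderExpansion g x p B) :
    (fun y : (Submodule.span ℝ {‖p‖⁻¹ • p})ᗮ => boundaryGraph K x (‖p‖⁻¹ • p) y -
      inner ℝ ((‖p‖⁻¹ • tangentOp B (‖p‖⁻¹ • p)) y) y / 2)
        =o[𝓝 0] (fun y : (Submodule.span ℝ {‖p‖⁻¹ • p})ᗮ => ‖y‖ ^ 2) := by
  have hp0 := expansion_ne_zero hg hx h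
  obtain ⟨hpx, hp⟩ := hg.expansion_support h
  set N := ‖p‖⁻¹ • p with hN
  have hpN : inner ℝ p N = ‖p‖ := by
    rw [hN, inner_smul_right, real_inner_self_eq_norm_sq]; field_simp
  have hpy : ∀ y : (Submodule.span ℝ {N})ᗮ, inner ℝ p (y : EuclideanSpace ℝ (Fin n)) = 0 := by
    intro y
    have : inner ℝ (‖p‖⁻¹ • p) (y : EuclideanSpace ℝ (Fin n)) = 0 := inner_coe_orthogonal N y
    rw [real_inner_smul_left] at this
    exact (mul_eq_zero.1 this).resolve_left (inv_ne_zero hp0.ne')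
  set a := ‖p‖ with ha
  have hset : ∀ y : (Submodule.span ℝ {N})ᗮ, ∀ t : ℝ, x + (y : EuclideanSpace ℝ (Fin n)) - t • N ∈ K →
      0 ≤ t := by
    intro y t ht
    rw [hK] at ht
    have h1 := (hp _).trans ht
    rw [inner_sub_right, inner_add_right, hpx, hx, hpy, inner_smul_right, hpN] at h1
    by_contra! hneg
    nlinarith
  rw [isLittleO_iff]
  intro ε hε
  set C := ‖B‖ / (2 * a) + ε + 1 with hC
  have hC1 : 1 ≤ C := by
    have : 0 ≤ ‖B‖ / (2 * a) := by positivity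
    linarith
  obtain ⟨h₀, hh₀, hpar⟩ := h.parabolic N (C := C) (ε := ε * a / 2) (by linarith) (by positivity)
  filter_upwards [Metric.ball_mem_nhds 0 (Real.sqrt_pos.2 hh₀)] with y hy
  rw [mem_ball_zero_iff] at hy
  rcases eq_or_ne y 0 with rfl | hy0
  · have h1 : boundaryGraph K x N 0 = 0 := by
      rw [boundaryGraph]
      refine IsLeast.csInf_eq ⟨?_, fun t ht => hset 0 t ht⟩
      rw [mem_ofPred_eq, hK]
      simp [hx]
    simp [h1]
  · have hyn : 0 < ‖y‖ := norm_pos_iff.2 hy0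
    set s := ‖y‖ ^ 2 with hs
    have hs0 : 0 < s := by positivity
    have hsh : s < h₀ := by
      have := pow_lt_pow_left₀ hy (norm_nonneg y) two_ne_zero
      rwa [Real.sq_sqrt hh₀.le] at this
    have hsq : √s = ‖y‖ := Real.sqrt_sq (norm_nonneg y)
    set u : EuclideanSpace ℝ (Fin n) := ‖y‖⁻¹ • (y : EuclideanSpace ℝ (Fin n)) with hu
    have hun : ‖u‖ = 1 := by
      rw [hu, norm_smul, norm_inv, norm_norm, Submodule.coe_norm, inv_mul_cancel₀]
      simpa using hy0
    have hyu : √s • u = (y : EuclideanSpace ℝ (Fin n)) := by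
      rw [hsq, hu, smul_smul, mul_inv_cancel₀ hyn.ne', one_smul]
    set q := inner ℝ (B u) u / 2 with hq
    have hq0 : 0 ≤ q := div_nonneg (hg.expansion_nonneg h u) zero_le_two
    have hqB : q ≤ ‖B‖ / 2 := by
      have h1 := real_inner_le_norm (B u) u
      have h2 := B.le_opNorm u
      rw [hun, mul_one] at h1 h2
      rw [hq]; linarith
    have hqa : q / a ≤ ‖B‖ / (2 * a) := by
      rw [← div_div]; gcongr
    have hqy : inner ℝ ((a⁻¹ • tangentOp B N) y) y / 2 = s * (q / a) := by
      rw [LinearMap.smul_apply, real_inner_smul_left, inner_tangentOp, ← hyu, map_smul,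
        real_inner_smul_left, inner_smul_right, hq, hsq, hs]
      field_simp
    have hest : ∀ σ, |σ| ≤ C →
        |g (x + y - (s * σ) • N) - 1 - s * (-σ * a + q)| ≤ ε * a / 2 * s := by
      intro σ hσ
      have h1 := hpar s hs0 hsh u (-σ) (by rw [hu, inner_smul_right, hpy, mul_zero])
        (by rw [hun]; exact hC1) (by rwa [abs_neg])
      rw [hyu, hx, hpN, mul_neg, neg_smul, ← sub_eq_add_neg] at h1
      exact h1
    have hqa0 : 0 ≤ q / a := by positivity
    have hplus := hest (q / a + ε) (by rw [abs_of_nonneg (by linarith)]; linarith)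
    have hminus := hest (q / a - ε) (by rw [abs_le]; constructor <;> linarith)
    have e1 : -(q / a + ε) * a + q = -(ε * a) := by field_simp; ring
    have e2 : -(q / a - ε) * a + q = ε * a := by field_simp; ring
    rw [e1] at hplus
    rw [e2] at hminus
    have hεa : 0 < s * (ε * a) := by positivity
    have hin : g (x + y - (s * (q / a + ε)) • N) ≤ 1 := by
      have := (abs_le.1 hplus).2
      linarith
    have hout : 1 < g (x + y - (s * (q / a - ε)) • N) := by
      have := (abs_le.1 hminus).1
      linarith
    -- The expansion covers bounded `σ` only. Lower `t` are excluded by convexity on the line: a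
    -- point outside `K` does not lie between two points of `K`.
    have hlow : ∀ t : ℝ, g (x + y - t • N) ≤ 1 → s * (q / a - ε) ≤ t := by
      intro t ht
      by_contra! hlt
      have hlt2 : s * (q / a - ε) < s * (q / a + ε) := by gcongr; linarith
      set t₁ := s * (q / a - ε)
      set t₂ := s * (q / a + ε)
      have hd : 0 < t₂ - t := by linarith
      have hn1 : 0 ≤ (t₂ - t₁) / (t₂ - t) := div_nonneg (by linarith) hd.le
      have hn2 : 0 ≤ (t₁ - t) / (t₂ - t) := div_nonneg (by linarith) hd.le
      have hn3 : (t₂ - t₁) / (t₂ - t) + (t₁ - t) / (t₂ - t) = 1 := by field_simp; ring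
      have hcx := hg.convexOn.2 (mem_univ (x + y - t • N)) (mem_univ (x + y - t₂ • N)) hn1 hn2 hn3
      have e3 : ((t₂ - t₁) / (t₂ - t)) • (x + y - t • N) + ((t₁ - t) / (t₂ - t)) • (x + y - t₂ • N)
          = x + y - t₁ • N := by
        match_scalars <;> field_simp <;> ring
      rw [e3, smul_eq_mul, smul_eq_mul] at hcx
      have h5 : (t₂ - t₁) / (t₂ - t) * g (x + y - t • N) + (t₁ - t) / (t₂ - t) * g (x + y - t₂ • N)
          ≤ (t₂ - t₁) / (t₂ - t) * 1 + (t₁ - t) / (t₂ - t) * 1 := by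
        gcongr
      linarith
    have hbg1 : boundaryGraph K x N y ≤ s * (q / a + ε) := by
      refine csInf_le ⟨0, fun t ht => hset y t ht⟩ ?_
      rw [mem_ofPred_eq, hK]
      exact hin
    have hbg2 : s * (q / a - ε) ≤ boundaryGraph K x N y := by
      refine le_csInf ⟨_, by rw [mem_ofPred_eq, hK]; exact hin⟩ fun t ht => hlow t ?_
      rw [mem_ofPred_eq, hK] at ht
      exact ht
    rw [hqy, Real.norm_eq_abs, Real.norm_of_nonneg hs0.le, abs_le]
    constructor <;> linarith

/-- `gaussKronecker` chooses a value, so uniqueness is needed: testing on the rays `t y` identifies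
the quadratic forms, and these determine symmetric operators. -/
lemma eq_of_quadratic_isLittleO {V : Type*} [NormedAddCommGroup V] [InnerProductSpace ℝ V]
    {A A' : V →ₗ[ℝ] V} (hA : A.IsSymmetric) (hA' : A'.IsSymmetric) {f : V → ℝ}
    (h : (fun y => f y - inner ℝ (A y) y / 2) =o[𝓝 0] fun y => ‖y‖ ^ 2)
    (h' : (fun y => f y - inner ℝ (A' y) y / 2) =o[𝓝 0] fun y => ‖y‖ ^ 2) : A = A' := by
  have hsub : (fun y => inner ℝ ((A - A') y) y / 2) =o[𝓝 0] fun y => ‖y‖ ^ 2 := by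
    refine (h'.sub h).congr_left fun y => ?_
    rw [LinearMap.sub_apply, inner_sub_left]; ring
  have hz : ∀ y, inner ℝ ((A - A') y) y = 0 := by
    intro y
    have hl : Tendsto (fun t : ℝ => t • y) (𝓝[≠] 0) (𝓝 0) := by
      have : Tendsto (fun t : ℝ => t • y) (𝓝 0) (𝓝 ((0 : ℝ) • y)) :=
        Continuous.tendsto (by fun_prop) _
      rw [zero_smul] at this
      exact this.mono_left nhdsWithin_le_nhds
    have h1 := hsub.comp_tendsto hl
    have h2 : (fun _ : ℝ => inner ℝ ((A - A') y) y / 2) =o[𝓝[≠] (0 : ℝ)] fun _ => ‖y‖ ^ 2 := by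
      rw [isLittleO_iff] at h1 ⊢
      intro c hc
      filter_upwards [h1 hc, self_mem_nhdsWithin] with t ht ht0
      have ht0 : t ≠ 0 := ht0
      simp only [Function.comp_apply, map_smul, real_inner_smul_left, inner_smul_right, norm_smul,
        norm_div, norm_mul, norm_pow, mul_pow, norm_norm] at ht ⊢
      have : 0 < ‖t‖ ^ 2 := by positivity
      refine le_of_mul_le_mul_left ?_ this
      calc _ = ‖t‖ * (‖t‖ * ‖inner ℝ ((A - A') y) y‖) / ‖(2 : ℝ)‖ := by ring
        _ ≤ _ := ht
        _ = _ := by ring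
    have h3 := (isLittleO_const_const_iff).1 h2
    linarith
  have := (LinearMap.IsSymmetric.inner_map_self_eq_zero (hA.sub hA')).1 hz
  exact sub_eq_zero.1 this

/-- The Gauss–Kronecker curvature in terms of the second order expansion of the gauge. -/
theorem gaussKronecker_eq_det (hg : BodyGauge g ρ R) (hK : K = {z | g z ≤ 1})
    (hx : g x = 1) (h : HasSecondOrderExpansion g x p B) :
    gaussKronecker K x = LinearMap.det (‖p‖⁻¹ • tangentOp B (‖p‖⁻¹ • p)) := by
  have hsym : (‖p‖⁻¹ • tangentOp B (‖p‖⁻¹ • p)).IsSymmetric := by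
    intro y z
    have := isSymmetric_tangentOp h.1 (‖p‖⁻¹ • p) y z
    rw [LinearMap.smul_apply, LinearMap.smul_apply, real_inner_smul_left, inner_smul_right, this]
  have hex : ∃ κ, HasGaussKroneckerCurvature K x κ :=
    ⟨_, ‖p‖⁻¹ • p, isOuterUnitNormal_of_expansion hg hK hx h,
      fun N' hN' => outerUnitNormal_unique hg hK hx h hN', _, hsym,
      boundaryGraph_isLittleO hg hK hx h, rfl⟩
  rw [gaussKronecker, dif_pos hex]
  obtain ⟨N', hN', -, A', hA', hlo, hκ⟩ := hex.choose_spec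
  have hNN := outerUnitNormal_unique hg hK hx h hN'
  subst hNN
  rw [hκ, eq_of_quadratic_isLittleO hA' hsym hlo (boundaryGraph_isLittleO hg hK hx h)]

end Bridge

end Illumination
end

/-! ### Caps in parabolic coordinates -/

noncomputable section

namespace Illumination

open scoped ENNReal NNReal

section Cap

variable {E : Type*} [NormedAddCommGroup E] [InnerProductSpace ℝ E] {g : E → ℝ} {ρ R : ℝ}
  {x p z w : E} {B : E →L[ℝ] E}

/-- The part of the convex hull of `z` and `{g ≤ 1}` outside `{g ≤ 1}`, without the apex `z`. -/
def cap (g : E → ℝ) (z : E) : Set E := {w | 1 < g w ∧ ∃ l : ℝ, 1 ≤ l ∧ g (z + l • (w - z)) ≤ 1}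

lemma BodyGauge.convexOn_line (hg : BodyGauge g ρ R) (z v : E) :
    ConvexOn ℝ univ fun t : ℝ => g (z + t • v) := by
  refine ⟨convex_univ, fun s _ t _ a b ha hb hab => ?_⟩
  have h := hg.convexOn.2 (mem_univ (z + s • v)) (mem_univ (z + t • v)) ha hb hab
  convert h using 2
  simp only [smul_eq_mul]
  rw [smul_add, smul_add, smul_smul, smul_smul, add_add_add_comm, ← add_smul, ← add_smul, hab,
    one_smul]

/-- On the line from `z` through `w` the convex function `g` exceeds `1` at parameter `1` and is at
most `1` at a later parameter `l`. It is therefore nonincreasing up to `1`. -/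
lemma cap_antitone (hg : BodyGauge g ρ R) (hw : w ∈ cap g z) {s t : ℝ} (hst : s ≤ t) (ht : t ≤ 1) :
    g (z + t • (w - z)) ≤ g (z + s • (w - z)) := by
  obtain ⟨h1, l, hl1, hl⟩ := hw
  have hG := hg.convexOn_line z (w - z)
  have hG1 : g (z + (1 : ℝ) • (w - z)) = g w := by rw [one_smul, add_sub_cancel]
  have hl' : 1 < l := by
    refine lt_of_le_of_ne hl1 ?_
    rintro rfl
    linarith
  have key : g w ≤ g (z + t • (w - z)) := by
    rcases ht.eq_or_lt with rfl | ht
    · rw [hG1]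
    · have := hG.lt_left_of_right_lt (mem_univ t) (mem_univ l) (z := 1)
        (by rw [openSegment_eq_Ioo (ht.trans hl')]; exact ⟨ht, hl'⟩) (by rw [hG1]; linarith)
      rw [hG1] at this
      exact this.le
  rcases hst.eq_or_lt with rfl | hst
  · rfl
  · exact (hG.lt_left_of_right_lt (mem_univ s) (mem_univ l) (z := t)
      (by rw [openSegment_eq_Ioo (hst.trans (ht.trans_lt hl'))]; exact ⟨hst, ht.trans_lt hl'⟩)
      (by linarith)).le

lemma mem_cap_iff : w ∈ cap g z ↔ 1 < g w ∧ w ≠ z ∧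
    ∃ k, g k ≤ 1 ∧ ∃ μ ∈ Icc (0 : ℝ) 1, w = (1 - μ) • z + μ • k := by
  constructor
  · rintro ⟨h1, l, hl1, hl⟩
    have hl0 : 0 < l := by linarith
    refine ⟨h1, ?_, z + l • (w - z), hl, l⁻¹, ⟨by positivity, inv_le_one_of_one_le₀ hl1⟩, ?_⟩
    · rintro rfl
      rw [sub_self, smul_zero, add_zero] at hl
      linarith
    · match_scalars <;> field_simp
      ring
  · rintro ⟨h1, hz, k, hk, μ, ⟨hμ0, hμ1⟩, rfl⟩
    have hμ : 0 < μ := by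
      refine lt_of_le_of_ne hμ0 ?_
      rintro rfl
      simp at hz
    refine ⟨h1, μ⁻¹, (one_le_inv₀ hμ).2 hμ1, ?_⟩
    have : z + μ⁻¹ • ((1 - μ) • z + μ • k - z) = k := by
      match_scalars <;> field_simp
      ring
    rw [this]
    exact hk

lemma BodyGauge.isCompact_le [FiniteDimensional ℝ E] (hg : BodyGauge g ρ R) (a : ℝ) :
    IsCompact {w | g w ≤ a} := by
  refine Metric.isCompact_of_isClosed_isBounded (isClosed_le hg.continuous continuous_const) ?_
  refine (Metric.isBounded_closedBall (x := (0 : E)) (r := a * R)).subset fun w hw => ?_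
  rw [mem_closedBall_zero_iff]
  exact hg.norm_le_of_gauge_le hw

/-- Apart from the conditions `1 < g w` and `w ≠ z`, the cap is cut out by the projection of a
closed set along the compact factor `K × [0, 1]`, which is closed. -/
lemma measurableSet_cap_graph [FiniteDimensional ℝ E] [MeasurableSpace E] [BorelSpace E]
    (hg : BodyGauge g ρ R) : MeasurableSet {q : E × E | q.2 ∈ cap g q.1} := by
  have : CompactSpace {w | g w ≤ 1} := isCompact_iff_compactSpace.1 (hg.isCompact_le 1)
  have hcl : IsClosed (Prod.snd '' {r : ({w | g w ≤ 1} × Icc (0 : ℝ) 1) × (E × E) |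
      r.2.2 = (1 - (r.1.2 : ℝ)) • r.2.1 + (r.1.2 : ℝ) • (r.1.1 : E)}) :=
    isClosedMap_snd_of_compactSpace _ (isClosed_eq (by fun_prop) (by fun_prop))
  have e : {q : E × E | q.2 ∈ cap g q.1} = {q | 1 < g q.2} ∩ {q | q.2 = q.1}ᶜ ∩
      (Prod.snd '' {r : ({w | g w ≤ 1} × Icc (0 : ℝ) 1) × (E × E) |
        r.2.2 = (1 - (r.1.2 : ℝ)) • r.2.1 + (r.1.2 : ℝ) • (r.1.1 : E)}) := by
    ext q
    rw [mem_ofPred_eq, mem_cap_iff]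
    constructor
    · rintro ⟨h1, h2, k, hk, μ, hμ, h⟩
      exact ⟨⟨h1, h2⟩, ((⟨k, hk⟩, ⟨μ, hμ⟩), q), h, rfl⟩
    · rintro ⟨⟨h1, h2⟩, ⟨⟨⟨k, hk⟩, ⟨μ, hμ⟩⟩, q'⟩, h, rfl⟩
      exact ⟨h1, h2, k, hk, μ, hμ, h⟩
  rw [e]
  exact ((measurableSet_lt measurable_const (hg.continuous.measurable.comp measurable_snd)).inter
    (isClosed_eq continuous_snd continuous_fst).measurableSet.compl).inter hcl.measurableSet

lemma measurableSet_cap [FiniteDimensional ℝ E] [MeasurableSpace E] [BorelSpace E]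
    (hg : BodyGauge g ρ R) (z : E) : MeasurableSet (cap g z) :=
  measurable_prodMk_left (x := z) (measurableSet_cap_graph hg)

/-- Parabolic coordinates at `x`. -/
def parab (x : E) (h : ℝ) (y : E) (σ : ℝ) : E := x + √h • y + (h * σ) • x

/-- The apex `(1 + h) x` has parabolic coordinates `(0, 1)`. Along the line from it through `(y, σ)`
the limit model of `(g - 1) / h` is therefore `1 + l (σ - 1) + l² q` with `q = ⟨B y, y⟩ / 2`, and
the position of caps is read off from this polynomial on `l ≥ 1`. -/
lemma parab_line (x y : E) (h σ l : ℝ) :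
    (1 + h) • x + l • (parab x h y σ - (1 + h) • x) = parab x h (l • y) (1 + l * (σ - 1)) := by
  rw [parab, parab]
  match_scalars <;> ring

variable [FiniteDimensional ℝ E]

lemma gauge_parab_bound (hg : BodyGauge g ρ R) (hx : g x = 1) (h : HasSecondOrderExpansion g x p B)
    {C ε : ℝ} (hC : 0 < C) (hε : 0 < ε) : ∀ᶠ t in 𝓝[>] (0 : ℝ), ∀ (y : E) (σ : ℝ),
      inner ℝ p y = 0 → ‖y‖ ≤ C → |σ| ≤ C →
      |g (parab x t y σ) - 1 - t * (σ + inner ℝ (B y) y / 2)| ≤ ε * t := by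
  obtain ⟨h₀, hh₀, hpar⟩ := h.parabolic x hC hε
  filter_upwards [Ioo_mem_nhdsGT hh₀] with t ht y σ hy hyC hσC
  have := hpar t ht.1 ht.2 y σ hy hyC hσC
  rwa [(hg.expansion_support h).1, hx, mul_one] at this

lemma eventually_one_lt_gauge_parab (hg : BodyGauge g ρ R) (hx : g x = 1)
    (h : HasSecondOrderExpansion g x p B) {y : E} {σ : ℝ} (hy : inner ℝ p y = 0)
    (hs : 0 < σ + inner ℝ (B y) y / 2) : ∀ᶠ t in 𝓝[>] (0 : ℝ), 1 < g (parab x t y σ) := by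
  filter_upwards [gauge_parab_bound hg hx h (C := ‖y‖ + |σ| + 1)
    (ε := (σ + inner ℝ (B y) y / 2) / 2) (by positivity) (by linarith), self_mem_nhdsWithin]
    with t ht ht0
  have h1 := (abs_le.1 (ht y σ hy (by linarith [abs_nonneg σ]) (by linarith [norm_nonneg y]))).1
  have := mul_pos ht0 hs
  linarith

lemma eventually_gauge_parab_lt_one (hg : BodyGauge g ρ R) (hx : g x = 1)
    (h : HasSecondOrderExpansion g x p B) {y : E} {σ : ℝ} (hy : inner ℝ p y = 0)
    (hs : σ + inner ℝ (B y) y / 2 < 0) : ∀ᶠ t in 𝓝[>] (0 : ℝ), g (parab x t y σ) < 1 := by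
  filter_upwards [gauge_parab_bound hg hx h (C := ‖y‖ + |σ| + 1)
    (ε := -(σ + inner ℝ (B y) y / 2) / 2) (by positivity) (by linarith), self_mem_nhdsWithin]
    with t ht ht0
  have h1 := (abs_le.1 (ht y σ hy (by linarith [abs_nonneg σ]) (by linarith [norm_nonneg y]))).2
  have := mul_neg_of_pos_of_neg ht0 hs
  linarith

lemma eventually_mem_cap (hg : BodyGauge g ρ R) (hx : g x = 1)
    (h : HasSecondOrderExpansion g x p B) {y : E} {σ : ℝ} (hy : inner ℝ p y = 0)
    (hσ : -(inner ℝ (B y) y / 2) < σ) (hq1 : inner ℝ (B y) y / 2 < 1)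
    (hσ' : σ < 1 - 2 * √(inner ℝ (B y) y / 2)) :
    ∀ᶠ t in 𝓝[>] (0 : ℝ), parab x t y σ ∈ cap g ((1 + t) • x) := by
  set q := inner ℝ (B y) y / 2 with hq
  have hq0 : 0 ≤ q := div_nonneg (hg.expansion_nonneg h y) zero_le_two
  obtain ⟨l, hl, hl2⟩ : ∃ l : ℝ, 1 ≤ l ∧ 1 + l * (σ - 1) + l ^ 2 * q < 0 := by
    rcases hq0.eq_or_lt with h0 | h0
    · rw [← h0, Real.sqrt_zero] at hσ'
      rw [← h0] at hσ
      have h1 : 0 < 1 - σ := by linarith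
      refine ⟨2 / (1 - σ), ?_, ?_⟩
      · rw [le_div_iff₀ h1]; linarith
      · rw [← h0]
        have : 2 / (1 - σ) * (σ - 1) = -2 := by field_simp; ring
        rw [this]; norm_num
    · have hs := Real.sqrt_pos.2 h0
      have hs1 : √q ≤ 1 := Real.sqrt_le_one.2 hq1.le
      -- Here `l² q = 1` and the model equals `2 + (σ - 1) / √q`, negative exactly when `σ < 1 -
      -- 2√q`. The condition `l ≥ 1` is where `q < 1` enters.
      refine ⟨(√q)⁻¹, (one_le_inv₀ hs).2 hs1, ?_⟩
      have e : (√q)⁻¹ ^ 2 * q = 1 := by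
        nth_rw 2 [← Real.sq_sqrt hq0]
        field_simp
      rw [e]
      have : (√q)⁻¹ * (σ - 1) < -2 := by
        rw [inv_mul_lt_iff₀ hs]; linarith
      linarith
  filter_upwards [eventually_one_lt_gauge_parab hg hx h hy (σ := σ) (by linarith),
    eventually_gauge_parab_lt_one hg hx h (y := l • y) (σ := 1 + l * (σ - 1))
      (by rw [inner_smul_right, hy, mul_zero]) (by
        rw [map_smul, real_inner_smul_left, inner_smul_right]
        convert hl2 using 1
        rw [hq]; ring)] with t h1 h2
  exact ⟨h1, l, hl, by rw [parab_line]; exact h2.le⟩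

lemma eventually_notMem_cap (hg : BodyGauge g ρ R) (hx : g x = 1)
    (h : HasSecondOrderExpansion g x p B) {y : E} {σ ε : ℝ} (hy : inner ℝ p y = 0)
    (hε : 0 < ε) (hq0 : 0 < inner ℝ (B y) y / 2)
    (hσ : ∀ l : ℝ, 1 ≤ l → ε ≤ 1 + l * (σ - 1) + l ^ 2 * (inner ℝ (B y) y / 2)) :
    ∀ᶠ t in 𝓝[>] (0 : ℝ), parab x t y σ ∉ cap g ((1 + t) • x) := by
  set q := inner ℝ (B y) y / 2 with hq
  -- The model is uniform only for bounded `l`. At this `L` it exceeds its value at `l = 1` by at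
  -- least one, so `g` is larger there than at the point itself; by convexity the line cannot enter
  -- the body beyond `L`.
  obtain ⟨L, hL1, hL⟩ : ∃ L : ℝ, 1 < L ∧ σ + q + 1 ≤ 1 + L * (σ - 1) + L ^ 2 * q := by
    have h1 : Tendsto (fun L : ℝ => L * (L * q + (σ - 1))) atTop atTop :=
      tendsto_id.atTop_mul_atTop₀
        (tendsto_atTop_add_const_right _ _ (tendsto_id.atTop_mul_const hq0))
    obtain ⟨L, hL, hL1⟩ := ((h1.eventually_ge_atTop (σ + q)).and (eventually_gt_atTop 1)).exists
    exact ⟨L, hL1, by nlinarith⟩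
  set ε' := min (ε / 2) (1 / 4) with hε'
  have hε'0 : 0 < ε' := by positivity
  filter_upwards [gauge_parab_bound hg hx h (C := L * ‖y‖ + 1 + L * |σ - 1|) (ε := ε')
    (by positivity) hε'0, self_mem_nhdsWithin] with t ht ht0 hmem
  have ht0 : 0 < t := ht0
  have hmodel : ∀ l : ℝ, 1 ≤ l → l ≤ L →
      |g ((1 + t) • x + l • (parab x t y σ - (1 + t) • x)) - 1 -
        t * (1 + l * (σ - 1) + l ^ 2 * q)| ≤ ε' * t := by
    intro l hl1 hlL
    have hl0 : 0 ≤ l := by linarith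
    rw [parab_line]
    have hLy : l * ‖y‖ ≤ L * ‖y‖ := by gcongr
    have hLs : l * |σ - 1| ≤ L * |σ - 1| := by gcongr
    have h1 := ht (l • y) (1 + l * (σ - 1)) (by rw [inner_smul_right, hy, mul_zero])
      (by
        rw [norm_smul, Real.norm_of_nonneg hl0]
        have : 0 ≤ L * |σ - 1| := by positivity
        linarith)
      (by
        refine (abs_add_le _ _).trans ?_
        rw [abs_one, abs_mul, abs_of_nonneg hl0]
        have : 0 ≤ L * ‖y‖ := by positivity
        linarith)
    convert h1 using 4
    rw [map_smul, real_inner_smul_left, inner_smul_right, hq]; ring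
  have hε1 : ε' * t ≤ ε / 2 * t := by gcongr; exact min_le_left _ _
  have hε2 : ε' * t ≤ 1 / 4 * t := by gcongr; exact min_le_right _ _
  obtain ⟨h1, l, hl1, hl⟩ := hmem
  rcases le_or_gt l L with hlL | hlL
  · have h2 := (abs_le.1 (hmodel l hl1 hlL)).1
    have h3 : t * ε ≤ t * (1 + l * (σ - 1) + l ^ 2 * q) := by gcongr; exact hσ l hl1
    have h4 := mul_pos ht0 hε
    linarith
  · have hG := hg.convexOn_line ((1 + t) • x) (parab x t y σ - (1 + t) • x)
    have h2 := hG.le_max_of_mem_Icc (mem_univ 1) (mem_univ l) (z := L) ⟨hL1.le, hlL.le⟩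
    have hG1 : g ((1 + t) • x + (1 : ℝ) • (parab x t y σ - (1 + t) • x)) = g (parab x t y σ) := by
      rw [one_smul, add_sub_cancel]
    simp only [hG1] at h2
    rw [max_eq_left (by linarith)] at h2
    have h3 := (abs_le.1 (hmodel L hL1.le le_rfl)).1
    have h4 := (abs_le.1 (hmodel 1 le_rfl hL1.le)).2
    rw [hG1] at h4
    have h5 : t * (σ + q + 1) ≤ t * (1 + L * (σ - 1) + L ^ 2 * q) := by gcongr
    have e : t * (1 + 1 * (σ - 1) + 1 ^ 2 * q) = t * (σ + q + 1) - t := by ring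
    rw [e] at h4
    linarith

/-- In parabolic coordinates the caps stay bounded if the second order part is definite. -/
lemma cap_parab_bounded (hg : BodyGauge g ρ R) (hx : g x = 1)
    (h : HasSecondOrderExpansion g x p B) {m : ℝ} (hm : 0 < m)
    (hB : ∀ y, inner ℝ p y = 0 → m * ‖y‖ ^ 2 ≤ inner ℝ (B y) y / 2) :
    ∃ C > 0, ∀ᶠ t in 𝓝[>] (0 : ℝ), ∀ y σ, inner ℝ p y = 0 → parab x t y σ ∈ cap g ((1 + t) • x) →
      ‖y‖ ≤ C ∧ |σ| ≤ C := by
  -- For a cap point contracted to size `C` the estimates below give `q ≤ 12` and `|τ - 1| ≤ 14`, so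
  -- its size is at most `√(12 / m) + 14`, a contradiction.
  set C := √(12 / m) + 15 with hC
  have hC15 : 15 ≤ C := by
    have := Real.sqrt_nonneg (12 / m)
    linarith
  refine ⟨C + 1, by linarith, ?_⟩
  filter_upwards [gauge_parab_bound hg hx h (C := C + 1) (ε := 1) (by linarith) one_pos,
    self_mem_nhdsWithin] with t ht ht0 y σ hy hmem
  have ht0 : 0 < t := ht0
  by_contra hcon
  have hS : C < ‖y‖ + |σ - 1| := by
    by_contra! hle
    refine hcon ⟨by linarith [abs_nonneg (σ - 1)], ?_⟩
    have : |σ| ≤ |σ - 1| + 1 := by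
      calc |σ| = |(σ - 1) + 1| := by rw [sub_add_cancel]
        _ ≤ |σ - 1| + |1| := abs_add_le _ _
        _ = _ := by rw [abs_one]
    linarith [norm_nonneg y]
  set S := ‖y‖ + |σ - 1| with hSdef
  -- A cap point that is too far away is moved towards the apex until its size is exactly `C`,
  -- inside the range of the expansion. By `cap_antitone`, `g` stays in `[1, 1 + t]` there and is no
  -- smaller halfway to the apex; these inequalities bound the quadratic model.
  set l := C / S with hl
  have hS0 : 0 < S := by linarith
  have hl0 : 0 < l := by positivity
  have hl1 : l ≤ 1 := (div_le_one hS0).2 hS.le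
  have hlS : l * ‖y‖ + l * |σ - 1| = C := by
    rw [← mul_add, ← hSdef, hl, div_mul_cancel₀ _ hS0.ne']
  have hly : l * ‖y‖ ≤ C := by have : 0 ≤ l * |σ - 1| := by positivity
                               linarith
  have hls : l * |σ - 1| ≤ C := by have : 0 ≤ l * ‖y‖ := by positivity
                                   linarith
  set q := l ^ 2 * (inner ℝ (B y) y / 2) with hq
  set τ := 1 + l * (σ - 1) with hτ
  have hmodel : ∀ r : ℝ, 0 ≤ r → r ≤ 1 →
      |g ((1 + t) • x + (r * l) • (parab x t y σ - (1 + t) • x)) - 1 -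
        t * (1 + r * (τ - 1) + r ^ 2 * q)| ≤ 1 * t := by
    intro r hr0 hr1
    rw [parab_line]
    have h1 := ht ((r * l) • y) (1 + r * l * (σ - 1)) (by rw [inner_smul_right, hy, mul_zero])
      (by
        rw [norm_smul, Real.norm_of_nonneg (by positivity), mul_assoc]
        have := mul_le_mul_of_nonneg_right hr1 (show 0 ≤ l * ‖y‖ by positivity)
        linarith)
      (by
        refine (abs_add_le _ _).trans ?_
        rw [abs_one, abs_mul, abs_of_nonneg (by positivity), mul_assoc]
        have := mul_le_mul_of_nonneg_right hr1 (show 0 ≤ l * |σ - 1| by positivity)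
        linarith)
    convert h1 using 4
    rw [map_smul, real_inner_smul_left, inner_smul_right, hq, hτ]; ring
  have hfull := hmodel 1 zero_le_one le_rfl
  have hhalf := hmodel (1 / 2) (by norm_num) (by norm_num)
  have hmono1 := cap_antitone hg hmem (show 1 / 2 * l ≤ 1 * l by linarith) (by linarith)
  have hmono2 := cap_antitone hg hmem (show (1 : ℝ) * l ≤ 1 by linarith) le_rfl
  have hmono3 := cap_antitone hg hmem (show (0 : ℝ) ≤ 1 * l by linarith) (by linarith)
  have h1 := hmem.1
  rw [one_smul, add_sub_cancel] at hmono2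
  rw [zero_smul, add_zero, hg.smul (by linarith), hx] at hmono3
  set G := g ((1 + t) • x + (1 * l) • (parab x t y σ - (1 + t) • x))
  set G' := g ((1 + t) • x + (1 / 2 * l) • (parab x t y σ - (1 + t) • x))
  have hf := abs_le.1 hfull
  have hh := abs_le.1 hhalf
  have a1 : -1 ≤ τ + q := by
    have : t * (-1) ≤ t * (τ + q) := by linarith [hf.2]
    exact le_of_mul_le_mul_left this ht0
  have a2 : τ + q ≤ 2 := by
    have : t * (τ + q) ≤ t * 2 := by linarith [hf.1]
    exact le_of_mul_le_mul_left this ht0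
  have a3 : τ / 2 + 3 / 4 * q ≤ 5 / 2 := by
    have : t * (τ / 2 + 3 / 4 * q) ≤ t * (5 / 2) := by linarith [hf.1, hh.2]
    exact le_of_mul_le_mul_left this ht0
  have hq12 : q ≤ 12 := by linarith
  have hqm : m * (l * ‖y‖) ^ 2 ≤ q := by
    rw [hq]
    have := mul_le_mul_of_nonneg_left (hB y hy) (show 0 ≤ l ^ 2 by positivity)
    linarith
  have hq0 : 0 ≤ q := le_trans (by positivity) hqm
  have hy12 : l * ‖y‖ ≤ √(12 / m) := by
    refine Real.le_sqrt_of_sq_le ?_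
    rw [le_div_iff₀ hm]
    linarith
  have hτ14 : l * |σ - 1| ≤ 14 := by
    have : l * |σ - 1| = |τ - 1| := by
      rw [hτ, add_sub_cancel_left, abs_mul, abs_of_pos hl0]
    rw [this, abs_le]
    constructor <;> linarith
  linarith

end Cap

end Illumination
end

/-! ### Limit of the rescaled cap volume -/

noncomputable section

namespace Illumination

open scoped ENNReal NNReal

section CapVolume

variable {E : Type*} [NormedAddCommGroup E] [InnerProductSpace ℝ E] [FiniteDimensional ℝ E]
  [MeasurableSpace E] [BorelSpace E] {g : E → ℝ} {ρ R : ℝ} {x p : E} {B : E →L[ℝ] E}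
  {f : E → ℝ≥0∞}

omit [FiniteDimensional ℝ E] [MeasurableSpace E] [BorelSpace E] in
lemma inner_eq_zero_of_unit_orthogonal (hp : 0 < ‖p‖) (y : (Submodule.span ℝ {‖p‖⁻¹ • p})ᗮ) :
    inner ℝ p (y : E) = 0 := by
  have := inner_coe_orthogonal (‖p‖⁻¹ • p) y
  rw [real_inner_smul_left] at this
  exact (mul_eq_zero.1 this).resolve_left (inv_ne_zero hp.ne')

/-- The obliqueness of the direction `x` contributes `⟨N, x⟩ = ‖p‖⁻¹`, the tangential scaling
`√t^(n-1)` and the radial scaling `t`. -/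
lemma lintegral_eq_parab (hp : 0 < ‖p‖) (hpx : inner ℝ p x = 1) (hf : Measurable f) {t : ℝ}
    (ht : 0 < t) :
    ∫⁻ w, f w = ENNReal.ofReal (‖p‖⁻¹ * √t ^ (Module.finrank ℝ E + 1)) *
      ∫⁻ q : (Submodule.span ℝ {‖p‖⁻¹ • p})ᗮ × ℝ, f (parab x t q.1 q.2) := by
  set N := ‖p‖⁻¹ • p with hN
  have hN1 : ‖N‖ = 1 := by rw [hN, norm_smul, norm_inv, norm_norm, inv_mul_cancel₀ hp.ne']
  have hNx : inner ℝ N x = ‖p‖⁻¹ := by rw [hN, real_inner_smul_left, hpx, mul_one]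
  have hs : 0 < √t := Real.sqrt_pos.2 ht
  have hm : Measurable fun q : (Submodule.span ℝ {N})ᗮ × ℝ => f ((q.1 : E) + q.2 • x) :=
    hf.comp (by fun_prop)
  have hm1 : Measurable fun y : (Submodule.span ℝ {N})ᗮ => ∫⁻ s : ℝ, f ((y : E) + s • x) :=
    hm.lintegral_prod_right'
  have hm2 : Measurable fun q : (Submodule.span ℝ {N})ᗮ × ℝ => f (parab x t q.1 q.2) := by
    refine hf.comp ?_
    unfold parab
    fun_prop
  have hinner : ∀ y : E, ∫⁻ s : ℝ, f (√t • y + s • x) =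
      ENNReal.ofReal t * ∫⁻ σ : ℝ, f (parab x t y σ) := by
    intro y
    rw [← lintegral_add_left_eq_self (fun s : ℝ => f (√t • y + s • x)) 1,
      lintegral_comp_smul (F := fun s : ℝ => f (√t • y + (1 + s) • x)) (hf.comp (by fun_prop)) ht,
      Module.finrank_self, pow_one]
    congr 1
    refine lintegral_congr fun σ => ?_
    congr 1
    rw [parab, smul_eq_mul, add_smul, one_smul]
    abel
  have hfr : Module.finrank ℝ (Submodule.span ℝ {N})ᗮ + 1 = Module.finrank ℝ E :=
    finrank_orthogonal_add_one (by rintro h; rw [h, norm_zero] at hN1; exact zero_ne_one hN1)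
  rw [lintegral_eq_oblique N hN1 (x := x) (by rw [hNx]; positivity) hf,
    lintegral_comp_smul hm1 hs, hNx]
  simp only [Submodule.coe_smul, hinner]
  rw [lintegral_const_mul _ hm2.lintegral_prod_right', Measure.volume_eq_prod,
    lintegral_prod _ hm2.aemeasurable, ← mul_assoc, ← mul_assoc,
    ← ENNReal.ofReal_mul (by positivity), ← ENNReal.ofReal_mul (by positivity)]
  congr 2
  rw [← hfr]
  nth_rw 2 [← Real.sq_sqrt ht.le]
  ring

/-- The limit of the rescaled caps. -/
def capRegion (B : E →L[ℝ] E) (N : E) : Set ((Submodule.span ℝ {N})ᗮ × ℝ) :=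
  {q | inner ℝ (B q.1) (q.1 : E) / 2 < 1 ∧ -(inner ℝ (B q.1) (q.1 : E) / 2) < q.2 ∧
    q.2 < 1 - 2 * √(inner ℝ (B q.1) (q.1 : E) / 2)}

/-- The volume of the limit of the rescaled caps. -/
def capIntegral (B : E →L[ℝ] E) (N : E) : ℝ≥0∞ :=
  ∫⁻ y : (Submodule.span ℝ {N})ᗮ,
    ENNReal.ofReal (max 0 (1 - √(inner ℝ (B y) (y : E) / 2)) ^ 2)

omit [FiniteDimensional ℝ E] in
lemma measurableSet_capRegion (B : E →L[ℝ] E) (N : E) : MeasurableSet (capRegion B N) := by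
  have h : Continuous fun q : (Submodule.span ℝ {N})ᗮ × ℝ => inner ℝ (B q.1) (q.1 : E) / 2 := by
    fun_prop
  exact ((isOpen_lt h continuous_const).inter ((isOpen_lt h.neg continuous_snd).inter
    (isOpen_lt continuous_snd
      (continuous_const.sub (continuous_const.mul h.sqrt))))).measurableSet

/-- The slice over `y` is an interval of length `1 - 2√q + q = (1 - √q)²` if `q < 1`, and empty
otherwise. -/
lemma volume_capRegion (hB : ∀ y : E, 0 ≤ inner ℝ (B y) y) (N : E) :
    volume (capRegion B N) = capIntegral B N := by
  rw [Measure.volume_eq_prod, Measure.prod_apply (measurableSet_capRegion B N), capIntegral]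
  refine lintegral_congr fun y => ?_
  set q := inner ℝ (B y) (y : E) / 2 with hq
  have hq0 : 0 ≤ q := div_nonneg (hB y) zero_le_two
  rcases lt_or_ge q 1 with h1 | h1
  · have : Prod.mk y ⁻¹' capRegion B N = Ioo (-q) (1 - 2 * √q) := by
      ext σ
      simp only [capRegion, mem_preimage, mem_ofPred_eq, mem_Ioo]
      exact ⟨fun h => h.2, fun h => ⟨h1, h⟩⟩
    rw [this, Real.volume_Ioo, max_eq_right (by linarith [Real.sqrt_le_one.2 h1.le])]
    congr 1
    nth_rw 2 [← Real.sq_sqrt hq0]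
    ring
  · have : Prod.mk y ⁻¹' capRegion B N = ∅ := by
      ext σ
      simp only [capRegion, mem_preimage, mem_ofPred_eq, mem_empty_iff_false, iff_false]
      exact fun h => absurd h.1 (not_lt.2 h1)
    rw [this, measure_empty, max_eq_left (by linarith [Real.one_le_sqrt.2 h1])]
    simp

omit [FiniteDimensional ℝ E] [MeasurableSpace E] [BorelSpace E] in
lemma tendsto_parab (x y : E) (σ : ℝ) : Tendsto (fun t => parab x t y σ) (𝓝[>] 0) (𝓝 x) := by
  have : Tendsto (fun t => parab x t y σ) (𝓝 0) (𝓝 (parab x 0 y σ)) := by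
    refine Continuous.tendsto ?_ 0
    unfold parab
    fun_prop
  have e : parab x 0 y σ = x := by simp [parab]
  rw [e] at this
  exact this.mono_left nhdsWithin_le_nhds

lemma measurable_cap_indicator_parab (hg : BodyGauge g ρ R) (hf : Measurable f) (N : E) (t : ℝ) :
    Measurable fun q : (Submodule.span ℝ {N})ᗮ × ℝ =>
      (cap g ((1 + t) • x)).indicator f (parab x t q.1 q.2) := by
  refine (hf.indicator (measurableSet_cap hg _)).comp ?_
  unfold parab
  fun_prop

lemma lintegral_cap_div (hg : BodyGauge g ρ R) (hx : g x = 1) (h : HasSecondOrderExpansion g x p B)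
    (hp : 0 < ‖p‖) (hf : Measurable f) {t : ℝ} (ht : 0 < t) :
    (∫⁻ w in cap g ((1 + t) • x), f w) / ENNReal.ofReal (√t ^ (Module.finrank ℝ E + 1)) =
      ENNReal.ofReal ‖p‖⁻¹ * ∫⁻ q : (Submodule.span ℝ {‖p‖⁻¹ • p})ᗮ × ℝ,
        (cap g ((1 + t) • x)).indicator f (parab x t q.1 q.2) := by
  have hpx : inner ℝ p x = 1 := by rw [(hg.expansion_support h).1, hx]
  have hs : 0 < √t := Real.sqrt_pos.2 ht
  have hs' : 0 < √t ^ (Module.finrank ℝ E + 1) := by positivity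
  rw [← lintegral_indicator (measurableSet_cap hg _),
    lintegral_eq_parab hp hpx (hf.indicator (measurableSet_cap hg _)) ht,
    ENNReal.ofReal_mul (by positivity), ENNReal.div_eq_inv_mul, mul_comm (ENNReal.ofReal ‖p‖⁻¹),
    mul_assoc, ← mul_assoc, ENNReal.inv_mul_cancel (ENNReal.ofReal_pos.2 hs').ne'
    ENNReal.ofReal_ne_top, one_mul]

/-- Lower bound for the volume of small caps. -/
theorem le_liminf_lintegral_cap (hg : BodyGauge g ρ R) (hx : g x = 1)
    (h : HasSecondOrderExpansion g x p B) (hp : 0 < ‖p‖) (hf : Measurable f)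
    (hfx : ContinuousAt f x) :
    ENNReal.ofReal ‖p‖⁻¹ * (f x * capIntegral B (‖p‖⁻¹ • p)) ≤
      liminf (fun t => (∫⁻ w in cap g ((1 + t) • x), f w) /
        ENNReal.ofReal (√t ^ (Module.finrank ℝ E + 1))) (𝓝[>] 0) := by
  have hB := hg.expansion_nonneg h
  set N := ‖p‖⁻¹ • p with hN
  have h1 : f x * capIntegral B N ≤ liminf (fun t => ∫⁻ q : (Submodule.span ℝ {N})ᗮ × ℝ,
      (cap g ((1 + t) • x)).indicator f (parab x t q.1 q.2)) (𝓝[>] 0) := by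
    rw [← volume_capRegion hB, ← setLIntegral_const, ← lintegral_indicator
      (measurableSet_capRegion B N)]
    refine le_trans (lintegral_mono fun q => ?_) (lintegral_liminf_le
      fun t => measurable_cap_indicator_parab hg hf N t)
    by_cases hq : q ∈ capRegion B N
    · rw [indicator_of_mem hq]
      have h2 := eventually_mem_cap hg hx h (inner_eq_zero_of_unit_orthogonal hp q.1)
        hq.2.1 hq.1 hq.2.2
      have h3 : Tendsto (fun t => (cap g ((1 + t) • x)).indicator f (parab x t q.1 q.2)) (𝓝[>] 0)
          (𝓝 (f x)) := by
        refine (hfx.tendsto.comp (tendsto_parab x q.1 q.2)).congr' ?_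
        filter_upwards [h2] with t ht
        rw [indicator_of_mem ht]; rfl
      exact h3.liminf_eq.ge
    · rw [indicator_of_notMem hq]
      exact zero_le
  calc _ ≤ ENNReal.ofReal ‖p‖⁻¹ * liminf (fun t => ∫⁻ q : (Submodule.span ℝ {N})ᗮ × ℝ,
      (cap g ((1 + t) • x)).indicator f (parab x t q.1 q.2)) (𝓝[>] 0) := by gcongr
    _ = liminf (fun t => ENNReal.ofReal ‖p‖⁻¹ * ∫⁻ q : (Submodule.span ℝ {N})ᗮ × ℝ,
      (cap g ((1 + t) • x)).indicator f (parab x t q.1 q.2)) (𝓝[>] 0) :=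
        (ENNReal.liminf_const_mul_of_ne_top ENNReal.ofReal_ne_top).symm
    _ = _ := by
        refine liminf_congr ?_
        filter_upwards [self_mem_nhdsWithin] with t ht
        rw [lintegral_cap_div hg hx h hp hf ht]

/-- The exceptional set consists of the two graphs bounding the region and of `y = 0`, which is null
because the hyperplane has positive dimension. For `y ≠ 0` definiteness gives `q > 0`. If `q < 1`,
completing the square shows that lines above the tangent one miss the paraboloid; if `q ≥ 1`, the
model polynomial is at least `σ + q` for all `l ≥ 1`. -/
lemma ae_parab_mem_cap_iff (hg : BodyGauge g ρ R) (hx : g x = 1)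
    (h : HasSecondOrderExpansion g x p B) (hp : 0 < ‖p‖)
    (hE : 2 ≤ Module.finrank ℝ E) {m : ℝ} (hm : 0 < m)
    (hBm : ∀ y, inner ℝ p y = 0 → m * ‖y‖ ^ 2 ≤ inner ℝ (B y) y / 2) :
    ∀ᵐ q : (Submodule.span ℝ {‖p‖⁻¹ • p})ᗮ × ℝ, ∀ᶠ t in 𝓝[>] (0 : ℝ),
      (parab x t q.1 q.2 ∈ cap g ((1 + t) • x) ↔ q ∈ capRegion B (‖p‖⁻¹ • p)) := by
  set N := ‖p‖⁻¹ • p with hN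
  have hfr : Module.finrank ℝ (Submodule.span ℝ {N})ᗮ + 1 = Module.finrank ℝ E :=
    finrank_orthogonal_add_one (by
      rw [hN]
      exact smul_ne_zero (inv_ne_zero hp.ne') (norm_pos_iff.1 hp))
  have : Nontrivial (Submodule.span ℝ {N})ᗮ :=
    Module.nontrivial_of_finrank_pos (R := ℝ) (by omega)
  have hfst : ∀ᵐ q : (Submodule.span ℝ {N})ᗮ × ℝ, q.1 ≠ 0 :=
    Measure.quasiMeasurePreserving_fst.ae (compl_mem_ae_iff.2 (measure_singleton _))
  have hgraph : ∀ F : (Submodule.span ℝ {N})ᗮ → ℝ, Continuous F →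
      ∀ᵐ q : (Submodule.span ℝ {N})ᗮ × ℝ, q.2 ≠ F q.1 := by
    intro F hF
    have hcl : MeasurableSet {q : (Submodule.span ℝ {N})ᗮ × ℝ | q.2 = F q.1} :=
      (isClosed_eq continuous_snd (hF.comp continuous_fst)).measurableSet
    have : volume {q : (Submodule.span ℝ {N})ᗮ × ℝ | q.2 = F q.1} = 0 := by
      rw [Measure.volume_eq_prod, Measure.measure_prod_null hcl]
      refine Eventually.of_forall fun y => ?_
      have : Prod.mk y ⁻¹' {q : (Submodule.span ℝ {N})ᗮ × ℝ | q.2 = F q.1} = {F y} := by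
        ext σ; simp
      simp only [this, measure_singleton]
      rfl
    filter_upwards [compl_mem_ae_iff.2 this] with q hq using hq
  filter_upwards [hfst, hgraph (fun y => -(inner ℝ (B y) (y : E) / 2)) (by fun_prop),
    hgraph (fun y => 1 - 2 * √(inner ℝ (B y) (y : E) / 2)) (by fun_prop)] with q h0 h1 h2
  have hy := inner_eq_zero_of_unit_orthogonal hp q.1
  set b := inner ℝ (B q.1) (q.1 : E) / 2 with hb
  have hb0 : 0 < b := by
    refine lt_of_lt_of_le ?_ (hBm q.1 hy)
    have : 0 < ‖(q.1 : E)‖ := norm_pos_iff.2 (by simpa using h0)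
    positivity
  have hsb : √b ^ 2 = b := Real.sq_sqrt hb0.le
  have hsb0 : 0 < √b := Real.sqrt_pos.2 hb0
  by_cases hq : q ∈ capRegion B N
  · filter_upwards [eventually_mem_cap hg hx h hy hq.2.1 hq.1 hq.2.2] with t ht
    exact ⟨fun _ => hq, fun _ => ht⟩
  · suffices hs : ∀ᶠ t in 𝓝[>] (0 : ℝ), parab x t q.1 q.2 ∉ cap g ((1 + t) • x) by
      filter_upwards [hs] with t ht
      exact ⟨fun h => absurd h ht, fun h => absurd h hq⟩
    rcases lt_or_gt_of_ne h1 with h1 | h1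
    · filter_upwards [eventually_gauge_parab_lt_one hg hx h hy (σ := q.2) (by linarith)] with t ht
      exact fun hc => absurd hc.1 (not_lt.2 ht.le)
    rcases lt_or_ge b 1 with hb1 | hb1
    · have h3 : 1 - 2 * √b < q.2 := by
        refine lt_of_le_of_ne (not_lt.1 fun hlt => hq ⟨hb1, h1, hlt⟩) (Ne.symm h2)
      refine eventually_notMem_cap hg hx h hy (ε := q.2 - 1 + 2 * √b) (by linarith) hb0
        fun l hl => ?_
      rw [← hb]
      have h4 : 2 * l * √b ≤ 1 + l ^ 2 * b := by nlinarith [sq_nonneg (1 - l * √b)]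
      nlinarith
    · refine eventually_notMem_cap hg hx h hy (ε := q.2 + b) (by linarith) hb0 fun l hl => ?_
      rw [← hb]
      nlinarith [mul_nonneg (sub_nonneg.2 hl) (sub_nonneg.2 hl)]

/-- The volume of small caps at a point with definite second order part. -/
theorem tendsto_lintegral_cap (hg : BodyGauge g ρ R) (hx : g x = 1)
    (h : HasSecondOrderExpansion g x p B) (hp : 0 < ‖p‖) (hE : 2 ≤ Module.finrank ℝ E)
    {m : ℝ} (hm : 0 < m)
    (hBm : ∀ y, inner ℝ p y = 0 → m * ‖y‖ ^ 2 ≤ inner ℝ (B y) y / 2) (hf : Measurable f)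
    (hfx : ContinuousAt f x) (hftop : f x ≠ ⊤) :
    Tendsto (fun t => (∫⁻ w in cap g ((1 + t) • x), f w) /
        ENNReal.ofReal (√t ^ (Module.finrank ℝ E + 1))) (𝓝[>] 0)
      (𝓝 (ENNReal.ofReal ‖p‖⁻¹ * (f x * capIntegral B (‖p‖⁻¹ • p)))) := by
  have hB := hg.expansion_nonneg h
  set N := ‖p‖⁻¹ • p with hN
  suffices hs : Tendsto (fun t => ∫⁻ q : (Submodule.span ℝ {N})ᗮ × ℝ,
      (cap g ((1 + t) • x)).indicator f (parab x t q.1 q.2)) (𝓝[>] 0)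
      (𝓝 (f x * capIntegral B N)) by
    refine (ENNReal.Tendsto.const_mul hs (Or.inr ENNReal.ofReal_ne_top)).congr' ?_
    filter_upwards [self_mem_nhdsWithin] with t ht
    rw [lintegral_cap_div hg hx h hp hf ht]
  rw [← volume_capRegion hB, ← setLIntegral_const, ← lintegral_indicator
      (measurableSet_capRegion B N)]
  obtain ⟨C, hC0, hC⟩ := cap_parab_bounded hg hx h hm hBm
  have hfb : ∀ᶠ w in 𝓝 x, f w ≤ f x + 1 := by
    have : f x < f x + 1 := ENNReal.lt_add_right hftop one_ne_zero
    filter_upwards [hfx.eventually_lt_const this] with w hw using hw.le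
  obtain ⟨r, hr, hfr⟩ := Metric.eventually_nhds_iff.1 hfb
  have hsmall : ∀ᶠ t in 𝓝[>] (0 : ℝ), √t * C + t * C * ‖x‖ < r := by
    have : Tendsto (fun t : ℝ => √t * C + t * C * ‖x‖) (𝓝 0) (𝓝 (√0 * C + 0 * C * ‖x‖)) :=
      Continuous.tendsto (by fun_prop) 0
    simp only [Real.sqrt_zero, zero_mul, add_zero] at this
    exact (this.mono_left nhdsWithin_le_nhds).eventually_lt_const hr
  refine tendsto_lintegral_filter_of_dominated_convergence
    ((Metric.closedBall (0 : (Submodule.span ℝ {N})ᗮ) C ×ˢ Icc (-C) C).indicator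
      fun _ => f x + 1)
    (Eventually.of_forall fun t => measurable_cap_indicator_parab hg hf N t) ?_ ?_ ?_
  · filter_upwards [hC, hsmall, self_mem_nhdsWithin] with t ht hts ht0
    refine Eventually.of_forall fun q => ?_
    have ht0 : 0 < t := ht0
    by_cases hmem : parab x t q.1 q.2 ∈ cap g ((1 + t) • x)
    · obtain ⟨hy, hσ⟩ := ht q.1 q.2 (inner_eq_zero_of_unit_orthogonal hp q.1) hmem
      rw [indicator_of_mem hmem, indicator_of_mem]
      · refine hfr ?_
        rw [dist_eq_norm, parab, add_assoc, add_sub_cancel_left]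
        refine lt_of_le_of_lt ((norm_add_le _ _).trans ?_) hts
        rw [norm_smul, norm_smul, norm_mul, Real.norm_of_nonneg (Real.sqrt_nonneg t),
          Real.norm_of_nonneg ht0.le, Real.norm_eq_abs]
        gcongr
      · exact ⟨by simpa using hy, abs_le.1 hσ⟩
    · rw [indicator_of_notMem hmem]
      exact zero_le
  · rw [lintegral_indicator (Metric.isClosed_closedBall.measurableSet.prod measurableSet_Icc),
      setLIntegral_const, Measure.volume_eq_prod, Measure.prod_prod]
    exact ENNReal.mul_ne_top (ENNReal.add_ne_top.2 ⟨hftop, ENNReal.one_ne_top⟩)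
      (ENNReal.mul_ne_top measure_closedBall_lt_top.ne (by simp))
  · filter_upwards [ae_parab_mem_cap_iff hg hx h hp hE hm hBm] with q hq
    by_cases hmem : q ∈ capRegion B N
    · rw [indicator_of_mem hmem]
      refine (hfx.tendsto.comp (tendsto_parab x q.1 q.2)).congr' ?_
      filter_upwards [hq] with t ht
      rw [indicator_of_mem (ht.2 hmem)]; rfl
    · rw [indicator_of_notMem hmem]
      refine tendsto_const_nhds.congr' ?_
      filter_upwards [hq] with t ht
      rw [indicator_of_notMem fun hc => hmem (ht.1 hc)]

end CapVolume

end Illumination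
end

/-! ### The integral of the squared cone function and the determinant -/

noncomputable section

namespace Illumination

open scoped ENNReal NNReal

section QuadraticCone

variable {V : Type*} [NormedAddCommGroup V] [InnerProductSpace ℝ V] [FiniteDimensional ℝ V]
  {T : V →ₗ[ℝ] V}

lemma nonneg_eigenvalues_of_inner_nonneg (hT : T.IsSymmetric) (hT0 : ∀ y, 0 ≤ inner ℝ (T y) y)
    (i : Fin (Module.finrank ℝ V)) : 0 ≤ hT.eigenvalues rfl i := by
  have h := hT0 (hT.eigenvectorBasis rfl i)
  rw [hT.apply_eigenvectorBasis, RCLike.ofReal_real_eq_id, id, real_inner_smul_left,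
    real_inner_self_eq_norm_sq, (hT.eigenvectorBasis rfl).norm_eq_one] at h
  simpa using h

/-- A nonnegative quadratic form is the squared norm of a linear map. -/
lemma exists_sqrt_of_inner_nonneg (hT : T.IsSymmetric) (hT0 : ∀ y, 0 ≤ inner ℝ (T y) y) :
    ∃ S : V →ₗ[ℝ] V, (∀ y, inner ℝ (T y) y = ‖S y‖ ^ 2) ∧ LinearMap.det S = √(LinearMap.det T) := by
  set b := hT.eigenvectorBasis rfl with hb
  set μ := hT.eigenvalues rfl with hμ
  have hμ0 : ∀ i, 0 ≤ μ i := nonneg_eigenvalues_of_inner_nonneg hT hT0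
  refine ⟨Matrix.toLin b.toBasis b.toBasis (Matrix.diagonal fun i => √(μ i)), fun y => ?_, ?_⟩
  · have hr : ∀ i, b.repr (Matrix.toLin b.toBasis b.toBasis (Matrix.diagonal fun i => √(μ i)) y) i =
        √(μ i) * b.repr y i := by
      intro i
      have := congrFun (LinearMap.toMatrix_mulVec_repr b.toBasis b.toBasis
        (Matrix.toLin b.toBasis b.toBasis (Matrix.diagonal fun i => √(μ i))) y) i
      rw [LinearMap.toMatrix_toLin, Matrix.mulVec_diagonal] at this
      simpa using this.symm
    rw [← b.repr.norm_map, EuclideanSpace.norm_sq_eq, ← b.repr.inner_map_map, PiLp.inner_apply]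
    refine Finset.sum_congr rfl fun i _ => ?_
    rw [hr, hT.eigenvectorBasis_apply_self_apply, norm_mul, mul_pow, Real.norm_eq_abs, sq_abs,
      Real.sq_sqrt (hμ0 i), Real.norm_eq_abs, sq_abs]
    simp only [RCLike.ofReal_real_eq_id, id, RCLike.inner_apply, conj_trivial]
    ring
  · rw [LinearMap.det_toLin, Matrix.det_diagonal, hT.det_eq_prod_eigenvalues rfl]
    simp only [RCLike.ofReal_real_eq_id, id]
    exact (Real.sqrt_prod _ fun i _ => hμ0 i).symm

lemma det_nonneg_of_inner_nonneg (hT : T.IsSymmetric) (hT0 : ∀ y, 0 ≤ inner ℝ (T y) y) :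
    0 ≤ LinearMap.det T := by
  rw [hT.det_eq_prod_eigenvalues rfl]
  exact Finset.prod_nonneg fun i _ => nonneg_eigenvalues_of_inner_nonneg hT hT0 i

lemma exists_pos_bound_of_det_pos (hT : T.IsSymmetric) (hT0 : ∀ y, 0 ≤ inner ℝ (T y) y)
    (hd : 0 < LinearMap.det T) : ∃ m > 0, ∀ y, m * ‖y‖ ^ 2 ≤ inner ℝ (T y) y / 2 := by
  obtain ⟨S, hS, hSd⟩ := exists_sqrt_of_inner_nonneg hT hT0
  have hinj : Function.Injective S := by
    have hu : IsUnit (LinearMap.det S) := by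
      rw [hSd]; exact (Real.sqrt_pos.2 hd).ne'.isUnit
    exact (Module.End.isUnit_iff _).1 ((LinearMap.isUnit_iff_isUnit_det S).2 hu) |>.1
  obtain ⟨c, hc, hcS⟩ := (LinearMap.injective_iff_antilipschitz S).1 hinj
  have hc0 : (0 : ℝ) < c := hc
  refine ⟨1 / (2 * (c : ℝ) ^ 2), by positivity, fun y => ?_⟩
  have h1 : ‖y‖ ≤ c * ‖S y‖ := by simpa using hcS.le_mul_dist y 0
  have h2 : ‖y‖ ^ 2 ≤ (c * ‖S y‖) ^ 2 := by gcongr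
  rw [hS, div_mul_eq_mul_div, one_mul, div_le_div_iff₀ (by positivity) two_pos]
  nlinarith

lemma det_pos_of_bound (hT : T.IsSymmetric) {m : ℝ} (hm : 0 < m)
    (hTm : ∀ y, m * ‖y‖ ^ 2 ≤ inner ℝ (T y) y) : 0 < LinearMap.det T := by
  have hT0 : ∀ y, 0 ≤ inner ℝ (T y) y := fun y => le_trans (by positivity) (hTm y)
  refine lt_of_le_of_ne (det_nonneg_of_inner_nonneg hT hT0) fun h0 => ?_
  obtain ⟨v, hv, hv0⟩ := (Submodule.ne_bot_iff _).1 (LinearMap.bot_lt_ker_of_det_eq_zero h0.symm).ne'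
  have h1 := hTm v
  rw [LinearMap.mem_ker.1 hv, inner_zero_left] at h1
  have : 0 < ‖v‖ := norm_pos_iff.2 hv0
  have : 0 < m * ‖v‖ ^ 2 := by positivity
  linarith

variable [MeasurableSpace V] [BorelSpace V]

/-- The integral over `V` of the squared cone function of a quadratic form. -/
def coneIntegral (T : V →ₗ[ℝ] V) : ℝ≥0∞ :=
  ∫⁻ y : V, ENNReal.ofReal (max 0 (1 - √(inner ℝ (T y) y / 2)) ^ 2)

variable (V) in
/-- The value of `coneIntegral` at the identity. -/
def coneConst : ℝ := √2 ^ (Module.finrank ℝ V + 2) * volume.real (Metric.ball (0 : V) 1) /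
  ((Module.finrank ℝ V + 1) * (Module.finrank ℝ V + 2))

lemma integral_cone_profile (k : ℕ) :
    ∫ y in Ioi (0 : ℝ), y ^ k • max 0 (1 - y / √2) ^ 2 =
      √2 ^ (k + 3) / ((k + 1) * (k + 2) * (k + 3)) := by
  have h2 : 0 < √(2 : ℝ) := by positivity
  have h22 : √(2 : ℝ) ^ 2 = 2 := Real.sq_sqrt zero_le_two
  have e1 : ∫ y in Ioi (0 : ℝ), y ^ k • max 0 (1 - y / √2) ^ 2 =
      ∫ y in Ioc (0 : ℝ) √2, y ^ k • max 0 (1 - y / √2) ^ 2 := by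
    refine setIntegral_eq_of_subset_of_forall_sdiff_eq_zero measurableSet_Ioi
      Ioc_subset_Ioi_self fun y hy => ?_
    have hy2 : √2 < y := by
      by_contra! hle
      exact hy.2 ⟨hy.1, hle⟩
    rw [max_eq_left (by rw [sub_nonpos, one_le_div h2]; exact hy2.le)]
    simp
  have e2 : ∫ y in Ioc (0 : ℝ) √2, y ^ k • max 0 (1 - y / √2) ^ 2 =
      ∫ y in (0 : ℝ)..√2, (y ^ k - √2 * y ^ (k + 1) + 1 / 2 * y ^ (k + 2)) := by
    rw [intervalIntegral.integral_of_le h2.le]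
    refine setIntegral_congr_fun measurableSet_Ioc fun y hy => ?_
    simp only [smul_eq_mul]
    rw [max_eq_right (by rw [sub_nonneg, div_le_one h2]; exact hy.2)]
    have : y / √2 = y * √2 / 2 := by
      rw [div_eq_div_iff h2.ne' two_ne_zero, mul_assoc, ← sq, h22]
    rw [this]
    have : (1 - y * √2 / 2) ^ 2 = 1 - √2 * y + 1 / 2 * y ^ 2 := by
      linear_combination (y ^ 2 / 4) * h22
    rw [this]; ring
  rw [e1, e2, intervalIntegral.integral_add, intervalIntegral.integral_sub,
    intervalIntegral.integral_const_mul, intervalIntegral.integral_const_mul, integral_pow,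
    integral_pow, integral_pow]
  · simp only [zero_pow (Nat.succ_ne_zero _), sub_zero]
    push_cast
    have a1 : √(2 : ℝ) ^ (k + 2 + 1) = 2 * √2 ^ (k + 1) := by
      linear_combination √2 ^ (k + 1) * h22
    have a2 : √(2 : ℝ) * √2 ^ (k + 1 + 1) = 2 * √2 ^ (k + 1) := by
      linear_combination √2 ^ (k + 1) * h22
    rw [mul_div_assoc', a1, a2]
    field_simp
    ring
  all_goals exact Continuous.intervalIntegrable (by fun_prop) _ _

lemma lintegral_cone_norm [Nontrivial V] :
    ∫⁻ y : V, ENNReal.ofReal (max 0 (1 - ‖y‖ / √2) ^ 2) = ENNReal.ofReal (coneConst V) := by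
  have hint : Integrable (fun y : V => max 0 (1 - ‖y‖ / √2) ^ 2) := by
    refine Continuous.integrable_of_hasCompactSupport (by fun_prop) ?_
    refine HasCompactSupport.of_support_subset_isCompact (isCompact_closedBall (0 : V) √2) ?_
    intro y hy
    rw [mem_closedBall_zero_iff]
    by_contra! hgt
    refine hy ?_
    have h2 : 0 < √(2 : ℝ) := by positivity
    simp only
    rw [max_eq_left (by rw [sub_nonpos, one_le_div h2]; exact hgt.le)]
    simp
  rw [← ofReal_integral_eq_lintegral_ofReal hint (Eventually.of_forall fun y => by positivity)]
  congr 1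
  obtain ⟨k, hk⟩ : ∃ k, Module.finrank ℝ V = k + 1 :=
    Nat.exists_eq_succ_of_ne_zero (Module.finrank_pos (R := ℝ) (M := V)).ne'
  rw [integral_fun_norm_addHaar (μ := volume) (fun r => max 0 (1 - r / √2) ^ 2), hk,
    Nat.add_sub_cancel, integral_cone_profile, coneConst, hk]
  simp only [nsmul_eq_mul, smul_eq_mul]
  push_cast
  field_simp
  ring

lemma coneConst_pos : 0 < coneConst V := by
  have : 0 < volume.real (Metric.ball (0 : V) 1) :=
    ENNReal.toReal_pos (Metric.measure_ball_pos _ _ one_pos).ne' measure_ball_lt_top.ne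
  rw [coneConst]
  positivity

lemma coneIntegral_of_det_pos [Nontrivial V] (hT : T.IsSymmetric) (hT0 : ∀ y, 0 ≤ inner ℝ (T y) y)
    (hd : 0 < LinearMap.det T) :
    coneIntegral T = ENNReal.ofReal (coneConst V) / ENNReal.ofReal √(LinearMap.det T) := by
  obtain ⟨S, hS, hSd⟩ := exists_sqrt_of_inner_nonneg hT hT0
  have hsd := Real.sqrt_pos.2 hd
  have h1 : ∀ y : V, √(inner ℝ (T y) y / 2) = ‖S y‖ / √2 := fun y => by
    rw [hS, Real.sqrt_div (by positivity), Real.sqrt_sq (norm_nonneg _)]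
  have hm : Measurable fun y : V => ENNReal.ofReal (max 0 (1 - ‖y‖ / √2) ^ 2) := by fun_prop
  have hSm : Measurable S := S.continuous_of_finiteDimensional.measurable
  rw [coneIntegral]
  simp only [h1]
  rw [← lintegral_map (μ := volume) hm hSm, Measure.map_linearMap_addHaar_eq_smul_addHaar volume
    (by rw [hSd]; exact hsd.ne'), lintegral_smul_measure, lintegral_cone_norm, hSd,
    abs_of_pos (inv_pos.2 hsd), ENNReal.ofReal_inv_of_pos hsd, smul_eq_mul, ENNReal.div_eq_inv_mul]

theorem coneIntegral_eq [Nontrivial V] (hT : T.IsSymmetric) (hT0 : ∀ y, 0 ≤ inner ℝ (T y) y) :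
    coneIntegral T = ENNReal.ofReal (coneConst V) / ENNReal.ofReal √(LinearMap.det T) := by
  rcases (det_nonneg_of_inner_nonneg hT hT0).eq_or_lt with hd | hd
  swap
  · exact coneIntegral_of_det_pos hT hT0 hd
  rw [← hd, Real.sqrt_zero, ENNReal.ofReal_zero,
    ENNReal.div_zero (ENNReal.ofReal_pos.2 coneConst_pos).ne', eq_top_iff]
  -- A degenerate form is compared with its definite perturbations `T + ε`, whose integrals are
  -- smaller and tend to infinity as their determinants tend to `0`.
  have hbound : ∀ ε : ℝ, 0 < ε → ENNReal.ofReal (coneConst V) /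
      ENNReal.ofReal √(LinearMap.det (T + ε • LinearMap.id)) ≤ coneIntegral T := by
    intro ε hε
    have hs : (T + ε • LinearMap.id : V →ₗ[ℝ] V).IsSymmetric := by
      intro y z
      simp [inner_add_left, inner_add_right, hT y z, real_inner_smul_left, inner_smul_right]
    have hi : ∀ y, inner ℝ ((T + ε • LinearMap.id : V →ₗ[ℝ] V) y) y =
        inner ℝ (T y) y + ε * ‖y‖ ^ 2 := by
      intro y
      simp [inner_add_left, real_inner_smul_left]
    have hb : ∀ y, ε * ‖y‖ ^ 2 ≤ inner ℝ ((T + ε • LinearMap.id : V →ₗ[ℝ] V) y) y := by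
      intro y
      rw [hi]; linarith [hT0 y]
    rw [← coneIntegral_of_det_pos hs (fun y => le_trans (by positivity) (hb y))
      (det_pos_of_bound hs hε hb), coneIntegral, coneIntegral]
    refine lintegral_mono fun y => ENNReal.ofReal_le_ofReal ?_
    have : √(inner ℝ (T y) y / 2) ≤ √(inner ℝ ((T + ε • LinearMap.id : V →ₗ[ℝ] V) y) y / 2) := by
      refine Real.sqrt_le_sqrt ?_
      rw [hi]
      have : 0 ≤ ε * ‖y‖ ^ 2 := by positivity
      linarith
    gcongr
  have hlim : Tendsto (fun ε : ℝ => LinearMap.det (T + ε • LinearMap.id)) (𝓝[>] 0) (𝓝 0) := by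
    have hc : Continuous fun ε : ℝ => LinearMap.det (T + ε • LinearMap.id) := by
      have e : (fun ε : ℝ => LinearMap.det (T + ε • LinearMap.id)) = fun ε : ℝ =>
          (LinearMap.toMatrix (Module.finBasis ℝ V) (Module.finBasis ℝ V) T +
            ε • (1 : Matrix _ _ ℝ)).det := by
        funext ε
        rw [← LinearMap.det_toMatrix (Module.finBasis ℝ V), map_add, map_smul, LinearMap.toMatrix_id]
      rw [e]
      exact Continuous.matrix_det (by fun_prop)
    have := hc.tendsto 0
    rw [zero_smul, add_zero, ← hd] at this
    exact this.mono_left nhdsWithin_le_nhds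
  have hlim2 : Tendsto (fun ε : ℝ => ENNReal.ofReal (coneConst V) /
      ENNReal.ofReal √(LinearMap.det (T + ε • LinearMap.id))) (𝓝[>] 0) (𝓝 ⊤) := by
    have h1 : Tendsto (fun ε : ℝ => ENNReal.ofReal √(LinearMap.det (T + ε • LinearMap.id)))
        (𝓝[>] 0) (𝓝 0) := by
      have := ENNReal.tendsto_ofReal ((Real.continuous_sqrt.tendsto 0).comp hlim)
      rwa [Real.sqrt_zero, ENNReal.ofReal_zero] at this
    have h2 := ENNReal.Tendsto.const_div h1 (a := ENNReal.ofReal (coneConst V))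
      (Or.inr ENNReal.ofReal_ne_top)
    rwa [ENNReal.div_zero (ENNReal.ofReal_pos.2 coneConst_pos).ne'] at h2
  exact le_of_tendsto hlim2 (eventually_mem_nhdsWithin.mono hbound)

end QuadraticCone

section CapLimit

variable {E : Type*} [NormedAddCommGroup E] [InnerProductSpace ℝ E] [FiniteDimensional ℝ E]
  [MeasurableSpace E] [BorelSpace E] {g : E → ℝ} {ρ R : ℝ} {x p : E} {B : E →L[ℝ] E}
  {f : E → ℝ≥0∞}

/-- The volume of small caps. The limit is infinite if the second order part is degenerate. -/
theorem tendsto_capVolume (hg : BodyGauge g ρ R) (hx : g x = 1)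
    (h : HasSecondOrderExpansion g x p B) (hp : 0 < ‖p‖) (hE : 2 ≤ Module.finrank ℝ E)
    (hf : Measurable f) (hfx : ContinuousAt f x) (hf0 : f x ≠ 0) (hftop : f x ≠ ⊤) :
    Tendsto (fun t => (∫⁻ w in cap g ((1 + t) • x), f w) /
        ENNReal.ofReal (√t ^ (Module.finrank ℝ E + 1))) (𝓝[>] 0)
      (𝓝 (ENNReal.ofReal ‖p‖⁻¹ * (f x *
        (ENNReal.ofReal (coneConst (Submodule.span ℝ {‖p‖⁻¹ • p})ᗮ) /
          ENNReal.ofReal √(LinearMap.det (tangentOp B (‖p‖⁻¹ • p))))))) := by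
  set N := ‖p‖⁻¹ • p with hN
  have hfr : Module.finrank ℝ (Submodule.span ℝ {N})ᗮ + 1 = Module.finrank ℝ E :=
    finrank_orthogonal_add_one (by
      rw [hN]
      exact smul_ne_zero (inv_ne_zero hp.ne') (norm_pos_iff.1 hp))
  have : Nontrivial (Submodule.span ℝ {N})ᗮ :=
    Module.nontrivial_of_finrank_pos (R := ℝ) (by omega)
  have hsym := isSymmetric_tangentOp h.1 N
  have hnn : ∀ y : (Submodule.span ℝ {N})ᗮ, 0 ≤ inner ℝ (tangentOp B N y) y := fun y => by
    rw [inner_tangentOp]; exact hg.expansion_nonneg h y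
  have hcc : capIntegral B N = coneIntegral (tangentOp B N) := by
    rw [capIntegral, coneIntegral]
    simp only [inner_tangentOp]
  rw [← coneIntegral_eq hsym hnn, ← hcc]
  -- In the degenerate case the limit is infinite, so the Fatou lower bound suffices; rescaled caps
  -- need not stay bounded there.
  rcases (det_nonneg_of_inner_nonneg hsym hnn).eq_or_lt with hd | hd
  · have htop : ENNReal.ofReal ‖p‖⁻¹ * (f x * capIntegral B N) = ⊤ := by
      rw [hcc, coneIntegral_eq hsym hnn, ← hd, Real.sqrt_zero, ENNReal.ofReal_zero,
        ENNReal.div_zero (ENNReal.ofReal_pos.2 coneConst_pos).ne', ENNReal.mul_top hf0,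
        ENNReal.mul_top (ENNReal.ofReal_pos.2 (inv_pos.2 hp)).ne']
    have h1 := le_liminf_lintegral_cap hg hx h hp hf hfx
    rw [htop] at h1 ⊢
    exact tendsto_of_le_liminf_of_limsup_le h1 le_top
  · obtain ⟨m, hm, hmT⟩ := exists_pos_bound_of_det_pos hsym hnn hd
    refine tendsto_lintegral_cap hg hx h hp hE hm (fun y hy => ?_) hf hfx hftop
    have hyN : y ∈ (Submodule.span ℝ {N})ᗮ := by
      rw [Submodule.mem_orthogonal_singleton_iff_inner_right, hN, real_inner_smul_left, hy, mul_zero]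
    have := hmT ⟨y, hyN⟩
    rwa [inner_tangentOp] at this

end CapLimit

end Illumination
end

/-! ### Lower bounds for the volume of caps -/

noncomputable section

namespace Illumination

open scoped ENNReal NNReal

section CapBounds

variable {E : Type*} [NormedAddCommGroup E] [InnerProductSpace ℝ E] {g : E → ℝ} {ρ R : ℝ}
  {x p z w : E}

lemma gauge_le_of_mem_cap (hg : BodyGauge g ρ R) (hw : w ∈ cap g z) : g w ≤ g z := by
  have := cap_antitone hg hw zero_le_one le_rfl
  rwa [one_smul, add_sub_cancel, zero_smul, add_zero] at this

/-- Caps grow along rays. -/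
lemma cap_subset_cap (hg : BodyGauge g ρ R) {s : ℝ} (hs : 1 ≤ s) :
    cap g z ⊆ cap g (s • z) := by
  rintro w ⟨h1, l, hl1, hl⟩
  have hl0 : 0 < l := by linarith
  have hs0 : 0 < s := by linarith
  -- With this `ν` the line from `s z` through `w`, followed to parameter `ν⁻¹`, ends at `(ν l)⁻¹ (z
  -- + l (w - z))`, a multiple by a factor at most `1` of a point of the body.
  set ν := 1 - (1 - l⁻¹) * s⁻¹ with hν
  have hli : l⁻¹ ≤ 1 := inv_le_one_of_one_le₀ hl1
  have hli0 : 0 < l⁻¹ := inv_pos.2 hl0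
  have hsi : s⁻¹ ≤ 1 := inv_le_one_of_one_le₀ hs
  have hsi0 : 0 < s⁻¹ := inv_pos.2 hs0
  have hνl : l⁻¹ ≤ ν := by
    rw [hν]
    nlinarith
  have hν0 : 0 < ν := by linarith
  have hν1 : ν ≤ 1 := by
    rw [hν]
    have := mul_nonneg (sub_nonneg.2 hli) hsi0.le
    linarith
  refine ⟨h1, ν⁻¹, (one_le_inv₀ hν0).2 hν1, ?_⟩
  have e : s • z + ν⁻¹ • (w - s • z) = (ν⁻¹ * l⁻¹) • (z + l • (w - z)) := by
    have h2 : s - ν⁻¹ * s = ν⁻¹ * l⁻¹ - ν⁻¹ := by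
      field_simp
      rw [hν]
      field_simp
      ring
    match_scalars
    · linear_combination h2 + ν⁻¹ * (mul_inv_cancel₀ hl0.ne')
    · field_simp
  rw [e, hg.smul (by positivity)]
  have h3 : ν⁻¹ * l⁻¹ ≤ 1 := by rwa [inv_mul_le_one₀ hν0]
  have h4 := hg.nonneg (z + l • (w - z))
  nlinarith [mul_nonneg (inv_pos.2 hν0).le hli0.le]

lemma ball_subset_cap (hg : BodyGauge g ρ R) (hx : g x = 1) {h : ℝ} (h0 : 0 < h) (h1 : h ≤ 1) :
    Metric.ball ((1 + h / 2) • x) (ρ * h / 4) ⊆ cap g ((1 + h) • x) := by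
  intro w hw
  have hρ := hg.pos_rho
  rw [mem_ball_iff_norm] at hw
  set u := w - (1 + h / 2) • x with hu
  have hwu : w = (1 + h / 2) • x + u := by rw [hu, add_sub_cancel]
  have hgu : ∀ v : E, ‖v‖ < ρ * h / 4 → g v < h / 4 := by
    intro v hv
    refine (hg.le_div v).trans_lt ?_
    rw [div_lt_iff₀ hρ]
    linarith
  -- For this parameter the line from the apex through the centre of the ball reaches the origin.
  refine ⟨?_, 2 * (1 + h) / h, ?_, ?_⟩
  · have h2 := hg.add_le w (-u)
    have h3 := hgu (-u) (by rwa [norm_neg])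
    have e : w + -u = (1 + h / 2) • x := by rw [hwu]; abel
    rw [e, hg.smul (by positivity), hx] at h2
    linarith
  · rw [le_div_iff₀ h0]; linarith
  · have e : (1 + h) • x + (2 * (1 + h) / h) • (w - (1 + h) • x) = (2 * (1 + h) / h) • u := by
      rw [hwu]
      match_scalars <;> field_simp
      ring
    rw [e, hg.smul (by positivity)]
    have h3 := hgu u hw
    have h4 : 2 * (1 + h) / h * g u ≤ 2 * (1 + h) / h * (h / 4) := by gcongr
    have h5 : 2 * (1 + h) / h * (h / 4) = (1 + h) / 2 := by field_simp; ring
    linarith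

/-- Doubling the distance from the apex leads into the touching ball. Relative to its centre the
squared norm drops by at least `h ρ r / 2` through the inward component, while the smallness
conditions keep the quadratic error below `h ρ r / 4`. -/
lemma parab_mem_cap_of_rolling (hpx : inner ℝ p x = 1)
    (hp : ∀ y, inner ℝ p y ≤ g y) (hxR : ‖x‖ ≤ R) (hpρ : ρ ≤ ‖p‖⁻¹)
    {r h σ : ℝ} {y : E} (hr : 0 < r)
    (hroll : x ∈ BodyGauge.rollingSet g r) (h0 : 0 < h) (hh1 : h * (4 * R ^ 2) ≤ ρ * r)
    (hy : inner ℝ p y = 0) (hyr : 64 * ‖y‖ ^ 2 ≤ ρ * r)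
    (hσ1 : 1 / 4 ≤ σ) (hσ2 : σ ≤ 3 / 8) : parab x h y σ ∈ cap g ((1 + h) • x) := by
  obtain ⟨hx, c, hc, hd⟩ := hroll
  have hsub := BodyGauge.sub_eq_of_closedBall_subset hr.le hpx hp hc hd.le
  have hpn : 0 < ‖p‖ := by
    rw [norm_pos_iff]
    rintro rfl
    simp at hpx
  have hxc : x - c = (r * ‖p‖⁻¹) • p := by
    rw [← one_smul ℝ (x - c), ← inv_mul_cancel₀ hpn.ne', mul_smul, hsub, smul_smul, mul_comm]
  refine ⟨?_, 2, one_le_two, ?_⟩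
  · refine lt_of_lt_of_le ?_ (hp _)
    rw [parab, inner_add_right, inner_add_right, inner_smul_right, inner_smul_right, hpx, hy]
    have : 0 < h * σ := by positivity
    linarith
  · rw [parab_line]
    refine hc ?_
    rw [mem_closedBall_iff_norm]
    set s := 1 - 2 * σ with hs
    have hs1 : 1 / 4 ≤ s := by linarith
    have hs2 : s ≤ 1 / 2 := by linarith
    have e : parab x h ((2 : ℝ) • y) (1 + 2 * (σ - 1)) - c =
        (x - c) + ((2 * √h) • y - (h * s) • x) := by
      rw [parab, hs]
      match_scalars <;> ring
    set u := (2 * √h) • y - (h * s) • x with hu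
    have hpu : inner ℝ p u = -(h * s) := by
      rw [hu, inner_sub_right, inner_smul_right, inner_smul_right, hpx, hy]; ring
    have hun : ‖u‖ ^ 2 ≤ 8 * h * ‖y‖ ^ 2 + 2 * (h * s) ^ 2 * R ^ 2 := by
      have h1 : ‖u‖ ≤ 2 * √h * ‖y‖ + h * s * R := by
        refine (norm_sub_le _ _).trans ?_
        rw [norm_smul, norm_smul, Real.norm_of_nonneg (by positivity),
          Real.norm_of_nonneg (by positivity)]
        gcongr
      calc ‖u‖ ^ 2 ≤ (2 * √h * ‖y‖ + h * s * R) ^ 2 := by gcongr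
        _ ≤ 2 * (2 * √h * ‖y‖) ^ 2 + 2 * (h * s * R) ^ 2 := by
            nlinarith [sq_nonneg (2 * √h * ‖y‖ - h * s * R)]
        _ = 8 * √h ^ 2 * ‖y‖ ^ 2 + 2 * (h * s) ^ 2 * R ^ 2 := by ring
        _ = _ := by rw [Real.sq_sqrt h0.le]
    have hxcn : ‖x - c‖ = r := by rw [← dist_eq_norm, hd]
    have key : ‖(x - c) + u‖ ^ 2 ≤ r ^ 2 := by
      rw [norm_add_sq_real, hxcn, hxc, real_inner_smul_left, hpu]
      have a1 : 8 * h * ‖y‖ ^ 2 ≤ h * (ρ * r) / 8 := by nlinarith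
      have a2 : 2 * (h * s) ^ 2 * R ^ 2 ≤ h * (ρ * r) / 8 := by
        have : s ^ 2 ≤ 1 / 4 := by nlinarith
        have h3 : 2 * (h * s) ^ 2 * R ^ 2 ≤ h * (h * (4 * R ^ 2)) / 8 := by
          have h4 : h ^ 2 * R ^ 2 * s ^ 2 ≤ h ^ 2 * R ^ 2 * (1 / 4) := by gcongr
          linarith
        have h5 : h * (h * (4 * R ^ 2)) ≤ h * (ρ * r) := by gcongr
        linarith
      have a3 : h * (ρ * r) / 4 ≤ r * ‖p‖⁻¹ * (h * s) := by
        calc h * (ρ * r) / 4 = r * ρ * (h * (1 / 4)) := by ring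
          _ ≤ r * ‖p‖⁻¹ * (h * s) := by gcongr
      have : 0 ≤ r * ‖p‖⁻¹ * (h * s) := by positivity
      linarith
    rw [e]
    exact le_of_sq_le_sq key hr.le

/-- `‖p‖⁻¹` is the distance from the origin to the supporting hyperplane at `x`, which separates the
inscribed ball of radius `ρ` from the outside and meets the ball of radius `R`. -/
lemma BodyGauge.inv_norm_support (hg : BodyGauge g ρ R) (hx : g x = 1) (hpx : inner ℝ p x = 1)
    (hp : ∀ y, inner ℝ p y ≤ g y) : 0 < ‖p‖ ∧ ρ ≤ ‖p‖⁻¹ ∧ ‖p‖⁻¹ ≤ R := by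
  have hpn : 0 < ‖p‖ := by
    rw [norm_pos_iff]
    rintro rfl
    simp at hpx
  have hρ := hg.pos_rho
  refine ⟨hpn, ?_, ?_⟩
  · have h1 := (hp p).trans (hg.le_div p)
    rw [real_inner_self_eq_norm_sq, le_div_iff₀ hρ] at h1
    rw [← one_div, le_div_iff₀ hpn]
    nlinarith
  · have h1 := real_inner_le_norm p x
    have h2 := hg.norm_le_of_gauge_le hx.le
    rw [inv_le_iff_one_le_mul₀ hpn]
    rw [hpx] at h1
    nlinarith

variable [FiniteDimensional ℝ E] [MeasurableSpace E] [BorelSpace E]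

lemma volume_closedBall_euclidean {d : ℕ} (hd : Module.finrank ℝ E = d) :
    volume (Metric.closedBall (0 : E) 1) =
      volume (Metric.closedBall (0 : EuclideanSpace ℝ (Fin d)) 1) := by
  set e := ((stdOrthonormalBasis ℝ E).reindex (finCongr hd)).repr
  rw [← e.measurePreserving.measure_preimage measurableSet_closedBall.nullMeasurableSet,
    e.preimage_closedBall, map_zero]

lemma volume_cap_ge (hg : BodyGauge g ρ R) (hx : g x = 1) {h : ℝ} (h0 : 0 < h) (h1 : h ≤ 1) :
    ENNReal.ofReal ((ρ / 4) ^ Module.finrank ℝ E * volume.real (Metric.ball (0 : E) 1) *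
      h ^ Module.finrank ℝ E) ≤ volume (cap g ((1 + h) • x)) := by
  have hρ := hg.pos_rho
  refine le_trans ?_ (measure_mono (ball_subset_cap hg hx h0 h1))
  rw [Measure.addHaar_ball_of_pos _ _ (by positivity),
    show (ρ / 4) ^ Module.finrank ℝ E * volume.real (Metric.ball (0 : E) 1) * h ^ Module.finrank ℝ E
      = (ρ * h / 4) ^ Module.finrank ℝ E * volume.real (Metric.ball (0 : E) 1) by
        rw [div_pow, div_pow, mul_pow]; ring,
    ENNReal.ofReal_mul (by positivity), Measure.real, ENNReal.ofReal_toReal measure_ball_lt_top.ne]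

/-- If `h` is at most a constant times `r`, the cap contains a parabolic box of tangential size
comparable to `√(r h)` and height comparable to `h`. For larger `h` the inscribed ball of volume
comparable to `h^n` suffices, as `h^((n-1)/2)` then dominates `r^((n-1)/2)`. -/
lemma volume_cap_ge_of_rolling (hg : BodyGauge g ρ R) [Nontrivial E] :
    ∃ c > 0, ∀ x r h, 0 < r → x ∈ BodyGauge.rollingSet g r → 0 < h → h ≤ 1 →
      ENNReal.ofReal (c * √r ^ (Module.finrank ℝ E - 1) * √h ^ (Module.finrank ℝ E + 1)) ≤
        volume (cap g ((1 + h) • x)) := by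
  have hρ := hg.pos_rho
  have hR := hg.pos_R
  set d := Module.finrank ℝ E - 1 with hd
  have hdn : Module.finrank ℝ E = d + 1 := by
    have := Module.finrank_pos (R := ℝ) (M := E)
    omega
  set ω := volume.real (Metric.ball (0 : E) 1) with hω
  have hω0 : 0 < ω :=
    ENNReal.toReal_pos (Metric.measure_ball_pos _ _ one_pos).ne' measure_ball_lt_top.ne
  set ω' := volume.real (Metric.closedBall (0 : EuclideanSpace ℝ (Fin d)) 1) with hω'
  have hω'0 : 0 < ω' :=
    ENNReal.toReal_pos (Metric.measure_closedBall_pos _ _ one_pos).ne' measure_closedBall_lt_top.ne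
  set a := ρ / (4 * R ^ 2) with ha
  have ha0 : 0 < a := by positivity
  set c₁ := ρ * (√(ρ / 64) ^ d * ω' * (1 / 8)) with hc₁
  set c₂ := (ρ / 4) ^ (d + 1) * ω * √a ^ d with hc₂
  refine ⟨min c₁ c₂, by positivity, fun x r h hr hroll h0 h1 => ?_⟩
  rw [hdn]
  have hsh : 0 < √h := Real.sqrt_pos.2 h0
  have hsr : 0 < √r := Real.sqrt_pos.2 hr
  rcases le_or_gt h (a * r) with hle | hgt
  · obtain ⟨p, hpx, hp⟩ := hg.exists_support x
    have hx : g x = 1 := hroll.1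
    rw [hx] at hpx
    obtain ⟨hpn, hpρ, hpR⟩ := hg.inv_norm_support hx hpx hp
    set N := ‖p‖⁻¹ • p with hN
    have hfr : Module.finrank ℝ (Submodule.span ℝ {N})ᗮ + 1 = Module.finrank ℝ E :=
      finrank_orthogonal_add_one (by
        rw [hN]
        exact smul_ne_zero (inv_ne_zero hpn.ne') (norm_pos_iff.1 hpn))
    have hsub : ∀ q ∈ Metric.closedBall (0 : (Submodule.span ℝ {N})ᗮ) (√(ρ / 64) * √r) ×ˢ
        Icc (1 / 4 : ℝ) (3 / 8), parab x h q.1 q.2 ∈ cap g ((1 + h) • x) := by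
      rintro ⟨y, σ⟩ ⟨hy, hσ⟩
      have hle1 : h ≤ ρ / (4 * R ^ 2) * r := hle
      rw [div_mul_eq_mul_div, le_div_iff₀ (by positivity)] at hle1
      refine parab_mem_cap_of_rolling hpx hp (by simpa using hg.norm_le_of_gauge_le hx.le)
        hpρ hr hroll h0 hle1 (inner_eq_zero_of_unit_orthogonal hpn y) ?_ hσ.1 hσ.2
      rw [mem_closedBall_zero_iff] at hy
      have : ‖y‖ ^ 2 ≤ (√(ρ / 64) * √r) ^ 2 := by gcongr
      rw [mul_pow, Real.sq_sqrt (by positivity), Real.sq_sqrt hr.le] at this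
      rw [← Submodule.coe_norm]
      linarith
    have hvolW : volume (Metric.closedBall (0 : (Submodule.span ℝ {N})ᗮ) (√(ρ / 64) * √r)) =
        ENNReal.ofReal ((√(ρ / 64) * √r) ^ d * ω') := by
      have hfd : Module.finrank ℝ (Submodule.span ℝ {N})ᗮ = d := by omega
      rw [Measure.addHaar_closedBall' _ _ (by positivity), hfd, ENNReal.ofReal_mul (by positivity),
        hω', Measure.real, ENNReal.ofReal_toReal measure_closedBall_lt_top.ne]
      rw [volume_closedBall_euclidean hfd]
    have hcapm := measurableSet_cap hg ((1 + h) • x)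
    rw [← lintegral_indicator_one hcapm, lintegral_eq_parab hpn hpx (measurable_one.indicator hcapm) h0]
    calc ENNReal.ofReal (min c₁ c₂ * √r ^ d * √h ^ (d + 1 + 1))
        ≤ ENNReal.ofReal (‖p‖⁻¹ * √h ^ (Module.finrank ℝ E + 1) *
          ((√(ρ / 64) * √r) ^ d * ω' * (1 / 8))) := by
            refine ENNReal.ofReal_le_ofReal ?_
            rw [hdn]
            calc min c₁ c₂ * √r ^ d * √h ^ (d + 1 + 1) ≤ c₁ * √r ^ d * √h ^ (d + 1 + 1) := by
                  gcongr; exact min_le_left _ _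
              _ = ρ * √h ^ (d + 1 + 1) * ((√(ρ / 64) * √r) ^ d * ω' * (1 / 8)) := by
                  rw [hc₁, mul_pow]; ring
              _ ≤ _ := by gcongr
      _ = ENNReal.ofReal (‖p‖⁻¹ * √h ^ (Module.finrank ℝ E + 1)) *
          volume (Metric.closedBall (0 : (Submodule.span ℝ {N})ᗮ) (√(ρ / 64) * √r) ×ˢ
            Icc (1 / 4 : ℝ) (3 / 8)) := by
          rw [Measure.volume_eq_prod, Measure.prod_prod, hvolW, Real.volume_Icc,
            ENNReal.ofReal_mul (by positivity), ENNReal.ofReal_mul (p := _ * ω') (by positivity)]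
          norm_num
      _ ≤ _ := by
          gcongr
          rw [← lintegral_indicator_one (measurableSet_closedBall.prod measurableSet_Icc)]
          refine lintegral_mono fun q => ?_
          by_cases hq : q ∈ Metric.closedBall (0 : (Submodule.span ℝ {N})ᗮ) (√(ρ / 64) * √r) ×ˢ
            Icc (1 / 4 : ℝ) (3 / 8)
          · rw [indicator_of_mem hq, indicator_of_mem (hsub q hq)]
            rfl
          · rw [indicator_of_notMem hq]
            exact zero_le
  · refine le_trans (ENNReal.ofReal_le_ofReal ?_) (volume_cap_ge hg hroll.1 h0 h1)
    rw [hdn]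
    have hsq : √a * √r ≤ √h := by
      rw [← Real.sqrt_mul ha0.le]
      exact Real.sqrt_le_sqrt hgt.le
    calc min c₁ c₂ * √r ^ d * √h ^ (d + 1 + 1) ≤ c₂ * √r ^ d * √h ^ (d + 1 + 1) := by
          gcongr; exact min_le_right _ _
      _ = (ρ / 4) ^ (d + 1) * ω * ((√a * √r) ^ d * √h ^ (d + 2)) := by rw [hc₂, mul_pow]; ring
      _ ≤ (ρ / 4) ^ (d + 1) * ω * (√h ^ d * √h ^ (d + 2)) := by gcongr
      _ = (ρ / 4) ^ (d + 1) * ω * (√h ^ 2) ^ (d + 1) := by ring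
      _ = _ := by rw [Real.sq_sqrt h0.le]

end CapBounds

end Illumination
end

/-! ### Asymptotics of the illumination body along rays -/

noncomputable section

namespace Illumination

open scoped ENNReal NNReal

lemma sqrt_pow_rpow {h : ℝ} (hh : 0 ≤ h) (m : ℕ) (a : ℝ) : (√h ^ m) ^ a = h ^ ((m : ℝ) / 2 * a) := by
  rw [Real.sqrt_eq_rpow, ← Real.rpow_natCast, ← Real.rpow_mul hh, ← Real.rpow_mul hh]
  congr 1
  ring

lemma sqrt_mul_rpow_pow {s δ : ℝ} (hs : 0 ≤ s) (hδ : 0 ≤ δ) (m : ℕ) :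
    √(s * δ ^ (2 / ((m : ℝ) + 1))) ^ (m + 1) = s ^ (((m : ℝ) + 1) / 2) * δ := by
  have h := sqrt_pow_rpow (show 0 ≤ s * δ ^ (2 / ((m : ℝ) + 1)) by positivity) (m + 1) 1
  rw [Real.rpow_one, mul_one, Real.mul_rpow hs (by positivity), ← Real.rpow_mul hδ] at h
  push_cast at h
  rw [h, div_mul_div_cancel₀' two_ne_zero, div_self (by positivity), Real.rpow_one]

lemma HasSecondOrderExpansion.of_smul {E : Type*} [NormedAddCommGroup E] [InnerProductSpace ℝ E]
    {g : E → ℝ} {ρ R : ℝ} {x p : E} (hg : BodyGauge g ρ R) {B : E →L[ℝ] E}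
    {t : ℝ} (ht : 0 < t) (h : HasSecondOrderExpansion g (t • x) p B) :
    HasSecondOrderExpansion g x p (t • B) := by
  refine ⟨fun y z => ?_, ?_⟩
  · have := h.1 y z
    simp only [ContinuousLinearMap.coe_coe, ContinuousLinearMap.toLinearMap_smul, LinearMap.smul_apply,
      real_inner_smul_left, inner_smul_right] at this ⊢
    rw [this]
  · have hl : Tendsto (fun v : E => t • v) (𝓝 0) (𝓝 0) := by
      have : Tendsto (fun v : E => t • v) (𝓝 0) (𝓝 (t • (0 : E))) := Continuous.tendsto (by fun_prop) _
      rwa [smul_zero] at this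
    have h1 := (h.2.comp_tendsto hl).const_mul_left t⁻¹
    have h2 : ((fun v : E => ‖v‖ ^ 2) ∘ fun v => t • v) =O[𝓝 0] fun v : E => ‖v‖ ^ 2 := by
      refine IsBigO.of_bound (t ^ 2) (Eventually.of_forall fun v => ?_)
      rw [Function.comp_apply, norm_smul, mul_pow, norm_mul, norm_pow, norm_pow, norm_norm,
        Real.norm_of_nonneg (norm_nonneg _), Real.norm_of_nonneg ht.le]
    refine (h1.trans_isBigO h2).congr_left fun v => ?_
    simp only [Function.comp_apply]
    rw [← smul_add, hg.smul ht.le, hg.smul ht.le, inner_smul_right, map_smul,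
      real_inner_smul_left, inner_smul_right, smul_apply, real_inner_smul_left]
    field_simp

section Illum

variable {E : Type*} [NormedAddCommGroup E] [InnerProductSpace ℝ E] [FiniteDimensional ℝ E]
  [MeasurableSpace E] [BorelSpace E] {g : E → ℝ} {ρ R : ℝ} {x p z w : E} {f k : E → ℝ≥0∞}

/-- Almost all boundary points have a second order expansion. -/
theorem BodyGauge.ae_boundary_expansion (hg : BodyGauge g ρ R) [Nontrivial E] :
    ∀ᵐ x ∂((Measure.euclideanHausdorffMeasure (Module.finrank ℝ E - 1) : Measure E).restrict
      {x | g x = 1}), ∃ p B, HasSecondOrderExpansion g x p B :=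
  hg.ae_boundary_of_ae (ae_exists_hasSecondOrderExpansion hg.convexOn hg.lipschitz hg.nonneg)
    fun _ t ht ⟨p, B, h⟩ => ⟨p, t • B, h.of_smul hg ht⟩

/-- The points whose cap has `f`-volume at most `δ`. -/
def illum (g : E → ℝ) (f : E → ℝ≥0∞) (δ : ℝ) : Set E :=
  {z | ∫⁻ w in cap g z, f w ≤ ENNReal.ofReal δ}

lemma measurableSet_illum (hg : BodyGauge g ρ R) (hf : Measurable f) (δ : ℝ) :
    MeasurableSet (illum g f δ) := by
  refine measurableSet_le ?_ measurable_const
  have h : Measurable fun z : E => ∫⁻ w, {q : E × E | q.2 ∈ cap g q.1}.indicator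
      (fun q => f q.2) (z, w) :=
    ((hf.comp measurable_snd).indicator (measurableSet_cap_graph hg)).lintegral_prod_right'
  convert h using 2 with z
  rw [← lintegral_indicator (measurableSet_cap hg z)]
  rfl

lemma lintegral_cap_ge (hg : BodyGauge g ρ R) {c a : ℝ}
    (hfc : ∀ w, g w ≤ a → ENNReal.ofReal c ≤ f w) (hz : g z ≤ a) :
    ENNReal.ofReal c * volume (cap g z) ≤ ∫⁻ w in cap g z, f w := by
  rw [← setLIntegral_const]
  exact setLIntegral_mono' (measurableSet_cap hg z) fun w hw =>
    hfc w ((gauge_le_of_mem_cap hg hw).trans hz)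

/-- The cap over `(1 + h₀) x` has mass bounded below uniformly in `x`, and caps grow along rays, so
a small `δ` forces `h ≤ h₀`. The second bound solves `c c₁ r^((n-1)/2) h^((n+1)/2) ≤ δ` for `h`. -/
lemma illum_bound (hg : BodyGauge g ρ R) [Nontrivial E] {c h₀ : ℝ}
    (hc : 0 < c) (hh₀ : 0 < h₀) (hh₁ : h₀ ≤ 1)
    (hfc : ∀ w, g w ≤ 1 + h₀ → ENNReal.ofReal c ≤ f w) :
    ∃ C > 0, ∃ δ₀ > 0, ∀ δ, 0 < δ → δ < δ₀ → ∀ x, g x = 1 → ∀ h, 0 < h →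
      (1 + h) • x ∈ illum g f δ → h ≤ h₀ ∧ ∀ r, 0 < r → x ∈ BodyGauge.rollingSet g r →
        h ≤ C * r ^ (-(((Module.finrank ℝ E : ℝ) - 1) / ((Module.finrank ℝ E : ℝ) + 1))) *
          δ ^ (2 / ((Module.finrank ℝ E : ℝ) + 1)) := by
  obtain ⟨c₁, hc₁, hroll⟩ := volume_cap_ge_of_rolling hg
  set n := Module.finrank ℝ E with hn
  have hn0 : 1 ≤ n := Module.finrank_pos (R := ℝ) (M := E)
  have hρ := hg.pos_rho
  set b := (ρ / 4) ^ n * volume.real (Metric.ball (0 : E) 1) * h₀ ^ n with hb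
  have hω0 : 0 < volume.real (Metric.ball (0 : E) 1) :=
    ENNReal.toReal_pos (Metric.measure_ball_pos _ _ one_pos).ne' measure_ball_lt_top.ne
  have hb0 : 0 < b := by positivity
  set α := 2 / ((n : ℝ) + 1) with hα
  have hα0 : 0 < α := by positivity
  refine ⟨(c * c₁) ^ (-α), by positivity, c * b, by positivity, ?_⟩
  intro δ hδ0 hδ x hx h h0 hmem
  have hhh : h ≤ h₀ := by
    by_contra! hgt
    have h1 := lintegral_cap_ge hg hfc (z := (1 + h₀) • x)
      (by rw [hg.smul (by linarith), hx, mul_one])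
    have h2 := volume_cap_ge hg hx hh₀ hh₁
    have h3 : cap g ((1 + h₀) • x) ⊆ cap g ((1 + h) • x) := by
      have := cap_subset_cap hg (z := (1 + h₀) • x) (s := (1 + h) / (1 + h₀))
        (by rw [one_le_div (by linarith)]; linarith)
      rwa [smul_smul, div_mul_cancel₀ _ (by linarith)] at this
    have h4 : ENNReal.ofReal (c * b) ≤ ENNReal.ofReal δ := by
      rw [ENNReal.ofReal_mul hc.le]
      calc ENNReal.ofReal c * ENNReal.ofReal b
          ≤ ENNReal.ofReal c * volume (cap g ((1 + h₀) • x)) := mul_le_mul_right h2 _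
        _ ≤ _ := h1
        _ ≤ _ := lintegral_mono_set h3
        _ ≤ _ := hmem
    rw [ENNReal.ofReal_le_ofReal_iff hδ0.le] at h4
    linarith
  refine ⟨hhh, fun r hr hxr => ?_⟩
  have h1 := lintegral_cap_ge hg hfc (z := (1 + h) • x)
    (by rw [hg.smul (by linarith), hx, mul_one]; linarith)
  have h2 := hroll x r h hr hxr h0 (hhh.trans hh₁)
  have h3 : c * (c₁ * √r ^ (n - 1) * √h ^ (n + 1)) ≤ δ := by
    rw [← ENNReal.ofReal_le_ofReal_iff hδ0.le, ENNReal.ofReal_mul hc.le]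
    exact (mul_le_mul_right h2 _).trans (h1.trans hmem)
  have hsr : 0 < √r := Real.sqrt_pos.2 hr
  have hsh : 0 < √h := Real.sqrt_pos.2 h0
  have h4 : (c * (c₁ * √r ^ (n - 1) * √h ^ (n + 1))) ^ α ≤ δ ^ α :=
    Real.rpow_le_rpow (by positivity) h3 hα0.le
  have e1 : c * (c₁ * √r ^ (n - 1) * √h ^ (n + 1)) = (c * c₁) * √r ^ (n - 1) * √h ^ (n + 1) := by
    ring
  have e2 : ((n - 1 : ℕ) : ℝ) / 2 * α = ((n : ℝ) - 1) / ((n : ℝ) + 1) := by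
    rw [Nat.cast_sub hn0, hα]
    push_cast
    field_simp
  have e3 : ((n + 1 : ℕ) : ℝ) / 2 * α = 1 := by
    rw [hα]
    push_cast
    field_simp
  rw [e1, Real.mul_rpow (by positivity) (by positivity), Real.mul_rpow (by positivity) (by positivity),
    sqrt_pow_rpow hr.le, sqrt_pow_rpow h0.le, e2, e3, Real.rpow_one] at h4
  rw [Real.rpow_neg (by positivity), Real.rpow_neg hr.le, ← mul_inv, inv_mul_eq_div, le_div_iff₀
    (by positivity)]
  linarith

/-- Rescaling of the part of the ray through `x` outside the body. -/
lemma rayIntegral_illum (hg : BodyGauge g ρ R) (hf : Measurable f) (hk : Measurable k)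
    (hx : g x = 1) {δ b : ℝ} (hb : 0 < b) :
    BodyGauge.rayIntegral ((illum g f δ \ {z | g z ≤ 1}).indicator k) x / ENNReal.ofReal b =
      ∫⁻ s : ℝ, (Ioi (0 : ℝ)).indicator (fun s => (illum g f δ).indicator k ((1 + b * s) • x) *
        ENNReal.ofReal ((1 + b * s) ^ (Module.finrank ℝ E - 1))) s := by
  have hI := measurableSet_illum hg hf δ
  have hKm : MeasurableSet {z : E | g z ≤ 1} :=
    measurableSet_le hg.continuous.measurable measurable_const
  set F : ℝ → ℝ≥0∞ := fun u => (Ioi (0 : ℝ)).indicator (fun u => (illum g f δ).indicator k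
    ((1 + u) • x) * ENNReal.ofReal ((1 + u) ^ (Module.finrank ℝ E - 1))) u with hF
  have hFm : Measurable F := by
    refine Measurable.indicator ?_ measurableSet_Ioi
    exact ((hk.indicator hI).comp (by fun_prop)).mul (by fun_prop)
  have h1 : BodyGauge.rayIntegral ((illum g f δ \ {z | g z ≤ 1}).indicator k) x = ∫⁻ u, F u := by
    rw [BodyGauge.rayIntegral, ← lintegral_indicator measurableSet_Ioi,
      ← lintegral_add_left_eq_self _ (1 : ℝ)]
    refine lintegral_congr fun u => ?_
    simp only [hF]
    by_cases hu : 0 < u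
    · have hu1 : (1 : ℝ) + u ∈ Ioi (0 : ℝ) := by rw [mem_Ioi]; linarith
      rw [indicator_of_mem hu1, indicator_of_mem (mem_Ioi.2 hu)]
      congr 1
      have hout : (1 + u) • x ∉ {z | g z ≤ 1} := by
        rw [mem_ofPred_eq, hg.smul (by linarith), hx]; linarith
      by_cases hm : (1 + u) • x ∈ illum g f δ
      · rw [indicator_of_mem hm, indicator_of_mem
          (show (1 + u) • x ∈ illum g f δ \ {z | g z ≤ 1} from ⟨hm, hout⟩)]
      · rw [indicator_of_notMem hm, indicator_of_notMem fun h => hm h.1]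
    · rw [indicator_of_notMem (show u ∉ Ioi (0 : ℝ) from hu)]
      by_cases hu1 : (1 : ℝ) + u ∈ Ioi (0 : ℝ)
      · have hin : (1 + u) • x ∈ {z | g z ≤ 1} := by
          rw [mem_ofPred_eq, hg.smul (le_of_lt hu1), hx]; linarith
        rw [indicator_of_mem hu1, indicator_of_notMem fun h => h.2 hin, zero_mul]
      · rw [indicator_of_notMem hu1]
  rw [h1, lintegral_comp_smul hFm hb, Module.finrank_self, pow_one, ENNReal.div_eq_inv_mul,
    ← mul_assoc, ENNReal.inv_mul_cancel (ENNReal.ofReal_pos.2 hb).ne' ENNReal.ofReal_ne_top, one_mul]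
  refine lintegral_congr fun s => ?_
  simp only [hF]
  by_cases hs : 0 < s
  · rw [indicator_of_mem (show b • s ∈ Ioi (0 : ℝ) from mul_pos hb hs),
      indicator_of_mem (mem_Ioi.2 hs), smul_eq_mul]
  · rw [indicator_of_notMem (show s ∉ Ioi (0 : ℝ) from hs), indicator_of_notMem]
    intro h
    exact hs ((mul_pos_iff_of_pos_left hb).1 h)

/-- At height `s δ^(2/(n+1))` the mass of the cap is asymptotic to `s^((n+1)/2) L δ`, which is
compared with `δ`. The case `L = ∞` is included: the threshold is then `0`. -/
lemma eventually_illum_iff {L : ℝ≥0∞} (hL0 : L ≠ 0)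
    (hL : Tendsto (fun t => (∫⁻ w in cap g ((1 + t) • x), f w) /
      ENNReal.ofReal (√t ^ (Module.finrank ℝ E + 1))) (𝓝[>] 0) (𝓝 L)) {s : ℝ} (hs : 0 < s)
    (hsL : s ≠ L⁻¹.toReal ^ (2 / ((Module.finrank ℝ E : ℝ) + 1))) :
    ∀ᶠ δ in 𝓝[>] (0 : ℝ), ((1 + δ ^ (2 / ((Module.finrank ℝ E : ℝ) + 1)) * s) • x ∈ illum g f δ ↔
      s < L⁻¹.toReal ^ (2 / ((Module.finrank ℝ E : ℝ) + 1))) := by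
  set n := Module.finrank ℝ E with hn
  set α := 2 / ((n : ℝ) + 1) with hα
  have hα0 : 0 < α := by positivity
  set e := ((n : ℝ) + 1) / 2 with he
  have he0 : 0 < e := by positivity
  have hαe : α * e = 1 := by rw [hα, he]; field_simp
  have hse : 0 < s ^ e := by positivity
  have hlim : Tendsto (fun δ : ℝ => s * δ ^ α) (𝓝[>] 0) (𝓝[>] 0) := by
    refine tendsto_nhdsWithin_iff.2 ⟨?_, ?_⟩
    · have : Tendsto (fun δ : ℝ => s * δ ^ α) (𝓝 0) (𝓝 (s * 0 ^ α)) :=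
        Continuous.tendsto (continuous_const.mul (Real.continuous_rpow_const hα0.le)) 0
      rw [Real.zero_rpow hα0.ne', mul_zero] at this
      exact this.mono_left nhdsWithin_le_nhds
    · filter_upwards [self_mem_nhdsWithin] with δ hδ
      have : (0 : ℝ) < δ := hδ
      exact mem_Ioi.2 (by positivity)
  have h1 : Tendsto (fun δ : ℝ => (∫⁻ w in cap g ((1 + δ ^ α * s) • x), f w) / ENNReal.ofReal δ)
      (𝓝[>] 0) (𝓝 (ENNReal.ofReal (s ^ e) * L)) := by
    refine (ENNReal.Tendsto.const_mul (hL.comp hlim) (Or.inr ENNReal.ofReal_ne_top)).congr' ?_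
    filter_upwards [self_mem_nhdsWithin] with δ hδ
    have hδ : 0 < δ := hδ
    rw [Function.comp_apply, sqrt_mul_rpow_pow hs.le hδ.le n, ENNReal.ofReal_mul hse.le,
      mul_comm s, ENNReal.div_eq_inv_mul, ENNReal.div_eq_inv_mul,
      ENNReal.mul_inv (Or.inl (ENNReal.ofReal_pos.2 hse).ne') (Or.inl ENNReal.ofReal_ne_top),
      ← mul_assoc, ← mul_assoc, ENNReal.mul_inv_cancel (ENNReal.ofReal_pos.2 hse).ne'
      ENNReal.ofReal_ne_top, one_mul]
  have hiff : ∀ δ : ℝ, 0 < δ → ((1 + δ ^ α * s) • x ∈ illum g f δ ↔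
      (∫⁻ w in cap g ((1 + δ ^ α * s) • x), f w) / ENNReal.ofReal δ ≤ 1) := by
    intro δ hδ
    rw [ENNReal.div_le_iff (ENNReal.ofReal_pos.2 hδ).ne' ENNReal.ofReal_ne_top, one_mul]
    rfl
  have hℓe : (L⁻¹.toReal ^ α) ^ e = L⁻¹.toReal := by
    rw [← Real.rpow_mul ENNReal.toReal_nonneg, hαe, Real.rpow_one]
  have hLi : L⁻¹ ≠ ⊤ := ENNReal.inv_ne_top.2 hL0
  rcases lt_or_gt_of_ne hsL with hlt | hgt
  · have h2 : ENNReal.ofReal (s ^ e) * L < 1 := by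
      have h3 : s ^ e < L⁻¹.toReal := by
        rw [← hℓe]; exact Real.rpow_lt_rpow hs.le hlt he0
      have h4 : ENNReal.ofReal (s ^ e) < L⁻¹ := (ENNReal.ofReal_lt_iff_lt_toReal hse.le hLi).2 h3
      rw [← one_div] at h4
      exact (ENNReal.lt_div_iff_mul_lt (Or.inl hL0)
        (Or.inr (ENNReal.ofReal_pos.2 hse).ne')).1 h4
    filter_upwards [h1.eventually_lt_const h2, self_mem_nhdsWithin] with δ hδ hδ0
    exact ⟨fun _ => hlt, fun _ => (hiff δ hδ0).2 hδ.le⟩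
  · have h2 : 1 < ENNReal.ofReal (s ^ e) * L := by
      have h3 : L⁻¹.toReal < s ^ e := by
        rw [← hℓe]; exact Real.rpow_lt_rpow (by positivity) hgt he0
      have h4 : L⁻¹ < ENNReal.ofReal (s ^ e) := (ENNReal.lt_ofReal_iff_toReal_lt hLi).2 h3
      rw [← one_div] at h4
      exact (ENNReal.div_lt_iff (Or.inl hL0) (Or.inr ENNReal.one_ne_top)).1 h4
    filter_upwards [h1.eventually_const_lt h2, self_mem_nhdsWithin] with δ hδ hδ0
    exact ⟨fun h => absurd ((hiff δ hδ0).1 h) (not_le.2 hδ), fun h => absurd h (not_lt.2 hgt.le)⟩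

/-- The length of the ray between the body and its illumination body. -/
lemma tendsto_rayIntegral_illum (hg : BodyGauge g ρ R) (hf : Measurable f) (hk : Measurable k)
    (hx : g x = 1) (hkx : ContinuousAt k x) (hktop : k x ≠ ⊤) {L : ℝ≥0∞} (hL0 : L ≠ 0)
    (hL : Tendsto (fun t => (∫⁻ w in cap g ((1 + t) • x), f w) /
      ENNReal.ofReal (√t ^ (Module.finrank ℝ E + 1))) (𝓝[>] 0) (𝓝 L)) {S : ℝ}
    (hS : ∀ᶠ δ in 𝓝[>] (0 : ℝ), ∀ s, 0 < s →
      (1 + δ ^ (2 / ((Module.finrank ℝ E : ℝ) + 1)) * s) • x ∈ illum g f δ → s ≤ S) :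
    Tendsto (fun δ => BodyGauge.rayIntegral ((illum g f δ \ {z | g z ≤ 1}).indicator k) x /
        ENNReal.ofReal (δ ^ (2 / ((Module.finrank ℝ E : ℝ) + 1)))) (𝓝[>] 0)
      (𝓝 (k x * ENNReal.ofReal (L⁻¹.toReal ^ (2 / ((Module.finrank ℝ E : ℝ) + 1))))) := by
  set n := Module.finrank ℝ E with hn
  set α := 2 / ((n : ℝ) + 1) with hα
  have hα0 : 0 < α := by positivity
  set ℓ := L⁻¹.toReal ^ α with hℓ
  have hδα : Tendsto (fun δ : ℝ => δ ^ α) (𝓝[>] 0) (𝓝 0) := by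
    have : Tendsto (fun δ : ℝ => δ ^ α) (𝓝 0) (𝓝 (0 ^ α)) :=
      (Real.continuous_rpow_const hα0.le).tendsto 0
    rw [Real.zero_rpow hα0.ne'] at this
    exact this.mono_left nhdsWithin_le_nhds
  have hline : Tendsto (fun u : ℝ => (1 + u) • x) (𝓝 0) (𝓝 x) := by
    have : Tendsto (fun u : ℝ => (1 + u) • x) (𝓝 0) (𝓝 ((1 + (0 : ℝ)) • x)) :=
      Continuous.tendsto (by fun_prop) 0
    rwa [add_zero, one_smul] at this
  have hpow : Tendsto (fun u : ℝ => ENNReal.ofReal ((1 + u) ^ (n - 1))) (𝓝 0) (𝓝 1) := by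
    have : Tendsto (fun u : ℝ => ENNReal.ofReal ((1 + u) ^ (n - 1))) (𝓝 0)
        (𝓝 (ENNReal.ofReal ((1 + (0 : ℝ)) ^ (n - 1)))) :=
      (ENNReal.continuous_ofReal.comp (by fun_prop : Continuous fun u : ℝ =>
        (1 + u) ^ (n - 1))).tendsto 0
    rwa [add_zero, one_pow, ENNReal.ofReal_one] at this
  have hprod : Tendsto (fun u : ℝ => k ((1 + u) • x) * ENNReal.ofReal ((1 + u) ^ (n - 1))) (𝓝 0)
      (𝓝 (k x)) := by
    have := ENNReal.Tendsto.mul (hkx.tendsto.comp hline) (Or.inr ENNReal.one_ne_top) hpow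
      (Or.inr hktop)
    rwa [mul_one] at this
  obtain ⟨η, hη, hηb⟩ := Metric.eventually_nhds_iff.1
    (hprod.eventually_lt_const (ENNReal.lt_add_right hktop one_ne_zero))
  have hgoal : k x * ENNReal.ofReal ℓ = ∫⁻ s : ℝ, (Ioo 0 ℓ).indicator (fun _ => k x) s := by
    rw [lintegral_indicator measurableSet_Ioo, setLIntegral_const, Real.volume_Ioo, sub_zero]
  rw [hgoal]
  have hmain : Tendsto (fun δ : ℝ => ∫⁻ s : ℝ, (Ioi (0 : ℝ)).indicator (fun s =>
      (illum g f δ).indicator k ((1 + δ ^ α * s) • x) *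
        ENNReal.ofReal ((1 + δ ^ α * s) ^ (n - 1))) s) (𝓝[>] 0)
      (𝓝 (∫⁻ s : ℝ, (Ioo 0 ℓ).indicator (fun _ => k x) s)) := by
    refine tendsto_lintegral_filter_of_dominated_convergence
      ((Icc 0 S).indicator fun _ => k x + 1) (Eventually.of_forall fun δ => ?_) ?_ ?_ ?_
    · refine Measurable.indicator ?_ measurableSet_Ioi
      exact ((hk.indicator (measurableSet_illum hg hf δ)).comp (by fun_prop)).mul (by fun_prop)
    · have hsmall : ∀ᶠ δ in 𝓝[>] (0 : ℝ), δ ^ α * S < η := by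
        have := hδα.mul_const S
        rw [zero_mul] at this
        exact this.eventually_lt_const hη
      filter_upwards [hS, hsmall, self_mem_nhdsWithin] with δ hδS hδη hδ0
      refine Eventually.of_forall fun s => ?_
      have hδ0 : 0 < δ := hδ0
      by_cases hs : 0 < s
      · rw [indicator_of_mem (mem_Ioi.2 hs)]
        by_cases hm : (1 + δ ^ α * s) • x ∈ illum g f δ
        · have hsS := hδS s hs hm
          rw [indicator_of_mem hm, indicator_of_mem (show s ∈ Icc 0 S from ⟨hs.le, hsS⟩)]
          refine (hηb ?_).le
          rw [dist_zero_right, Real.norm_of_nonneg (by positivity)]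
          refine lt_of_le_of_lt ?_ hδη
          gcongr
        · rw [indicator_of_notMem hm, zero_mul]
          exact zero_le
      · rw [indicator_of_notMem (show s ∉ Ioi (0 : ℝ) from hs)]
        exact zero_le
    · rw [lintegral_indicator measurableSet_Icc, setLIntegral_const, Real.volume_Icc]
      exact ENNReal.mul_ne_top (ENNReal.add_ne_top.2 ⟨hktop, ENNReal.one_ne_top⟩)
        ENNReal.ofReal_ne_top
    · have hne : ∀ᵐ s : ℝ, s ≠ ℓ := compl_mem_ae_iff.2 (measure_singleton ℓ)
      filter_upwards [hne] with s hsℓ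
      by_cases hs : 0 < s
      · have hiff := eventually_illum_iff hL0 hL hs hsℓ
        have hsδ : Tendsto (fun δ : ℝ => δ ^ α * s) (𝓝[>] 0) (𝓝 0) := by
          have := hδα.mul_const s
          rwa [zero_mul] at this
        by_cases hlt : s < ℓ
        · rw [indicator_of_mem (show s ∈ Ioo 0 ℓ from ⟨hs, hlt⟩)]
          refine (hprod.comp hsδ).congr' ?_
          filter_upwards [hiff] with δ hδ
          rw [indicator_of_mem (mem_Ioi.2 hs), indicator_of_mem (hδ.2 hlt), Function.comp_apply]
        · rw [indicator_of_notMem fun h => hlt h.2]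
          refine tendsto_const_nhds.congr' ?_
          filter_upwards [hiff] with δ hδ
          rw [indicator_of_mem (mem_Ioi.2 hs), indicator_of_notMem fun h => hlt (hδ.1 h), zero_mul]
      · simp only [indicator_of_notMem (show s ∉ Ioi (0 : ℝ) from hs)]
        rw [indicator_of_notMem fun h => hs h.1]
        exact tendsto_const_nhds
  refine hmain.congr' ?_
  filter_upwards [self_mem_nhdsWithin] with δ hδ
  have hδ : 0 < δ := hδ
  rw [rayIntegral_illum hg hf hk hx (by positivity)]

lemma rayIntegral_illum_le (hg : BodyGauge g ρ R) (hf : Measurable f) (hk : Measurable k)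
    (hx : g x = 1) {δ b S M h₀ : ℝ} (hb : 0 < b) (hh₁ : h₀ ≤ 1)
    (hkM : ∀ w, g w ≤ 1 + h₀ → k w ≤ ENNReal.ofReal M)
    (hS : ∀ s, 0 < s → (1 + b * s) • x ∈ illum g f δ → s ≤ S ∧ b * s ≤ h₀) :
    BodyGauge.rayIntegral ((illum g f δ \ {z | g z ≤ 1}).indicator k) x / ENNReal.ofReal b ≤
      ENNReal.ofReal M * ENNReal.ofReal (2 ^ (Module.finrank ℝ E - 1)) * ENNReal.ofReal S := by
  rw [rayIntegral_illum hg hf hk hx hb]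
  have e : ENNReal.ofReal M * ENNReal.ofReal (2 ^ (Module.finrank ℝ E - 1)) * ENNReal.ofReal S =
      ∫⁻ s : ℝ, (Icc 0 S).indicator
        (fun _ => ENNReal.ofReal M * ENNReal.ofReal (2 ^ (Module.finrank ℝ E - 1))) s := by
    rw [lintegral_indicator measurableSet_Icc, setLIntegral_const, Real.volume_Icc, sub_zero]
  rw [e]
  refine lintegral_mono fun s => ?_
  by_cases hs : 0 < s
  · rw [indicator_of_mem (mem_Ioi.2 hs)]
    by_cases hm : (1 + b * s) • x ∈ illum g f δ
    · obtain ⟨h1, h2⟩ := hS s hs hm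
      have hbs : 0 < b * s := mul_pos hb hs
      rw [indicator_of_mem hm, indicator_of_mem (show s ∈ Icc 0 S from ⟨hs.le, h1⟩)]
      refine mul_le_mul' (hkM _ ?_) (ENNReal.ofReal_le_ofReal ?_)
      · rw [hg.smul (by linarith), hx]; linarith
      · exact pow_le_pow_left₀ (by linarith) (by linarith) _
    · rw [indicator_of_notMem hm, zero_mul]
      exact zero_le
  · rw [indicator_of_notMem (show s ∉ Ioi (0 : ℝ) from hs)]
    exact zero_le

/-- The limit of `V((1 + t) x) / t^((n+1)/2)`, where `V` is the `f`-volume of the cap. -/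
def capLimit (f : E → ℝ≥0∞) (x p : E) (B : E →L[ℝ] E) : ℝ≥0∞ :=
  ENNReal.ofReal ‖p‖⁻¹ * (f x * (ENNReal.ofReal (coneConst (Submodule.span ℝ {‖p‖⁻¹ • p})ᗮ) /
    ENNReal.ofReal √(LinearMap.det (tangentOp B (‖p‖⁻¹ • p)))))

/-- Polar coordinates turn the shell mass into a boundary integral to which dominated convergence
applies, with the exponent `β = (n-1)/(n+1) < 1` in `exists_rolling_bound`. Since `F` is prescribed
only at points with an expansion, its measurability is obtained from being an almost everywhere
limit. -/
theorem tendsto_lintegral_illum (hg : BodyGauge g ρ R) (hE : 2 ≤ Module.finrank ℝ E)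
    (hf : Measurable f) (hk : Measurable k) {c h₀ M : ℝ} (hc : 0 < c) (hh₀ : 0 < h₀) (hh₁ : h₀ ≤ 1)
    (hfc : ∀ w, g w ≤ 1 + h₀ → ENNReal.ofReal c ≤ f w)
    (hkM : ∀ w, g w ≤ 1 + h₀ → k w ≤ ENNReal.ofReal M)
    (hfcont : ∀ x, g x = 1 → ContinuousAt f x ∧ f x ≠ ⊤)
    (hkcont : ∀ x, g x = 1 → ContinuousAt k x) {F : E → ℝ≥0∞}
    (hF : ∀ x p B, g x = 1 → HasSecondOrderExpansion g x p B →
      F x = ENNReal.ofReal ‖p‖⁻¹ * (k x * ENNReal.ofReal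
        ((capLimit f x p B)⁻¹.toReal ^ (2 / ((Module.finrank ℝ E : ℝ) + 1))))) :
    AEMeasurable F ((Measure.euclideanHausdorffMeasure (Module.finrank ℝ E - 1)).restrict
      {x | g x = 1}) ∧
    ∫⁻ x in {x | g x = 1}, F x ∂(Measure.euclideanHausdorffMeasure (Module.finrank ℝ E - 1)) < ⊤ ∧
    Tendsto (fun δ => (∫⁻ w in illum g f δ \ {z | g z ≤ 1}, k w) /
        ENNReal.ofReal (δ ^ (2 / ((Module.finrank ℝ E : ℝ) + 1)))) (𝓝[>] 0)
      (𝓝 (∫⁻ x in {x | g x = 1}, F x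
        ∂(Measure.euclideanHausdorffMeasure (Module.finrank ℝ E - 1)))) := by
  have : Nontrivial E := Module.nontrivial_of_finrank_pos (R := ℝ) (by omega)
  set n := Module.finrank ℝ E with hn
  set μ : Measure E := (Measure.euclideanHausdorffMeasure (n - 1)).restrict {x | g x = 1} with hμ
  set α := 2 / ((n : ℝ) + 1) with hα
  have hn2 : (2 : ℝ) ≤ n := by exact_mod_cast hE
  set β := ((n : ℝ) - 1) / ((n : ℝ) + 1) with hβ
  have hβ0 : 0 ≤ β := div_nonneg (by linarith) (by linarith)
  have hβ1 : β < 1 := by rw [hβ, div_lt_one (by linarith)]; linarith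
  obtain ⟨D, hDm, hDi, hD⟩ := hg.exists_rolling_bound hβ0 hβ1
  obtain ⟨C, hC, δ₀, hδ₀, hbound⟩ := illum_bound hg hc hh₀ hh₁ hfc
  have hKm : MeasurableSet {z : E | g z ≤ 1} :=
    measurableSet_le hg.continuous.measurable measurable_const
  have hSm : MeasurableSet {x : E | g x = 1} := hg.continuous.measurable (measurableSet_singleton 1)
  have hset : ∀ δ, MeasurableSet (illum g f δ \ {z | g z ≤ 1}) := fun δ =>
    (measurableSet_illum hg hf δ).diff hKm
  have haeD : ∀ᵐ x ∂μ, D x < ⊤ := ae_lt_top hDm hDi.ne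
  have haeS : ∀ᵐ x ∂μ, g x = 1 := ae_restrict_mem hSm
  have haeE := hg.ae_boundary_expansion
  set J : ℝ → E → ℝ≥0∞ := fun δ x => BodyGauge.conormal g x *
    (BodyGauge.rayIntegral ((illum g f δ \ {z | g z ≤ 1}).indicator k) x / ENNReal.ofReal (δ ^ α))
    with hJ
  have hJm : ∀ δ, Measurable (J δ) := fun δ =>
    BodyGauge.measurable_conormal.mul
      ((BodyGauge.measurable_rayIntegral (hk.indicator (hset δ))).div_const _)
  -- `R` bounds the conormal factor, `M` the density `k`, `2^(n-1)` the polar weight up to parameter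
  -- `1 + h₀ ≤ 2`, and `C D` the rescaled ray length.
  set bd : E → ℝ≥0∞ := fun x => ENNReal.ofReal R * (ENNReal.ofReal M *
    ENNReal.ofReal (2 ^ (n - 1)) * (ENNReal.ofReal C * D x)) with hbd
  have hcon : ∀ x p B, g x = 1 → HasSecondOrderExpansion g x p B →
      0 < ‖p‖ ∧ ‖p‖⁻¹ ≤ R ∧ BodyGauge.conormal g x = ENNReal.ofReal ‖p‖⁻¹ := by
    intro x p B hx h
    obtain ⟨hpx, hp⟩ := hg.expansion_support h
    rw [hx] at hpx
    obtain ⟨hpn, -, hpR⟩ := hg.inv_norm_support hx hpx hp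
    refine ⟨hpn, hpR, ?_⟩
    rw [BodyGauge.conormal, h.hasFDerivAt.fderiv, innerSL_apply_norm, ENNReal.ofReal_inv_of_pos hpn]
  have hJb : ∀ δ, 0 < δ → δ < δ₀ → ∀ᵐ x ∂μ, J δ x ≤ bd x := by
    intro δ hδ0 hδ
    have hδα : 0 < δ ^ α := by positivity
    filter_upwards [haeD, haeS, haeE] with x hDx hx ⟨p, B, h⟩
    obtain ⟨hpn, hpR, hcx⟩ := hcon x p B hx h
    obtain ⟨r, hr, hxr, hrD⟩ := hD x hx hDx
    have h1 := rayIntegral_illum_le hg hf hk hx (S := C * r ^ (-β)) hδα hh₁ hkM (by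
      intro s hs hm
      obtain ⟨h2, h3⟩ := hbound δ hδ0 hδ x hx (δ ^ α * s) (mul_pos hδα hs) hm
      refine ⟨?_, h2⟩
      have h4 := h3 r hr hxr
      rw [mul_comm (δ ^ α) s] at h4
      exact le_of_mul_le_mul_right h4 hδα)
    simp only [hJ, hbd]
    rw [hcx]
    refine mul_le_mul' (ENNReal.ofReal_le_ofReal hpR) (h1.trans ?_)
    rw [ENNReal.ofReal_mul hC.le]
    gcongr
  have hJl : ∀ᵐ x ∂μ, Tendsto (fun δ => J δ x) (𝓝[>] 0) (𝓝 (F x)) := by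
    filter_upwards [haeD, haeS, haeE] with x hDx hx ⟨p, B, h⟩
    obtain ⟨hpn, hpR, hcx⟩ := hcon x p B hx h
    obtain ⟨r, hr, hxr, hrD⟩ := hD x hx hDx
    obtain ⟨hfx, hftop⟩ := hfcont x hx
    have hf0 : f x ≠ 0 :=
      ((ENNReal.ofReal_pos.2 hc).trans_le (hfc x (by rw [hx]; linarith))).ne'
    have hktop : k x ≠ ⊤ :=
      ((hkM x (by rw [hx]; linarith)).trans_lt ENNReal.ofReal_lt_top).ne
    have hL := tendsto_capVolume hg hx h hpn hE hf hfx hf0 hftop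
    have hL0 : capLimit f x p B ≠ 0 := by
      rw [capLimit]
      refine mul_ne_zero (ENNReal.ofReal_pos.2 (inv_pos.2 hpn)).ne' (mul_ne_zero hf0 ?_)
      exact (ENNReal.div_pos (ENNReal.ofReal_pos.2 coneConst_pos).ne' ENNReal.ofReal_ne_top).ne'
    have h1 := tendsto_rayIntegral_illum hg hf hk hx (hkcont x hx) hktop hL0 hL
      (S := C * r ^ (-β)) (by
        filter_upwards [Ioo_mem_nhdsGT hδ₀] with δ hδ s hs hm
        have hδα : 0 < δ ^ α := Real.rpow_pos_of_pos hδ.1 _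
        have h4 := (hbound δ hδ.1 hδ.2 x hx (δ ^ α * s) (mul_pos hδα hs) hm).2 r hr hxr
        rw [mul_comm (δ ^ α) s] at h4
        exact le_of_mul_le_mul_right h4 hδα)
    rw [hF x p B hx h]
    simp only [hJ, hcx]
    exact ENNReal.Tendsto.const_mul h1 (Or.inr ENNReal.ofReal_ne_top)
  have hbdi : ∫⁻ x, bd x ∂μ ≠ ⊤ := by
    simp only [hbd]
    rw [lintegral_const_mul' _ _ ENNReal.ofReal_ne_top, lintegral_const_mul' _ _
      (ENNReal.mul_ne_top ENNReal.ofReal_ne_top ENNReal.ofReal_ne_top),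
      lintegral_const_mul' _ _ ENNReal.ofReal_ne_top]
    exact ENNReal.mul_ne_top ENNReal.ofReal_ne_top (ENNReal.mul_ne_top
      (ENNReal.mul_ne_top ENNReal.ofReal_ne_top ENNReal.ofReal_ne_top)
      (ENNReal.mul_ne_top ENNReal.ofReal_ne_top hDi.ne))
  have hJbe : ∀ᶠ δ in 𝓝[>] (0 : ℝ), ∀ᵐ x ∂μ, J δ x ≤ bd x := by
    filter_upwards [Ioo_mem_nhdsGT hδ₀] with δ hδ using hJb δ hδ.1 hδ.2
  have hlim : Tendsto (fun δ => ∫⁻ x, J δ x ∂μ) (𝓝[>] 0) (𝓝 (∫⁻ x, F x ∂μ)) :=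
    tendsto_lintegral_filter_of_dominated_convergence bd (Eventually.of_forall hJm) hJbe hbdi hJl
  refine ⟨aemeasurable_of_tendsto_metrizable_ae (𝓝[>] (0 : ℝ)) (fun δ => (hJm δ).aemeasurable) hJl,
    ?_, ?_⟩
  · refine lt_of_le_of_lt (le_of_tendsto hlim ?_) (lt_top_iff_ne_top.2 hbdi)
    filter_upwards [hJbe] with δ hδ using lintegral_mono_ae hδ
  · refine hlim.congr' ?_
    filter_upwards [self_mem_nhdsWithin] with δ hδ
    have hδ : 0 < δ := hδ
    rw [← lintegral_indicator (hset δ), hg.polar (hk.indicator (hset δ)), ENNReal.div_eq_inv_mul,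
      ← lintegral_const_mul' _ _ (ENNReal.inv_ne_top.2 (ENNReal.ofReal_pos.2 (by positivity)).ne')]
    refine lintegral_congr fun x => ?_
    simp only [hJ]
    rw [ENNReal.div_eq_inv_mul, mul_left_comm]

end Illum

end Illumination
end

/-! ### The weighted theorem and its constant -/

noncomputable section

namespace Illumination

open scoped ENNReal NNReal

section Final

variable {n : ℕ}

lemma exists_bodyGauge (K : ConvexBody (EuclideanSpace ℝ (Fin n)))
    (hK : (0 : EuclideanSpace ℝ (Fin n)) ∈ interior (K : Set (EuclideanSpace ℝ (Fin n)))) :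
    ∃ ρ R, BodyGauge (gauge (K : Set (EuclideanSpace ℝ (Fin n)))) ρ R := by
  have hn : (K : Set (EuclideanSpace ℝ (Fin n))) ∈ 𝓝 0 := mem_interior_iff_mem_nhds.1 hK
  obtain ⟨ρ, hρ, hball⟩ := Metric.mem_nhds_iff.1 hn
  obtain ⟨R, hR, hsub⟩ := K.isCompact.isBounded.subset_closedBall_lt 0 0
  refine ⟨ρ, R, hρ, hR, fun ht => ?_, ?_, fun x => ?_, fun x => ?_⟩
  · intro x
    rw [gauge_smul_of_nonneg ht, smul_eq_mul]
  · exact fun x y => gauge_add_le K.convex (absorbent_nhds_zero hn) x y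
  · rw [le_div_iff₀ hρ, mul_comm]
    exact mul_gauge_le_norm hball
  · exact le_gauge_of_subset_closedBall (absorbent_nhds_zero hn) hR.le hsub

/-- The apex is removed because `cap` never contains it, while the hull does; the difference is a
null set for every weighted volume. -/
lemma hullWith_diff {g : EuclideanSpace ℝ (Fin n) → ℝ} {K : Set (EuclideanSpace ℝ (Fin n))}
    (hKc : Convex ℝ K) (hKne : K.Nonempty) (hK : K = {z | g z ≤ 1}) (z : EuclideanSpace ℝ (Fin n)) :
    (hullWith z K \ K) \ {z} = cap g z := by
  ext w
  rw [mem_cap_iff, hullWith, singleton_union, convexHull_insert hKne, hKc.convexHull_eq,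
    convexJoin_singleton_left]
  have hKm : ∀ v, v ∈ K ↔ g v ≤ 1 := fun v => by rw [hK]; rfl
  constructor
  · rintro ⟨⟨h1, h2⟩, h3⟩
    rw [hKm, not_le] at h2
    simp only [mem_iUnion] at h1
    obtain ⟨k, hk, a, b, ha, hb, hab, rfl⟩ := h1
    refine ⟨h2, h3, k, (hKm k).1 hk, b, ⟨hb, by linarith⟩, ?_⟩
    rw [← hab, add_sub_cancel_right]
  · rintro ⟨h1, h2, k, hk, μ, ⟨hμ0, hμ1⟩, rfl⟩
    refine ⟨⟨?_, by rw [hKm, not_le]; exact h1⟩, h2⟩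
    simp only [mem_iUnion]
    exact ⟨k, (hKm k).2 hk, 1 - μ, μ, by linarith, hμ0, by ring, rfl⟩

lemma weightedVol_eq {U : Set (EuclideanSpace ℝ (Fin n))} (hU : IsOpen U)
    (φ : EuclideanSpace ℝ (Fin n) → ℝ) :
    weightedVol U φ = volume.withDensity (U.indicator fun x => ENNReal.ofReal (φ x)) := by
  rw [weightedVol, withDensity_indicator hU.measurableSet]

lemma measurable_weight {U : Set (EuclideanSpace ℝ (Fin n))} (hU : IsOpen U)
    {φ : EuclideanSpace ℝ (Fin n) → ℝ} (hφ : ContinuousOn φ U) :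
    Measurable (U.indicator fun x => ENNReal.ofReal (φ x)) := by
  classical
  have h := (ENNReal.continuous_ofReal.comp_continuousOn hφ).measurable_piecewise
    (g := 0) continuousOn_const hU.measurableSet
  rwa [piecewise_eq_indicator] at h

lemma continuousAt_weight {U : Set (EuclideanSpace ℝ (Fin n))} (hU : IsOpen U)
    {φ : EuclideanSpace ℝ (Fin n) → ℝ} (hφ : ContinuousOn φ U) {x : EuclideanSpace ℝ (Fin n)}
    (hx : x ∈ U) : ContinuousAt (U.indicator fun x => ENNReal.ofReal (φ x)) x := by
  have h : ContinuousAt (fun x => ENNReal.ofReal (φ x)) x :=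
    ENNReal.continuous_ofReal.continuousAt.comp (hφ.continuousAt (hU.mem_nhds hx))
  refine h.congr ?_
  filter_upwards [hU.mem_nhds hx] with y hy
  rw [indicator_of_mem hy]

lemma illuminationBody_eq [NeZero n] {g : EuclideanSpace ℝ (Fin n) → ℝ} {ρ R : ℝ}
    (hg : BodyGauge g ρ R) {K U : Set (EuclideanSpace ℝ (Fin n))}
    (hKc : Convex ℝ K) (hKne : K.Nonempty) (hK : K = {z | g z ≤ 1}) (hU : IsOpen U)
    (φ : EuclideanSpace ℝ (Fin n) → ℝ) (δ : ℝ) :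
    illuminationBody U φ K δ = illum g (U.indicator fun x => ENNReal.ofReal (φ x)) δ := by
  ext z
  have h0 : weightedVol U φ {z} = 0 := by
    rw [weightedVol_eq hU]
    exact withDensity_absolutelyContinuous _ _ (measure_singleton z)
  rw [illuminationBody, illum, mem_ofPred_eq, mem_ofPred_eq, ← measure_sdiff_null h0,
    hullWith_diff hKc hKne hK, weightedVol_eq hU, withDensity_apply _ (measurableSet_cap hg z)]

/-- The relation between the limit of the cap volumes and the constant in the theorem. -/
lemma illumination_density_eq {n : ℕ} (hn : 2 ≤ n) {P D ω a b : ℝ} (hP : 0 < P) (hD : 0 ≤ D)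
    (hω : 0 < ω) (ha : 0 < a) :
    P * (b * (P * (a * (√2 ^ (n + 1) * ω / (n * (n + 1)) / √D)))⁻¹ ^ (2 / ((n : ℝ) + 1))) =
      1 / 2 * ((n : ℝ) * ((n : ℝ) + 1) / ω) ^ (2 / ((n : ℝ) + 1)) *
        ((P ^ (n - 1) * D) ^ (1 / ((n : ℝ) + 1)) * a ^ (-(2 / ((n : ℝ) + 1))) * b) := by
  have hn0 : (0 : ℝ) < n := by positivity
  set α := 2 / ((n : ℝ) + 1) with hα
  have hα0 : 0 < α := by positivity
  -- This power is the origin of the factor `1 / 2` in the constant.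
  have h2 : (√(2 : ℝ) ^ (n + 1)) ^ α = 2 := by
    rw [sqrt_pow_rpow zero_le_two]
    have : ((n + 1 : ℕ) : ℝ) / 2 * α = 1 := by rw [hα]; push_cast; field_simp
    rw [this, Real.rpow_one]
  have hDα : √D ^ α = D ^ (1 / ((n : ℝ) + 1)) := by
    rw [Real.sqrt_eq_rpow, ← Real.rpow_mul hD]
    congr 1
    rw [hα]; field_simp
  -- The conormal factor `P` and the power of `P⁻¹` in the threshold combine to `P^((n-1)/(n+1))`,
  -- which is what turns `det` into the curvature.
  have hPα : P * (P⁻¹) ^ α = (P ^ (n - 1)) ^ (1 / ((n : ℝ) + 1)) := by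
    rw [Real.inv_rpow hP.le, ← Real.rpow_neg hP.le, ← Real.rpow_one_add' hP.le, ← Real.rpow_natCast,
      ← Real.rpow_mul hP.le, Nat.cast_sub (by omega)]
    · congr 1
      rw [hα]
      push_cast
      field_simp
      ring
    · rw [hα]
      have : (2 : ℝ) ≤ n := by exact_mod_cast hn
      have : 2 / ((n : ℝ) + 1) < 1 := by rw [div_lt_one (by linarith)]; linarith
      linarith
  have e : (P * (a * (√2 ^ (n + 1) * ω / (n * (n + 1)) / √D)))⁻¹ =
      P⁻¹ * (a⁻¹ * ((√2 ^ (n + 1))⁻¹ * ((n : ℝ) * ((n : ℝ) + 1) / ω) * √D)) := by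
    rw [mul_inv, mul_inv, inv_div]
    field_simp
  rw [e, Real.mul_rpow (by positivity) (by positivity), Real.mul_rpow (by positivity) (by positivity),
    Real.mul_rpow (by positivity) (by positivity), Real.mul_rpow (by positivity) (by positivity),
    Real.inv_rpow (x := √2 ^ (n + 1)) (by positivity), h2, hDα, Real.inv_rpow ha.le,
    Real.mul_rpow (by positivity) hD, ← hPα, Real.rpow_neg ha.le]
  ring

/-- A slightly dilated copy of the compact body still lies in `U`, and continuous functions attain
their bounds on it. -/
lemma exists_weight_bounds {g : EuclideanSpace ℝ (Fin n) → ℝ} {ρ R : ℝ} (hg : BodyGauge g ρ R)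
    {U : Set (EuclideanSpace ℝ (Fin n))} (hU : IsOpen U) (hKU : {z | g z ≤ 1} ⊆ U)
    {φ ψ : EuclideanSpace ℝ (Fin n) → ℝ} (hφc : ContinuousOn φ U) (hφpos : ∀ x ∈ U, 0 < φ x)
    (hψc : ContinuousOn ψ U) :
    ∃ h₀ c M : ℝ, 0 < h₀ ∧ h₀ ≤ 1 ∧ 0 < c ∧ ∀ w, g w ≤ 1 + h₀ → w ∈ U ∧ c ≤ φ w ∧ ψ w ≤ M := by
  obtain ⟨η, hη, hηU⟩ := (hg.isCompact_le 1).exists_cthickening_subset_open hU hKU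
  have hR := hg.pos_R
  set h₀ := min 1 (η / R) with hh₀
  have h0 : 0 < h₀ := by positivity
  have hsub : {w | g w ≤ 1 + h₀} ⊆ U := by
    intro w hw
    have hw : g w ≤ 1 + h₀ := hw
    have h1 : 0 < 1 + h₀ := by linarith
    refine hηU (Metric.mem_cthickening_of_dist_le w ((1 + h₀)⁻¹ • w) η _ ?_ ?_)
    · rw [mem_ofPred_eq, hg.smul (by positivity), inv_mul_le_one₀ h1]
      exact hw
    · have e : w - (1 + h₀)⁻¹ • w = (h₀ / (1 + h₀)) • w := by
        match_scalars
        field_simp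
        ring
      rw [dist_eq_norm, e, norm_smul, Real.norm_of_nonneg (by positivity)]
      have h2 := hg.norm_le_of_gauge_le hw
      calc h₀ / (1 + h₀) * ‖w‖ ≤ h₀ / (1 + h₀) * ((1 + h₀) * R) := by gcongr
        _ = h₀ * R := by field_simp
        _ ≤ η / R * R := by gcongr; exact min_le_right _ _
        _ = η := by field_simp
  have hcpt := hg.isCompact_le (1 + h₀)
  have hne : {w | g w ≤ 1 + h₀}.Nonempty := ⟨0, by rw [mem_ofPred_eq, hg.zero]; linarith⟩
  obtain ⟨w₁, hw₁, hmin⟩ := hcpt.exists_isMinOn hne (hφc.mono hsub)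
  obtain ⟨w₂, hw₂, hmax⟩ := hcpt.exists_isMaxOn hne (hψc.mono hsub)
  exact ⟨h₀, φ w₁, ψ w₂, h0, min_le_left _ _, hφpos _ (hsub hw₁), fun w hw =>
    ⟨hsub hw, hmin hw, hmax hw⟩⟩

lemma gaussKronecker_nonneg {g : EuclideanSpace ℝ (Fin n) → ℝ} {ρ R : ℝ} (hg : BodyGauge g ρ R)
    {K : Set (EuclideanSpace ℝ (Fin n))} (hK : K = {z | g z ≤ 1}) {x p : EuclideanSpace ℝ (Fin n)}
    {B : EuclideanSpace ℝ (Fin n) →L[ℝ] EuclideanSpace ℝ (Fin n)} (hx : g x = 1)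
    (h : HasSecondOrderExpansion g x p B) :
    0 ≤ LinearMap.det (tangentOp B (‖p‖⁻¹ • p)) ∧
    gaussKronecker K x = ‖p‖⁻¹ ^ (n - 1) * LinearMap.det (tangentOp B (‖p‖⁻¹ • p)) := by
  have hpn := expansion_ne_zero hg hx h
  have hfr := finrank_orthogonal_add_one (e := ‖p‖⁻¹ • p)
    (smul_ne_zero (inv_ne_zero hpn.ne') (norm_pos_iff.1 hpn))
  rw [finrank_euclideanSpace_fin] at hfr
  refine ⟨det_nonneg_of_inner_nonneg (isSymmetric_tangentOp h.1 _) fun y => ?_, ?_⟩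
  · rw [inner_tangentOp]
    exact hg.expansion_nonneg h y
  · rw [gaussKronecker_eq_det hg hK hx h, LinearMap.det_smul,
      show Module.finrank ℝ (Submodule.span ℝ {‖p‖⁻¹ • p})ᗮ = n - 1 by omega]

lemma capLimit_density {g : EuclideanSpace ℝ (Fin n) → ℝ} {ρ R : ℝ} (hg : BodyGauge g ρ R)
    (hn : 2 ≤ n) {K : Set (EuclideanSpace ℝ (Fin n))} (hK : K = {z | g z ≤ 1})
    {x p : EuclideanSpace ℝ (Fin n)} {f k : EuclideanSpace ℝ (Fin n) → ℝ≥0∞}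
    {B : EuclideanSpace ℝ (Fin n) →L[ℝ] EuclideanSpace ℝ (Fin n)} (hx : g x = 1)
    (h : HasSecondOrderExpansion g x p B) {a b : ℝ} (ha : 0 < a) (hb : 0 ≤ b)
    (hf : f x = ENNReal.ofReal a) (hk : k x = ENNReal.ofReal b) :
    ENNReal.ofReal (illuminationConst n * (gaussKronecker K x ^ (1 / ((n : ℝ) + 1)) *
      a ^ (-(2 / ((n : ℝ) + 1))) * b)) =
      ENNReal.ofReal ‖p‖⁻¹ * (k x * ENNReal.ofReal
        ((capLimit f x p B)⁻¹.toReal ^ (2 / ((n : ℝ) + 1)))) := by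
  have hpn := expansion_ne_zero hg hx h
  obtain ⟨hdet, hH⟩ := gaussKronecker_nonneg hg hK hx h
  have hfr := finrank_orthogonal_add_one (e := ‖p‖⁻¹ • p)
    (smul_ne_zero (inv_ne_zero hpn.ne') (norm_pos_iff.1 hpn))
  rw [finrank_euclideanSpace_fin] at hfr
  have hfd : Module.finrank ℝ (Submodule.span ℝ {‖p‖⁻¹ • p})ᗮ = n - 1 := by omega
  have : Nontrivial (Submodule.span ℝ {‖p‖⁻¹ • p})ᗮ :=
    Module.nontrivial_of_finrank_pos (R := ℝ) (by omega)
  have hω0 : 0 < volume.real (Metric.closedBall (0 : EuclideanSpace ℝ (Fin (n - 1))) 1) :=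
    ENNReal.toReal_pos (Metric.measure_closedBall_pos _ _ one_pos).ne' measure_closedBall_lt_top.ne
  have hcone : coneConst (Submodule.span ℝ {‖p‖⁻¹ • p})ᗮ = √2 ^ (n + 1) *
      volume.real (Metric.closedBall (0 : EuclideanSpace ℝ (Fin (n - 1))) 1) / (n * (n + 1)) := by
    rw [coneConst, hfd, Measure.real, Measure.real, ← Measure.addHaar_closedBall_eq_addHaar_ball,
      volume_closedBall_euclidean hfd, show n - 1 + 2 = n + 1 by omega, Nat.cast_sub (by omega)]
    congr 2 <;> push_cast <;> ring
  -- If the determinant vanishes, `capLimit` is infinite and the inverse on the left is `0`;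
  -- division by zero in `ℝ` makes the right side `0` as well, in agreement with the vanishing
  -- curvature.
  have hcap : (capLimit f x p B)⁻¹.toReal = (‖p‖⁻¹ * (a * (√2 ^ (n + 1) *
      volume.real (Metric.closedBall (0 : EuclideanSpace ℝ (Fin (n - 1))) 1) / (n * (n + 1)) /
        √(LinearMap.det (tangentOp B (‖p‖⁻¹ • p))))))⁻¹ := by
    rw [capLimit, hf, hcone, ENNReal.toReal_inv, ENNReal.toReal_mul, ENNReal.toReal_mul,
      ENNReal.toReal_div, ENNReal.toReal_ofReal (by positivity), ENNReal.toReal_ofReal ha.le,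
      ENNReal.toReal_ofReal (by positivity), ENNReal.toReal_ofReal (by positivity)]
  rw [hk, ← ENNReal.ofReal_mul hb, ← ENNReal.ofReal_mul (by positivity), hcap,
    illumination_density_eq hn (inv_pos.2 hpn) hdet hω0 ha, ← hH, illuminationConst]

theorem tendsto_weightedVol_illuminationBody (hn : 2 ≤ n)
    (K : ConvexBody (EuclideanSpace ℝ (Fin n)))
    (hK : (0 : EuclideanSpace ℝ (Fin n)) ∈ interior (K : Set (EuclideanSpace ℝ (Fin n))))
    (U : Set (EuclideanSpace ℝ (Fin n))) (hU : IsOpen U)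
    (hKU : (K : Set (EuclideanSpace ℝ (Fin n))) ⊆ U)
    (φ ψ : EuclideanSpace ℝ (Fin n) → ℝ)
    (hφc : ContinuousOn φ U) (hφpos : ∀ x ∈ U, 0 < φ x)
    (hψc : ContinuousOn ψ U) (hψpos : ∀ x ∈ U, 0 < ψ x) (hψi : IntegrableOn ψ U volume) :
    IntegrableOn
      (fun x => gaussKronecker (K : Set (EuclideanSpace ℝ (Fin n))) x
          ^ (1 / ((n : ℝ) + 1)) * φ x ^ (-(2 / ((n : ℝ) + 1))) * ψ x)
      (frontier (K : Set (EuclideanSpace ℝ (Fin n))))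
      (Measure.euclideanHausdorffMeasure (n - 1)) ∧
    Tendsto
      (fun δ : ℝ =>
        ((weightedVol U ψ).real (illuminationBody U φ (K : Set (EuclideanSpace ℝ (Fin n))) δ)
          - (weightedVol U ψ).real (K : Set (EuclideanSpace ℝ (Fin n))))
          / δ ^ (2 / ((n : ℝ) + 1)))
      (𝓝[>] 0)
      (𝓝 (illuminationConst n *
        ∫ x in frontier (K : Set (EuclideanSpace ℝ (Fin n))),
          gaussKronecker (K : Set (EuclideanSpace ℝ (Fin n))) x
            ^ (1 / ((n : ℝ) + 1)) * φ x ^ (-(2 / ((n : ℝ) + 1))) * ψ x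
          ∂(Measure.euclideanHausdorffMeasure (n - 1)))) := by
  have : NeZero n := ⟨by omega⟩
  obtain ⟨ρ, R, hg⟩ := exists_bodyGauge K hK
  set S : Set (EuclideanSpace ℝ (Fin n)) := (K : Set (EuclideanSpace ℝ (Fin n))) with hS
  set g := gauge S with hgdef
  have hnhds : S ∈ 𝓝 0 := mem_interior_iff_mem_nhds.1 hK
  have hSg : S = {z | g z ≤ 1} := by
    ext z
    rw [mem_ofPred_eq, gauge_le_one_iff_mem_closure K.convex hnhds, K.isClosed.closure_eq]
  have hfront : frontier S = {z | g z = 1} := by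
    ext z
    rw [mem_ofPred_eq, gauge_eq_one_iff_mem_frontier K.convex hnhds]
  have hfin : Module.finrank ℝ (EuclideanSpace ℝ (Fin n)) = n := finrank_euclideanSpace_fin
  obtain ⟨h₀, c, M, hh₀, hh₁, hc, hwt⟩ :=
    exists_weight_bounds hg hU (hSg ▸ hKU) hφc hφpos hψc
  set f := U.indicator fun x => ENNReal.ofReal (φ x) with hf
  set k := U.indicator fun x => ENNReal.ofReal (ψ x) with hk
  have hfm : Measurable f := measurable_weight hU hφc
  have hkm : Measurable k := measurable_weight hU hψc
  have hSU : ∀ x, g x = 1 → x ∈ U := fun x hx => hKU (by rw [hSg]; exact hx.le)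
  set Fr : EuclideanSpace ℝ (Fin n) → ℝ := fun x => gaussKronecker S x
    ^ (1 / ((n : ℝ) + 1)) * φ x ^ (-(2 / ((n : ℝ) + 1))) * ψ x with hFr
  have hmain := tendsto_lintegral_illum hg (by rw [hfin]; exact hn) hfm hkm hc hh₀ hh₁
    (fun w hw => by
      rw [hf, indicator_of_mem (hwt w hw).1]
      exact ENNReal.ofReal_le_ofReal (hwt w hw).2.1)
    (fun w hw => by
      rw [hk, indicator_of_mem (hwt w hw).1]
      exact ENNReal.ofReal_le_ofReal (hwt w hw).2.2)
    (fun x hx => ⟨continuousAt_weight hU hφc (hSU x hx), by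
      rw [hf, indicator_of_mem (hSU x hx)]; exact ENNReal.ofReal_ne_top⟩)
    (fun x hx => continuousAt_weight hU hψc (hSU x hx))
    (F := fun x => ENNReal.ofReal (illuminationConst n * Fr x))
    (fun x p B hx h => by
      rw [hfin]
      exact capLimit_density hg hn hSg hx h (hφpos x (hSU x hx)) (hψpos x (hSU x hx)).le
        (by rw [hf, indicator_of_mem (hSU x hx)]) (by rw [hk, indicator_of_mem (hSU x hx)]))
  have hexp := hg.ae_boundary_expansion
  rw [hfin] at hmain hexp
  obtain ⟨hFm, hFi, hlim⟩ := hmain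
  rw [hfront]
  set μ : Measure (EuclideanSpace ℝ (Fin n)) :=
    (Measure.euclideanHausdorffMeasure (n - 1)).restrict {x | g x = 1} with hμ
  have hcn : 0 < illuminationConst n := by
    have hω0 : 0 < volume.real (Metric.closedBall (0 : EuclideanSpace ℝ (Fin (n - 1))) 1) :=
      ENNReal.toReal_pos (Metric.measure_closedBall_pos _ _ one_pos).ne'
        measure_closedBall_lt_top.ne
    rw [illuminationConst]
    positivity
  have hmemS : ∀ᵐ x ∂μ, g x = 1 :=
    ae_restrict_mem (hg.continuous.measurable (measurableSet_singleton 1))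
  have hFr0 : ∀ᵐ x ∂μ, 0 ≤ illuminationConst n * Fr x := by
    filter_upwards [hmemS, hexp] with x hx ⟨p, B, h⟩
    obtain ⟨h1, h2⟩ := gaussKronecker_nonneg hg hSg hx h
    have h3 := (hφpos x (hSU x hx)).le
    have h4 := (hψpos x (hSU x hx)).le
    have h5 : 0 ≤ gaussKronecker S x := by rw [h2]; positivity
    simp only [hFr]
    positivity
  have hint' : Integrable (fun x => illuminationConst n * Fr x) μ := by
    refine ⟨?_, (hasFiniteIntegral_iff_ofReal hFr0).2 hFi⟩
    refine (hFm.ennreal_toReal.congr ?_).aestronglyMeasurable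
    filter_upwards [hFr0] with x hx
    exact ENNReal.toReal_ofReal hx
  have hint : Integrable Fr μ := by
    have := hint'.const_mul (illuminationConst n)⁻¹
    simpa [← mul_assoc, inv_mul_cancel₀ hcn.ne'] using this
  refine ⟨hint, ?_⟩
  have hval : ∫⁻ x, ENNReal.ofReal (illuminationConst n * Fr x) ∂μ =
      ENNReal.ofReal (illuminationConst n * ∫ x, Fr x ∂μ) := by
    rw [← integral_const_mul, ofReal_integral_eq_lintegral_ofReal hint' hFr0]
  have hI0 : 0 ≤ illuminationConst n * ∫ x, Fr x ∂μ := by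
    rw [← integral_const_mul]
    exact integral_nonneg_of_ae hFr0
  have hreal := (ENNReal.tendsto_toReal hFi.ne).comp hlim
  rw [hval, ENNReal.toReal_ofReal hI0] at hreal
  refine hreal.congr' ?_
  -- Finiteness of the ψ-volume allows the difference of real-valued measures to be written as the
  -- measure of the shell.
  have hfinite : IsFiniteMeasure (weightedVol U ψ) :=
    isFiniteMeasure_withDensity_ofReal hψi.2
  filter_upwards [self_mem_nhdsWithin] with δ hδ
  have hδ : 0 < δ := hδ
  have hsub : S ⊆ illum g f δ := by
    intro z hz
    have hz' : g z ≤ 1 := by rw [hSg] at hz; exact hz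
    have : cap g z = ∅ := by
      ext w
      simp only [mem_empty_iff_false, iff_false]
      exact fun hw => absurd (gauge_le_of_mem_cap hg hw) (not_le.2 (hz'.trans_lt hw.1))
    rw [illum, mem_ofPred_eq, this]
    simp
  have hSm : MeasurableSet S := K.isClosed.measurableSet
  rw [illuminationBody_eq hg K.convex K.nonempty hSg hU φ δ, ← hf,
    ← measureReal_sdiff hsub hSm, Function.comp_apply, ENNReal.toReal_div,
    ENNReal.toReal_ofReal (by positivity), Measure.real, weightedVol_eq hU,
    withDensity_apply _ ((measurableSet_illum hg hfm δ).diff hSm), ← hk, hSg]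

end Final

end Illumination
end

theorem mainTheorem1 (n : ℕ) (hn : 2 ≤ n) (K : ConvexBody (EuclideanSpace ℝ (Fin n)))
    (hK : (0 : EuclideanSpace ℝ (Fin n)) ∈ interior (K : Set (EuclideanSpace ℝ (Fin n))))
    (U : Set (EuclideanSpace ℝ (Fin n))) (hU : IsOpen U)
    (hKU : (K : Set (EuclideanSpace ℝ (Fin n))) ⊆ U)
    (φ ψ : EuclideanSpace ℝ (Fin n) → ℝ)
    (hφc : ContinuousOn φ U) (hφpos : ∀ x ∈ U, 0 < φ x) (hφi : IntegrableOn φ U volume)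
    (hψc : ContinuousOn ψ U) (hψpos : ∀ x ∈ U, 0 < ψ x) (hψi : IntegrableOn ψ U volume) :
    IntegrableOn
      (fun x => Illumination.gaussKronecker (K : Set (EuclideanSpace ℝ (Fin n))) x
          ^ (1 / ((n : ℝ) + 1)) * φ x ^ (-(2 / ((n : ℝ) + 1))) * ψ x)
      (frontier (K : Set (EuclideanSpace ℝ (Fin n))))
      (Measure.euclideanHausdorffMeasure (n - 1)) ∧
    Tendsto
      (fun δ : ℝ =>
        ((Illumination.weightedVol U ψ).real
            (Illumination.illuminationBody U φ (K : Set (EuclideanSpace ℝ (Fin n))) δ)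
          - (Illumination.weightedVol U ψ).real (K : Set (EuclideanSpace ℝ (Fin n))))
          / δ ^ (2 / ((n : ℝ) + 1)))
      (𝓝[>] 0)
      (𝓝 (Illumination.illuminationConst n *
        ∫ x in frontier (K : Set (EuclideanSpace ℝ (Fin n))),
          Illumination.gaussKronecker (K : Set (EuclideanSpace ℝ (Fin n))) x
            ^ (1 / ((n : ℝ) + 1)) * φ x ^ (-(2 / ((n : ℝ) + 1))) * ψ x
          ∂(Measure.euclideanHausdorffMeasure (n - 1)))) :=
  Illumination.tendsto_weightedVol_illuminationBody hn K hK U hU hKU φ ψ hφc hφpos hψc hψpos hψi
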